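/- All numbers are rationals of arbitrary precision. **Functions.** Let $\sigma(x)=\min(\max(x,0),1)$ and $\mathrm{relu}(x)=\max(x,0)$. A function $\mathbb Q^m\to\mathbb Q$ is *admissible* if it is built from rational constants and coordinates by addition, multiplication, division by an admissible function without zeros, $\sigma$ and $\mathrm{relu}$. A map $\mathbb Q^d\to\mathbb Q^e$ is admissible if all its coordinates are. A *feed-forward network* is a composition of affine maps over $\mathbb Q$ interleaved with coordinatewise applications of $\sigma$. **Attention.** Given a function $\mathrm{score}:\mathbb Q^d\times\mathbb Q^d\to\mathbb Q$ and normalization functions $\rho:\mathbb Q^n\to\mathbb Q^n$ ($n\ge 0$), put $\mathrm{Att}(q,(k_j),(v_j))=\sum_{j=1}^n s_jv_j$ with $(s_j)=\rho(\mathrm{score}(q,k_1),\dots,\mathrm{score}(q,k_n))$ (it is $0$ for $n=0$). Here $\rho$ is either $\mathrm{hardmax}$ (weight $1/r$ on each of the $r$ positions attaining the maximum, $0$ elsewhere), or $\rho_i(x)=f_\rho(x_i)/\sum_jf_\rho(x_j)$ for some admissible $f_\rho:\mathbb Q\to\mathbb Q_{>0}$. **Transformers.** A layer has parameter functions $Q,K,V,O:\mathbb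 Q^d\to\mathbb Q^d$. An encoder layer maps $(x_i)$ to $z_i=O(a_i)+a_i$, where $a_i=\mathrm{Att}(Q(x_i),K(X),V(X))+x_i$. A decoder layer maps $(y_i)$, given external keys and values $(K^e,V^e)$, to $z_i=O(a_i)+a_i$, where $p_i=\mathrm{Att}(Q(y_i),K(Y_i),V(Y_i))+y_i$, $a_i=\mathrm{Att}(p_i,K^e,V^e)+p_i$, and $Y_i$ is the sequence of the $y_j$ with $j\le i$. A *Transformer* consists of finitely many encoder layers, followed by two maps applied to every vector that produce $(K^e,V^e)=\mathrm{TEnc}(X)$, and finitely many decoder layers, followed by a map $F$ applied to the last vector, with value $\mathrm{TDec}((K^e,V^e),Y)$. With a *positional encoding* $\mathrm{pos}:\mathbb N\to\mathbb Q^d$ it produces, from $(x_1,\dots,x_n)$, a seed $y_0$ and $r\in\mathbb N$, the sequence $(y_1,\dots,y_r)$ with $$y_{t+1}=\mathrm{TDec}\big(\mathrm{TEnc}(x_1+\mathrm{pos}(1),\dots,x_n+\mathrm{pos}(n)),\,(y_0+\mathrm{pos}(1),\dots,y_t+\mathrm{pos}(t+1))\big).$$ The *class of Transformer networks with positional encodings*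 consists of these networks, in all dimensions $d>0$, with admissible score and parameter functions and with $\mathrm{pos}$ computable by a Turing machine in time linear in the number of bits of $i$. **Recognizers.** A *recognizer* over a finite alphabet $\Sigma$ consists of a seq-to-seq network $N$, an embedding $f:\Sigma\to\mathbb Q^d$ computable by a Turing machine in time linear in $|\Sigma|$, a seed $s\in\mathbb Q^d$, and a set $\mathbb F\subseteq\mathbb Q^d$ whose membership is decidable by a Turing machine in time linear in the number of bits of the vector. It accepts $w=a_1\cdots a_n\in\Sigma^*$ if for some $r\ge 1$ the last vector $y_r$ of $N((f(a_1),\dots,f(a_n)),s,r)$ lies in $\mathbb F$. A class of networks is *Turing complete* if, for every finite alphabet $\Sigma$, the languages over $\Sigma$ accepted by recognizers with networks in the class are exactly the languages over $\Sigma$ recognized by Turing machines. **Turing machines.** A machine has a finite state set $Q$, a finite tape alphabet $\Gamma\supseteq\Sigma\cup\{\#\}$ with blank $\#\notin\Sigma$, a partial transition function $Q\times\Gamma\rightharpoonup Q\times\Gamma\times\{\text{left},\text{stay},\text{right}\}$, an initial state and a set of accepting states. It has one two-way infinite tape and starts on the blank cell immediately to the left of the input; it accepts if it reaches an accepting state.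 It is in *normal form* if its head never stays and, on every input, never goes left of its initial position; its first step goes right into a state $q_{\mathrm{read}}$, in which it keeps moving right until it reads $\#$; and accepting states have no outgoing transitions. **Theorem.** The class of Transformer networks with positional encodings is Turing complete. Moreover, for every finite alphabet $\Sigma$, every Turing machine over $\Sigma$ is equivalent to one in normal form, and for every $M$ in normal form the language of $M$ is accepted by a recognizer whose network is a Transformer of dimension $d=2|Q|+4|\Gamma|+11$ with one encoder layer and three decoder layers, score $-|\langle q,k\rangle|$, hard attention ($\rho=\mathrm{hardmax}$), all parameter functions given by feed-forward networks, and the positional encoding $\mathrm{pos}(i)=(0,\dots,0,1,i,1/i,1/i^2)$. -/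

import Mathlib

namespace TransformerTC

open Turing Computability

/-- Vectors with rational entries of arbitrary precision. -/
abbrev Vec (d : ℕ) : Type := Fin d → ℚ

/-! ### Activations and admissible parameter functions -/

/-- The piecewise-linear sigmoidal activation. -/
def sigma (x : ℚ) : ℚ := if x < 0 then 0 else if x ≤ 1 then x else 1

/-- The rectifier. -/
def relu (x : ℚ) : ℚ := max x 0

/-- The scalar functions allowed inside a network: everywhere-defined functions obtained from
rational constants and coordinates by the field operations (division only by a function without
zeros) and the two piecewise-linear activations.  Every everywhere-defined rational function with
rational coefficients and every feed-forward network with these activations is of this form. -/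
inductive PiecewiseRational {ι : Type} : ((ι → ℚ) → ℚ) → Prop
  | const (c : ℚ) : PiecewiseRational (fun _ => c)
  | coord (i : ι) : PiecewiseRational (fun x => x i)
  | add {f g : (ι → ℚ) → ℚ} : PiecewiseRational f → PiecewiseRational g →
      PiecewiseRational (fun x => f x + g x)
  | mul {f g : (ι → ℚ) → ℚ} : PiecewiseRational f → PiecewiseRational g →
      PiecewiseRational (fun x => f x * g x)
  | div {f g : (ι → ℚ) → ℚ} : PiecewiseRational f → PiecewiseRational g → (∀ x, g x ≠ 0) →
      PiecewiseRational (fun x => f x / g x)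
  | sigma {f : (ι → ℚ) → ℚ} : PiecewiseRational f → PiecewiseRational (fun x => sigma (f x))
  | relu {f : (ι → ℚ) → ℚ} : PiecewiseRational f → PiecewiseRational (fun x => relu (f x))

/-- Vector-valued functions all of whose coordinates are piecewise rational. -/
def PiecewiseRationalMap {d e : ℕ} (f : Vec d → Vec e) : Prop :=
  ∀ i, PiecewiseRational (fun x => f x i)

/-- Feed-forward networks of arbitrary finite depth with rational weights and activation `sigma`:
affine maps `x ↦ x W + b`, interleaved with coordinatewise applications of `sigma`. -/
inductive FeedForward {m : ℕ} : {n : ℕ} → (Vec m → Vec n) → Prop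
  | affine {n : ℕ} (W : Matrix (Fin m) (Fin n) ℚ) (b : Vec n) :
      FeedForward (fun x => Matrix.vecMul x W + b)
  | layer {k n : ℕ} {g : Vec m → Vec k} (hg : FeedForward g)
      (W : Matrix (Fin k) (Fin n) ℚ) (b : Vec n) :
      FeedForward (fun x => Matrix.vecMul (fun i => sigma (g x i)) W + b)

/-! ### Attention -/

/-- A scoring function, taking a query and a key. -/
abbrev Score (d : ℕ) : Type := Vec d → Vec d → ℚ

/-- A normalization function, on score vectors of every length. -/
abbrev Normalization : Type := (n : ℕ) → (Fin n → ℚ) → Fin n → ℚ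

/-- Equal weight on all the positions where the maximum is attained, zero elsewhere. -/
def hardmax : Normalization := fun n x i =>
  if ∀ j, x j ≤ x i then
    1 / ((Finset.univ.filter (fun k : Fin n => ∀ j, x j ≤ x k)).card : ℚ)
  else 0

/-- `ρ` is either `hardmax` or of the form `ρ_i(x) = f(x_i) / ∑_j f(x_j)` for a positive
piecewise rational function `f`. -/
def IsNormalization (ρ : Normalization) : Prop :=
  ρ = hardmax ∨
    ∃ f : ℚ → ℚ, PiecewiseRational (fun x : Unit → ℚ => f (x ())) ∧ (∀ x, 0 < f x) ∧
      ∀ (n : ℕ) (x : Fin n → ℚ) (i : Fin n), ρ n x i = f (x i) / ∑ j, f (x j)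

/-- The attention `Att(q, K, V)`.  Over an empty sequence it is the empty sum `0`. -/
def att {d n : ℕ} (score : Score d) (ρ : Normalization) (q : Vec d) (K V : Fin n → Vec d) :
    Vec d :=
  ∑ i, ρ n (fun j => score q (K j)) i • V i

/-! ### Transformers -/

/-- The four parameter functions of a single encoder or decoder layer. -/
structure LayerParams (d : ℕ) where
  Q : Vec d → Vec d
  K : Vec d → Vec d
  V : Vec d → Vec d
  O : Vec d → Vec d

/-- A single-layer encoder: `a_i = Att(Q(x_i), K(X), V(X)) + x_i`, `z_i = O(a_i) + a_i`. -/
def encLayer {d n : ℕ} (score : Score d) (ρ : Normalization) (θ : LayerParams d)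
    (X : Fin n → Vec d) : Fin n → Vec d := fun i =>
  let a := att score ρ (θ.Q (X i)) (fun j => θ.K (X j)) (fun j => θ.V (X j)) + X i
  θ.O a + a

/-- A single-layer decoder, with self attention over the positions up to the current one followed
by attention over the external key-value pair:
`p_i = Att(Q(y_i), K(Y_i), V(Y_i)) + y_i`, `a_i = Att(p_i, Ke, Ve) + p_i`,
`z_i = O(a_i) + a_i`. -/
def decLayer {d n k : ℕ} (score : Score d) (ρ : Normalization) (θ : LayerParams d)
    (Ke Ve : Fin n → Vec d) (Y : Fin k → Vec d) : Fin k → Vec d := fun i =>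
  let Yi : Fin (i.val + 1) → Vec d := fun j => Y (Fin.castLE i.isLt j)
  let p := att score ρ (θ.Q (Y i)) (fun j => θ.K (Yi j)) (fun j => θ.V (Yi j)) + Y i
  let a := att score ρ p Ke Ve + p
  θ.O a + a

/-- A Transformer network of dimension `d`, with one entry of `enc` (`dec`) for each single-layer
encoder (decoder), in the order of application. -/
structure Transformer (d : ℕ) where
  score : Score d
  normalize : Normalization
  enc : List (LayerParams d)
  Kenc : Vec d → Vec d
  Venc : Vec d → Vec d
  dec : List (LayerParams d)
  F : Vec d → Vec d

namespace Transformer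

variable {d : ℕ} (T : Transformer d)

/-- The sequence produced by the encoder layers. -/
def encode {n : ℕ} (X : Fin n → Vec d) : Fin n → Vec d :=
  T.enc.foldl (fun Z θ => encLayer T.score T.normalize θ Z) X

/-- The encoder output `(K^e, V^e)`. -/
def tEnc {n : ℕ} (X : Fin n → Vec d) : (Fin n → Vec d) × (Fin n → Vec d) :=
  (fun i => T.Kenc (T.encode X i), fun i => T.Venc (T.encode X i))

/-- The decoder: `F` applied to the last vector produced by the decoder layers. -/
def tDec {n t : ℕ} (KV : (Fin n → Vec d) × (Fin n → Vec d)) (Y : Fin (t + 1) → Vec d) : Vec d :=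
  T.F (T.dec.foldl (fun Z θ => decLayer T.score T.normalize θ KV.1 KV.2 Z) Y (Fin.last t))

/-- The sequence `(y_0, …, y_t)`, where `y_0` is the seed and
`y_{t+1} = TDec(TEnc(x_1 + pos(1), …, x_n + pos(n)), (y_0 + pos(1), …, y_t + pos(t+1)))`. -/
def trace (pos : ℕ → Vec d) {n : ℕ} (X : Fin n → Vec d) (s : Vec d) : (t : ℕ) → Fin (t + 1) → Vec d
  | 0 => fun _ => s
  | t + 1 =>
    let Y := trace pos X s t
    Fin.snoc (α := fun _ => Vec d) Y
      (T.tDec (T.tEnc (fun i => X i + pos (i.val + 1))) (fun j => Y j + pos (j.val + 1)))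

end Transformer

/-! ### Sequence-to-sequence networks and language recognizers -/

/-- A seq-to-seq network: from an input sequence, a seed and a number `r` it produces an output
sequence `(y_1, …, y_r)`. -/
abbrev SeqToSeq (d : ℕ) : Type :=
  (n : ℕ) → (Fin n → Vec d) → Vec d → (r : ℕ) → Fin r → Vec d

/-- The seq-to-seq network of a Transformer with positional encoding `pos`. -/
def Transformer.net {d : ℕ} (T : Transformer d) (pos : ℕ → Vec d) : SeqToSeq d :=
  fun _ X s r i => T.trace pos X s r i.succ

/-- The alphabet in which rational vectors are written on tapes: bits (`Sum.inl`), and three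
further symbols, a minus sign, a fraction slash, and an end mark. -/
abbrev VecSym : Type := Bool ⊕ Fin 3

/-- Binary encoding of a rational number as a reduced signed fraction. -/
def encodeRat (q : ℚ) : List VecSym :=
  (if q < 0 then [Sum.inr 0] else []) ++ (encodeNat q.num.natAbs).map Sum.inl ++ [Sum.inr 1] ++
    (encodeNat q.den).map Sum.inl ++ [Sum.inr 2]

/-- Encoding of a rational vector, coordinate by coordinate. -/
def encodeVec {d : ℕ} (x : Vec d) : List VecSym :=
  (List.finRange d).flatMap fun i => encodeRat (x i)

/-- `f` is computed by a (multi-stack, equivalently multi-tape) Turing machine in time linear in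
the length of the encoded input. -/
def LinearTime {α β αΓ βΓ : Type} (ea : α → List αΓ) (eb : β → List βΓ) (f : α → β) : Prop :=
  ∃ c : ℕ, ∃ h : TM2ComputableInTime ea eb f, ∀ n, h.time n ≤ c * n + c

open Classical in
/-- A seq-to-seq language recognizer over the alphabet `S`. -/
structure Recognizer (S : Type) [Fintype S] (d : ℕ) where
  /-- embedding function -/
  embed : S → Vec d
  /-- the network -/
  network : SeqToSeq d
  /-- seed vector -/
  seed : Vec d
  /-- final vectors -/
  final : Set (Vec d)
  /-- the embedding is computed by a Turing machine in time linear in the size of the alphabet -/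
  embed_linear : ∃ c : ℕ, ∃ h : TM2ComputableInTime (fun a : S => [a]) encodeVec embed,
    ∀ n, h.time n ≤ c * Fintype.card S
  /-- membership in the set of final vectors is decided in linear time -/
  final_linear : LinearTime encodeVec encodeBool (fun x : Vec d => decide (x ∈ final))

namespace Recognizer

variable {S : Type} [Fintype S] {d : ℕ} (A : Recognizer S d)

/-- `w` is accepted if some output sequence (necessarily of positive length) ends in a final
vector. -/
def Accepts (w : List S) : Prop :=
  ∃ r : ℕ, A.network w.length (fun i => A.embed (w.get i)) A.seed (r + 1) (Fin.last r) ∈ A.final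

/-- The language accepted by a recognizer. -/
def language : Language S := {w | A.Accepts w}

end Recognizer

/-! ### Turing machines as language recognizers -/

/-- Head movements. -/
inductive Move
  | left
  | stay
  | right

/-- Head displacement. -/
def Move.toInt : Move → ℤ
  | left => -1
  | stay => 0
  | right => 1

/-- A deterministic Turing machine with one two-way infinite tape, input alphabet `S`,
tape alphabet `Γ` and a partial transition function. -/
structure TuringMachine (S : Type) where
  Q : Type
  [finQ : Fintype Q]
  Γ : Type
  [finΓ : Fintype Γ]
  blank : Γ
  /-- the input symbols, as symbols of the tape alphabet different from the blank -/
  input : S ↪ Γ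
  input_ne_blank : ∀ a, input a ≠ blank
  δ : Q → Γ → Option (Q × Γ × Move)
  init : Q
  accept : Set Q

attribute [instance] TuringMachine.finQ TuringMachine.finΓ

namespace TuringMachine

variable {S : Type} (M : TuringMachine S)

/-- A configuration: state, position of the head, contents of the tape. -/
structure Cfg where
  state : M.Q
  head : ℤ
  tape : ℤ → M.Γ

/-- One computation step; `none` when no transition applies. -/
def step (c : M.Cfg) : Option M.Cfg :=
  (M.δ c.state (c.tape c.head)).map fun (q, s, m) =>
    ⟨q, c.head + m.toInt, Function.update c.tape c.head s⟩

/-- The initial configuration: the input is in the cells `1, …, |w|`, all other cells are blank,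
and the head is on cell `0`, immediately to the left of the input. -/
def initCfg (w : List S) : M.Cfg where
  state := M.init
  head := 0
  tape z := if 1 ≤ z then (w.map M.input).getD (z - 1).toNat M.blank else M.blank

/-- The input is accepted if an accepting state is reached. -/
def Accepts (w : List S) : Prop :=
  ∃ c : M.Cfg, StateTransition.Reaches M.step (M.initCfg w) c ∧ c.state ∈ M.accept

/-- The language recognized by a Turing machine. -/
def language : Language S := {w | M.Accepts w}

/-- Normal form: the head moves in every step and never goes left of its initial position; the
first step goes to the right into a reading state, in which the machine keeps moving to the
right until it reads the blank symbol; accepting states have no outgoing transitions. -/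
structure NormalForm : Prop where
  no_stay : ∀ q s q' s' m, M.δ q s = some (q', s', m) → m ≠ Move.stay
  head_nonneg : ∀ w c, StateTransition.Reaches M.step (M.initCfg w) c → 0 ≤ c.head
  reads : ∃ q, (∃ v, M.δ M.init M.blank = some (q, v, Move.right)) ∧
    ∀ s, s ≠ M.blank → ∃ v, M.δ q s = some (q, v, Move.right)
  accept_halts : ∀ q ∈ M.accept, ∀ s, M.δ q s = none

end TuringMachine

/-! ### Turing completeness -/

/-- A class of seq-to-seq networks (in all dimensions) is Turing complete if, over every finite
alphabet, the languages accepted by recognizers using networks of the class are exactly the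
languages recognized by Turing machines. -/
def TuringComplete (𝒩 : (d : ℕ) → Set (SeqToSeq d)) : Prop :=
  ∀ (S : Type) [Fintype S] (L : Language S),
    (∃ d : ℕ, 0 < d ∧ ∃ A : Recognizer S d, A.network ∈ 𝒩 d ∧ A.language = L) ↔
      ∃ M : TuringMachine S, M.language = L

/-- All parameter functions of a layer have the property `P`. -/
def LayerParams.All {d : ℕ} (P : (Vec d → Vec d) → Prop) (θ : LayerParams d) : Prop :=
  P θ.Q ∧ P θ.K ∧ P θ.V ∧ P θ.O

/-- All parameter functions of a Transformer, apart from scoring and normalization, have the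
property `P`. -/
def Transformer.All {d : ℕ} (P : (Vec d → Vec d) → Prop) (T : Transformer d) : Prop :=
  (∀ θ ∈ T.enc, θ.All P) ∧ P T.Kenc ∧ P T.Venc ∧ (∀ θ ∈ T.dec, θ.All P) ∧ P T.F

/-- Transformers whose parameter and scoring functions are piecewise rational. -/
structure Transformer.Admissible {d : ℕ} (T : Transformer d) : Prop where
  params : T.All PiecewiseRationalMap
  score : PiecewiseRational
    (fun x : Fin d ⊕ Fin d → ℚ => T.score (fun i => x (Sum.inl i)) (fun i => x (Sum.inr i)))
  normalize : IsNormalization T.normalize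

/-- The class of Transformer networks with positional encodings; a positional encoding has to be
computable in time linear in the number of bits of the position. -/
def transformersWithPos (d : ℕ) : Set (SeqToSeq d) :=
  {N | ∃ T : Transformer d, T.Admissible ∧
    ∃ pos : ℕ → Vec d, LinearTime encodeNat encodeVec pos ∧ N = T.net pos}

/-- The scoring function `-|⟨q, k⟩|`. -/
def absScore (d : ℕ) : Score d := fun q k => -|∑ i, q i * k i|

/-- The positional encoding whose last four coordinates are `1, i, 1/i, 1/i²` and whose other
coordinates are `0`.  Only positions `i ≥ 1` are ever used. -/
def recipPos (d : ℕ) (i : ℕ) : Vec d := fun c =>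
  if c.val + 4 = d then 1
  else if c.val + 3 = d then (i : ℚ)
  else if c.val + 2 = d then 1 / (i : ℚ)
  else if c.val + 1 = d then 1 / (i : ℚ) ^ 2
  else 0

end TransformerTC

/-! From Turing machines to Transformers. For a machine in normal form, output number `t` of the
network describes time `t` of the run by the state, the symbol under the head, the last displacement
and an acceptance flag. The tape is never stored; it is recovered from the history. If the head is
on cell c at time t + 1, the symbol there is the one written at the last time l ≤ t at which the
head was on c. If there is no such time, it is an input letter or a blank.

The three decoder layers extract this information. The first evaluates the transition function on
one-hot bits. In the second all scores are equal, so attention averages the displacements and yields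
head(t)/(t+1) and head(t+1)/(t+1). The third finds l: with N = t + 1 and J = j + 1, the score of
time j is the negative of |(head(j) - c)/(NJ) + 1/(3N²J²)|. The first term vanishes exactly at the
visits of c, and among these the second prefers the latest (`lookup_lt_of_visited`). If c is new,
all visited cells lie to its left and the minimum is at j = t (`lookup_lt_of_new`). As the head
never stays, l < t or l = t tells an old cell from a new one. For a new cell, external attention
supplies input letter number min(N, n). This is the right letter because the head is on cell j at
every time j ≤ n + 1, and a cell first visited later lies beyond the input (`symbol_of_new`). The
induction step is `simOut_live`; after halting, the state bits are zero and remain so.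

Normal form is reached by folding the two-way tape at the origin into two tracks (`fold_respects`,
`language_fold`).

Two positional encodings are needed. One provides 1/i and 1/i², so that all parameter functions can
be feed-forward networks. The other provides only i, which is copied in linear time, and leaves the
inverses to a rational output function. `Positional` collects what the simulation needs from either.

From Transformers to Turing machines. Acceptance is the existence of a finite witness: a number of
steps, the outputs so far and the values of the positional encoding. Checking a witness is primitive
recursive, since admissible functions act primitive recursively on codes of rationals and a
linear-time machine computes a primitive recursive function (`exists_primrec_of_time`). Searching
for a witness is partial recursive, hence performed by a stack machine, hence by a Post-Turing
machine, hence by a Turing machine; the input word is first converted into a number on an additional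
stack. -/

namespace TransformerTC

/-! ### Closure properties of feed-forward networks -/

/-- Scalar affine functions. -/
def IsAffine {m : ℕ} (f : Vec m → ℚ) : Prop :=
  ∃ (w : Vec m) (c : ℚ), ∀ x, f x = ∑ i, x i * w i + c

namespace IsAffine

variable {m : ℕ} {f g : Vec m → ℚ}

theorem const (c : ℚ) : IsAffine (fun _ : Vec m => c) := ⟨0, c, by simp⟩

theorem coord (i : Fin m) : IsAffine (fun x : Vec m => x i) :=
  ⟨Pi.single i 1, 0, fun x => by simp [Pi.single_apply]⟩

theorem add (hf : IsAffine f) (hg : IsAffine g) : IsAffine (fun x => f x + g x) := by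
  obtain ⟨w, c, h⟩ := hf
  obtain ⟨w', c', h'⟩ := hg
  refine ⟨w + w', c + c', fun x => ?_⟩
  simp only [h, h', Pi.add_apply, mul_add, Finset.sum_add_distrib]
  ring

theorem smul (a : ℚ) (hf : IsAffine f) : IsAffine (fun x => a * f x) := by
  obtain ⟨w, c, h⟩ := hf
  refine ⟨a • w, a * c, fun x => ?_⟩
  simp only [h, Pi.smul_apply, smul_eq_mul, mul_add, Finset.mul_sum]
  congr 1
  exact Finset.sum_congr rfl fun i _ => by ring

theorem neg (hf : IsAffine f) : IsAffine (fun x => -f x) := by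
  simpa using hf.smul (-1)

theorem sub (hf : IsAffine f) (hg : IsAffine g) : IsAffine (fun x => f x - g x) := by
  simpa [sub_eq_add_neg] using hf.add hg.neg

end IsAffine

theorem FeedForward.of_isAffine {m n : ℕ} {f : Vec m → Vec n}
    (h : ∀ j, IsAffine (fun x => f x j)) : FeedForward f := by
  choose w c hw using h
  convert FeedForward.affine (fun i j => w j i : Matrix (Fin m) (Fin n) ℚ) c using 1
  funext x j
  simp [hw, Matrix.vecMul, dotProduct]

/-- Scalar outputs of feed-forward networks with at most `L` rounds of activations. -/
inductive BoundedNet {m : ℕ} : ℕ → (Vec m → ℚ) → Prop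
  | const (L : ℕ) (c : ℚ) : BoundedNet L (fun _ => c)
  | add {L : ℕ} {f g : Vec m → ℚ} : BoundedNet L f → BoundedNet L g →
      BoundedNet L (fun x => f x + g x)
  | smul {L : ℕ} {f : Vec m → ℚ} (c : ℚ) : BoundedNet L f → BoundedNet L (fun x => c * f x)
  -- Coordinates enter only underneath an activation, but at any level. Their activated values can
  -- be carried through further rounds because `sigma` is idempotent; an unbounded coordinate could
  -- not.
  | affine (L : ℕ) {f : Vec m → ℚ} : IsAffine f → BoundedNet (L + 1) (fun x => sigma (f x))
  | layer {L : ℕ} {f : Vec m → ℚ} : BoundedNet L f → BoundedNet (L + 1) (fun x => sigma (f x))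

namespace BoundedNet

variable {m L : ℕ} {f g : Vec m → ℚ}

theorem neg (hf : BoundedNet L f) : BoundedNet L (fun x => -f x) := by
  simpa using hf.smul (-1)

theorem sub (hf : BoundedNet L f) (hg : BoundedNet L g) : BoundedNet L (fun x => f x - g x) := by
  simpa [sub_eq_add_neg] using hf.add hg.neg

theorem sum {κ : Type*} (s : Finset κ) {F : κ → Vec m → ℚ} (h : ∀ k, BoundedNet L (F k)) :
    BoundedNet L (fun x => ∑ k ∈ s, F k x) := by
  classical
  induction s using Finset.induction_on with
  | empty => simpa using const L 0
  | insert a s ha ih => simpa [Finset.sum_insert ha] using (h a).add ih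

/-- Peels off the last round: sums and multiples only recombine activated units. The level is
equated to `L' + 1` in a separate hypothesis so that the induction on `h` applies. -/
theorem exists_eq_sum (h : BoundedNet L f) : ∀ {L' : ℕ}, L = L' + 1 →
    ∃ (κ : Type) (_ : Fintype κ) (G : κ → Vec m → ℚ) (w : κ → ℚ) (c : ℚ),
      (∀ k, IsAffine (G k) ∨ BoundedNet L' (G k)) ∧ ∀ x, f x = ∑ k, sigma (G k x) * w k + c := by
  induction h with
  | const L c => intro L' _; exact ⟨Empty, inferInstance, nofun, nofun, c, nofun, by simp⟩
  | add _ _ h₁ h₂ =>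
    intro L' hL
    obtain ⟨κ, _, G, w, c, hG, h⟩ := h₁ hL
    obtain ⟨κ', _, G', w', c', hG', h'⟩ := h₂ hL
    refine ⟨κ ⊕ κ', inferInstance, Sum.elim G G', Sum.elim w w', c + c', ?_, fun x => ?_⟩
    · rintro (k | k)
      exacts [hG k, hG' k]
    · simp only [h, h', Fintype.sum_sum_type, Sum.elim_inl, Sum.elim_inr]
      ring
  | smul a _ h =>
    intro L' hL
    obtain ⟨κ, _, G, w, c, hG, h⟩ := h hL
    refine ⟨κ, inferInstance, G, fun k => a * w k, a * c, hG, fun x => ?_⟩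
    simp only [h, mul_add, Finset.mul_sum]
    congr 1
    exact Finset.sum_congr rfl fun i _ => by ring
  | affine L h =>
    intro L' hL
    exact ⟨Unit, inferInstance, fun _ => _, fun _ => 1, 0, fun _ => Or.inl h, by simp⟩
  | layer h =>
    intro L' hL
    obtain rfl : _ = L' := by simpa using hL
    exact ⟨Unit, inferInstance, fun _ => _, fun _ => 1, 0, fun _ => Or.inr h, by simp⟩

theorem isAffine (h : BoundedNet L f) : L = 0 → IsAffine f := by
  induction h with
  | const L c => exact fun _ => IsAffine.const c
  | add _ _ h₁ h₂ => exact fun h => (h₁ h).add (h₂ h)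
  | smul a _ h => exact fun h' => (h h').smul a
  | affine => simp
  | layer => simp

end BoundedNet

theorem sigma_nonneg (x : ℚ) : 0 ≤ sigma x := by
  unfold sigma; split_ifs <;> grind

theorem sigma_le_one (x : ℚ) : sigma x ≤ 1 := by
  unfold sigma; split_ifs <;> grind

theorem sigma_of_mem {x : ℚ} (h₀ : 0 ≤ x) (h₁ : x ≤ 1) : sigma x = x := by
  unfold sigma; split_ifs <;> grind

theorem sigma_of_nonpos {x : ℚ} (h : x ≤ 0) : sigma x = 0 := by
  unfold sigma; split_ifs <;> grind

theorem sigma_of_one_le {x : ℚ} (h : 1 ≤ x) : sigma x = 1 := by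
  unfold sigma; split_ifs <;> grind

theorem sigma_sigma (x : ℚ) : sigma (sigma x) = sigma x :=
  sigma_of_mem (sigma_nonneg x) (sigma_le_one x)

@[simp] theorem sigma_zero : sigma 0 = 0 := sigma_of_nonpos le_rfl

@[simp] theorem sigma_one : sigma 1 = 1 := sigma_of_one_le le_rfl

/-- Units of different depths have to share layers. Since `sigma` is idempotent, an affine unit may
be activated once in advance without changing its final value, and the result is available at every
positive depth. All units of a round are thus brought to one depth and computed in parallel by
induction. -/
theorem FeedForward.of_boundedNet {m : ℕ} (L : ℕ) : ∀ {n : ℕ} {f : Vec m → Vec n},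
    (∀ j, BoundedNet L (fun x => f x j)) → FeedForward f := by
  induction L with
  | zero => exact fun h => .of_isAffine fun j => (h j).isAffine rfl
  | succ L ih =>
    intro n f h
    classical
    choose κ hκ G w c hG hf using fun j => (h j).exists_eq_sum rfl
    let e := Fintype.equivFin (Σ j, κ j)
    obtain ⟨G', hG', hs⟩ : ∃ G' : (Σ j, κ j) → Vec m → ℚ,
        ((∀ k, IsAffine (G' k)) ∨ ∀ k, BoundedNet L (G' k)) ∧
          ∀ k x, sigma (G' k x) = sigma (G k.1 k.2 x) := by
      cases L with
      | zero =>
        -- Without activations only affine units remain, so that one affine map computes all of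
        -- them.
        exact ⟨fun k => G k.1 k.2, Or.inl fun k => (hG k.1 k.2).elim id fun h => h.isAffine rfl,
          fun _ _ => rfl⟩
      | succ L =>
        refine ⟨fun k x => if IsAffine (G k.1 k.2) then sigma (G k.1 k.2 x) else G k.1 k.2 x,
          Or.inr fun k => ?_, fun k x => ?_⟩
        · by_cases ha : IsAffine (G k.1 k.2)
          · simpa [ha] using BoundedNet.affine L ha
          · simpa [ha] using (hG k.1 k.2).resolve_left ha
        · dsimp only
          split_ifs
          exacts [sigma_sigma _, rfl]
    have hg : FeedForward (fun x => fun i => G' (e.symm i) x) := by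
      rcases hG' with h | h
      · exact .of_isAffine fun j => h _
      · exact ih fun j => h _
    -- Block weights: the units belonging to output `j` contribute to output `j` only.
    convert hg.layer (fun i j => if (e.symm i).1 = j then w _ (e.symm i).2 else 0 :
      Matrix (Fin _) (Fin n) ℚ) c using 1
    funext x j
    simp only [hf, Matrix.vecMul, dotProduct, Pi.add_apply]
    congr 1
    rw [Equiv.sum_comp e.symm (fun k => sigma (G' k x) * if k.1 = j then w k.1 k.2 else 0),
      Fintype.sum_sigma, Finset.sum_eq_single j]
    · simp [hs]
    · intro b _ hb
      simp [hb]
    · simp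

/-! ### Closure properties of piecewise rational functions -/

namespace PiecewiseRational

variable {ι : Type} {f g : (ι → ℚ) → ℚ}

theorem sum {κ : Type*} (s : Finset κ) {F : κ → (ι → ℚ) → ℚ} (h : ∀ k, PiecewiseRational (F k)) :
    PiecewiseRational (fun x => ∑ k ∈ s, F k x) := by
  classical
  induction s using Finset.induction_on with
  | empty => simpa using const 0
  | insert a s ha ih => simpa [Finset.sum_insert ha] using (h a).add ih

theorem neg (hf : PiecewiseRational f) : PiecewiseRational (fun x => -f x) := by
  simpa using (const (-1)).mul hf

theorem abs (hf : PiecewiseRational f) : PiecewiseRational (fun x => |f x|) := by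
  convert hf.relu.add hf.neg.relu using 2 with x
  simp only [TransformerTC.relu]
  rcases le_total 0 (f x) with h | h
  · rw [abs_of_nonneg h, max_eq_left h, max_eq_right (by linarith)]; ring
  · rw [abs_of_nonpos h, max_eq_right h, max_eq_left (by linarith)]; ring

end PiecewiseRational

theorem FeedForward.piecewiseRationalMap {m n : ℕ} {f : Vec m → Vec n} (h : FeedForward f) :
    PiecewiseRationalMap f := by
  induction h with
  | affine W b =>
    intro j
    simp only [Matrix.vecMul, dotProduct, Pi.add_apply]
    exact (PiecewiseRational.sum _ fun i => (PiecewiseRational.coord i).mul (.const _)).add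
      (.const _)
  | layer _ W b ih =>
    intro j
    simp only [Matrix.vecMul, dotProduct, Pi.add_apply]
    exact (PiecewiseRational.sum _ fun i => (ih i).sigma.mul (.const _)).add (.const _)

theorem piecewiseRational_absScore (d : ℕ) : PiecewiseRational (fun x : Fin d ⊕ Fin d → ℚ =>
    absScore d (fun i => x (Sum.inl i)) (fun i => x (Sum.inr i))) :=
  (PiecewiseRational.sum _ fun i =>
    (PiecewiseRational.coord (Sum.inl i)).mul (.coord (Sum.inr i))).abs.neg

end TransformerTC

/-! ### From Turing machines in normal form to Transformers -/

namespace TransformerTC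

/-! ### Hard attention -/

section Attention

variable {d n : ℕ} {score : Score d} {q : Vec d} {K V : Fin n → Vec d}

theorem att_hardmax_of_unique (i₀ : Fin n)
    (h : ∀ j, j ≠ i₀ → score q (K j) < score q (K i₀)) : att score hardmax q K V = V i₀ := by
  have hmax : ∀ i, (∀ j, score q (K j) ≤ score q (K i)) ↔ i = i₀ := by
    refine fun i => ⟨fun hi => ?_, ?_⟩
    · by_contra hne
      exact absurd (hi i₀) (not_le.2 (h i hne))
    · rintro rfl j
      rcases eq_or_ne j i with rfl | hj
      exacts [le_rfl, (h j hj).le]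
  simp [att, hardmax, hmax, Finset.filter_eq']

/-- Constant scores make hard attention an average, that is, a prefix sum divided by the length.
This is how head positions are obtained from displacements. -/
theorem att_hardmax_of_const (h : ∀ i j, score q (K i) = score q (K j)) :
    att score hardmax q K V = (1 / (n : ℚ)) • ∑ i, V i := by
  have hmax : ∀ i, (∀ j, score q (K j) ≤ score q (K i)) := fun i j => (h j i).le
  simp [att, hardmax, hmax, Finset.smul_sum]

theorem att_apply_eq_zero {ρ : Normalization} {k : Fin d} (h : ∀ i, V i k = 0) :
    att score ρ q K V k = 0 := by
  simp [att, h]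

end Attention

section Decoder

variable {d n k : ℕ} (score : Score d) (ρ : Normalization) (θ : LayerParams d)
    (Ke Ve : Fin n → Vec d) (Y : Fin k → Vec d) (i : Fin k)

/-- The self-attention sublayer of a decoder layer. -/
def decSelf : Vec d :=
  att score ρ (θ.Q (Y i)) (fun j : Fin (i.val + 1) => θ.K (Y (Fin.castLE i.isLt j)))
    (fun j => θ.V (Y (Fin.castLE i.isLt j))) + Y i

/-- The two attention sublayers of a decoder layer. -/
def decAtt : Vec d :=
  att score ρ (decSelf score ρ θ Y i) Ke Ve + decSelf score ρ θ Y i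

theorem decLayer_eq : decLayer score ρ θ Ke Ve Y i =
    θ.O (decAtt score ρ θ Ke Ve Y i) + decAtt score ρ θ Ke Ve Y i := rfl

variable {θ Ve}

theorem decSelf_apply {c : Fin d} (hV : ∀ x, θ.V x c = 0) :
    decSelf score ρ θ Y i c = Y i c := by
  simp [decSelf, att_apply_eq_zero (k := c) (fun j => hV _)]

theorem decAtt_apply {c : Fin d} (hV : ∀ x, θ.V x c = 0) (hVe : ∀ j, Ve j c = 0) :
    decAtt score ρ θ Ke Ve Y i c = Y i c := by
  simp [decAtt, decSelf_apply score ρ Y i hV, att_apply_eq_zero (k := c) hVe]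

theorem decLayer_apply {c : Fin d} (hV : ∀ x, θ.V x c = 0) (hVe : ∀ j, Ve j c = 0) :
    decLayer score ρ θ Ke Ve Y i c = θ.O (decAtt score ρ θ Ke Ve Y i) c + Y i c := by
  simp [decLayer_eq, decAtt_apply score ρ Ke Y i hV hVe]

end Decoder

namespace Transformer

variable {d : ℕ} (T : Transformer d) (pos : ℕ → Vec d) {n : ℕ} (X : Fin n → Vec d) (s : Vec d)

/-- The last vector of the sequence produced by a Transformer. -/
def out (t : ℕ) : Vec d := T.trace pos X s t (Fin.last t)

/-- The sequence only grows at its end, so earlier outputs never change and a recursion for the last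
output describes the whole sequence. -/
theorem trace_apply (t : ℕ) (j : Fin (t + 1)) : T.trace pos X s t j = T.out pos X s j := by
  induction t with
  | zero =>
    obtain rfl : j = Fin.last 0 := Fin.ext (by omega)
    rfl
  | succ t ih =>
    refine Fin.lastCases rfl (fun j => ?_) j
    have : T.trace pos X s (t + 1) j.castSucc = T.trace pos X s t j := by
      simp only [trace, Fin.snoc_castSucc]
    rw [this, ih]
    rfl

theorem out_zero : T.out pos X s 0 = s := rfl

theorem out_succ (t : ℕ) : T.out pos X s (t + 1) =
    T.tDec (T.tEnc (fun i => X i + pos (i.val + 1)))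
      (fun j : Fin (t + 1) => T.out pos X s j + pos (j.val + 1)) := by
  simp only [out, trace, Fin.snoc_last]
  congr 1
  funext j
  rw [trace_apply]
  rfl

end Transformer

/-! ### The coordinates of the simulating Transformer -/

/-- Names for the coordinates of the Transformer that simulates a Turing machine. -/
inductive Coord (Q Γ : Type)
  | acc
  | state (q : Q)
  | nextState (q : Q)
  | sym (a : Γ)
  | written (a : Γ)
  | lastWritten (a : Γ)
  | input (a : Γ)
  | move
  | nextMove
  | headPos
  | curPos
  | lastTime
  | inputPos
  | one
  | pos
  | inv
  | invSq

namespace Coord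

variable {Q Γ : Type}

/-- The coordinates as a sum type, with the coordinate `acc` first and the coordinates of the
positional encoding last. -/
def sumEquiv : Coord Q Γ ≃
    Fin 1 ⊕ (((Q ⊕ Q) ⊕ ((Γ ⊕ Γ) ⊕ (Γ ⊕ Γ)) ⊕ Fin 6) ⊕ Fin 4) where
  toFun
    | acc => .inl 0
    | state q => .inr (.inl (.inl (.inl q)))
    | nextState q => .inr (.inl (.inl (.inr q)))
    | sym a => .inr (.inl (.inr (.inl (.inl (.inl a)))))
    | written a => .inr (.inl (.inr (.inl (.inl (.inr a)))))
    | lastWritten a => .inr (.inl (.inr (.inl (.inr (.inl a)))))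
    | input a => .inr (.inl (.inr (.inl (.inr (.inr a)))))
    | move => .inr (.inl (.inr (.inr 0)))
    | nextMove => .inr (.inl (.inr (.inr 1)))
    | headPos => .inr (.inl (.inr (.inr 2)))
    | curPos => .inr (.inl (.inr (.inr 3)))
    | lastTime => .inr (.inl (.inr (.inr 4)))
    | inputPos => .inr (.inl (.inr (.inr 5)))
    | one => .inr (.inr 0)
    | pos => .inr (.inr 1)
    | inv => .inr (.inr 2)
    | invSq => .inr (.inr 3)
  invFun
    | .inl _ => acc
    | .inr (.inl (.inl (.inl q))) => state q
    | .inr (.inl (.inl (.inr q))) => nextState q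
    | .inr (.inl (.inr (.inl (.inl (.inl a))))) => sym a
    | .inr (.inl (.inr (.inl (.inl (.inr a))))) => written a
    | .inr (.inl (.inr (.inl (.inr (.inl a))))) => lastWritten a
    | .inr (.inl (.inr (.inl (.inr (.inr a))))) => input a
    | .inr (.inl (.inr (.inr 0))) => move
    | .inr (.inl (.inr (.inr 1))) => nextMove
    | .inr (.inl (.inr (.inr 2))) => headPos
    | .inr (.inl (.inr (.inr 3))) => curPos
    | .inr (.inl (.inr (.inr 4))) => lastTime
    | .inr (.inl (.inr (.inr 5))) => inputPos
    | .inr (.inr 0) => one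
    | .inr (.inr 1) => pos
    | .inr (.inr 2) => inv
    | .inr (.inr 3) => invSq
  left_inv c := by cases c <;> rfl
  right_inv c := by
    rcases c with i | ((q | q) | (((a | a) | (a | a)) | i)) | i <;> try rfl
    all_goals fin_cases i <;> rfl

/-- Only five places matter: `acc` comes first so that acceptance can be read off the beginning of
the encoded vector, and the last four have to agree with the positional encoding. -/
theorem exists_equiv_fin (Q Γ : Type) [Fintype Q] [Fintype Γ] :
    ∃ e : Coord Q Γ ≃ Fin (2 * Fintype.card Q + 4 * Fintype.card Γ + 11),
      (e acc).val = 0 ∧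
      (e one).val + 4 = 2 * Fintype.card Q + 4 * Fintype.card Γ + 11 ∧
      (e pos).val + 3 = 2 * Fintype.card Q + 4 * Fintype.card Γ + 11 ∧
      (e inv).val + 2 = 2 * Fintype.card Q + 4 * Fintype.card Γ + 11 ∧
      (e invSq).val + 1 = 2 * Fintype.card Q + 4 * Fintype.card Γ + 11 := by
  let m := (Q ⊕ Q) ⊕ ((Γ ⊕ Γ) ⊕ (Γ ⊕ Γ)) ⊕ Fin 6
  have hm : Fintype.card m = 2 * Fintype.card Q + 4 * Fintype.card Γ + 6 := by
    simp [m, Fintype.card_sum]; omega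
  let e₁ : Fin 1 ⊕ (m ⊕ Fin 4) ≃ Fin (1 + (Fintype.card m + 4)) :=
    (Equiv.sumCongr (Equiv.refl _)
      ((Equiv.sumCongr (Fintype.equivFin m) (Equiv.refl _)).trans finSumFinEquiv)).trans
      finSumFinEquiv
  refine ⟨(sumEquiv.trans e₁).trans (finCongr (by omega)), ?_, ?_, ?_, ?_, ?_⟩ <;>
  simp [sumEquiv, e₁] <;> omega

end Coord

end TransformerTC

namespace TransformerTC

/-! ### Runs of Turing machines -/

namespace TuringMachine

variable {S : Type} (M : TuringMachine S)

/-- `C` is a run of `M` on `w` with (at least) `t` steps. -/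
structure IsRun (w : List S) (t : ℕ) (C : ℕ → M.Cfg) : Prop where
  zero : C 0 = M.initCfg w
  step : ∀ j < t, M.step (C j) = some (C (j + 1))

variable {M}

theorem step_eq_some {c c' : M.Cfg} (h : M.step c = some c') :
    ∃ q a m, M.δ c.state (c.tape c.head) = some (q, a, m) ∧ c'.state = q ∧
      c'.head = c.head + m.toInt ∧ c'.tape = Function.update c.tape c.head a := by
  simp only [step, Option.map_eq_some_iff] at h
  obtain ⟨⟨q, a, m⟩, h, rfl⟩ := h
  exact ⟨q, a, m, h, rfl, rfl, rfl⟩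

namespace IsRun

variable {w : List S} {t : ℕ} {C : ℕ → M.Cfg}

theorem mono (h : M.IsRun w t C) {s : ℕ} (hs : s ≤ t) : M.IsRun w s C :=
  ⟨h.zero, fun j hj => h.step j (by omega)⟩

theorem reaches (h : M.IsRun w t C) : StateTransition.Reaches M.step (M.initCfg w) (C t) := by
  induction t with
  | zero => rw [h.zero]; exact .refl
  | succ t ih => exact (ih (h.mono t.le_succ)).tail (h.step t t.lt_succ_self)

theorem tape_eq_init (h : M.IsRun w t C) (z : ℤ) (hz : ∀ j < t, (C j).head ≠ z) :
    (C t).tape z = (M.initCfg w).tape z := by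
  induction t with
  | zero => rw [h.zero]
  | succ t ih =>
    obtain ⟨q, a, m, -, -, -, ht⟩ := step_eq_some (h.step t t.lt_succ_self)
    rw [ht, Function.update_of_ne (hz t t.lt_succ_self).symm]
    exact ih (h.mono t.le_succ) fun j hj => hz j (by omega)

theorem tape_eq_written (h : M.IsRun w t C) {l : ℕ} (hl : l < t)
    (hlast : ∀ j < t, l < j → (C j).head ≠ (C l).head) :
    (C t).tape (C l).head = (C (l + 1)).tape (C l).head := by
  induction t with
  | zero => omega
  | succ t ih =>
    rcases eq_or_ne l t with rfl | hne
    · rfl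
    obtain ⟨q, a, m, -, -, -, ht⟩ := step_eq_some (h.step t t.lt_succ_self)
    rw [ht, Function.update_of_ne (hlast t t.lt_succ_self (by omega)).symm]
    exact ih (h.mono t.le_succ) (by omega) fun j hj => hlast j (by omega)

theorem head_zero (h : M.IsRun w t C) : (C 0).head = 0 := by
  rw [h.zero]; rfl

theorem head_succ (hM : M.NormalForm) (h : M.IsRun w t C) {j : ℕ} (hj : j < t) :
    (C (j + 1)).head = (C j).head + 1 ∨ (C (j + 1)).head = (C j).head - 1 := by
  obtain ⟨q, a, m, hδ, -, hh, -⟩ := step_eq_some (h.step j hj)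
  have := hM.no_stay _ _ _ _ _ hδ
  cases m <;> simp_all [Move.toInt, sub_eq_add_neg]

theorem head_nonneg (hM : M.NormalForm) (h : M.IsRun w t C) {j : ℕ} (hj : j ≤ t) :
    0 ≤ (C j).head :=
  hM.head_nonneg w _ (h.mono hj).reaches

theorem initCfg_tape (w : List S) (j : ℕ) :
    (M.initCfg w).tape (j + 1 : ℤ) = ((w.map M.input)[j]?).getD M.blank := by
  simp only [initCfg]
  rw [if_pos (by omega), List.getD_eq_getElem?_getD]
  simp

/-- A cell reached in this phase is untouched, because the head was strictly to its left before; it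
therefore still holds a letter, and the reading state goes on. The bound is `w.length + 1` because
the move that leaves the last letter is included. -/
theorem head_reading (hM : M.NormalForm) (h : M.IsRun w t C) {j : ℕ} (hj : j ≤ t)
    (hw : j ≤ w.length + 1) : (C j).head = j := by
  obtain ⟨q, ⟨v, hv⟩, hq⟩ := hM.reads
  suffices ∀ j ≤ t, j ≤ w.length + 1 → (∀ i ≤ j, (C i).head = i) ∧ (j ≠ 0 → (C j).state = q) from
    (this j hj hw).1 j le_rfl
  intro j
  induction j with
  | zero =>
    intro _ _
    refine ⟨fun i hi => ?_, by simp⟩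
    obtain rfl : i = 0 := by omega
    simp [h.head_zero]
  | succ j ih =>
    intro hj hw
    obtain ⟨ih₁, ih₂⟩ := ih (by omega) (by omega)
    obtain ⟨q', a, m, hδ, hs, hh, -⟩ := step_eq_some (h.step j (by omega))
    have key : q' = q ∧ m = Move.right := by
      rcases j with _ | j
      · have : M.δ (C 0).state ((C 0).tape (C 0).head) = M.δ M.init M.blank := by
          rw [h.zero]; simp [initCfg]
        rw [this, hv] at hδ
        simp at hδ
        exact ⟨hδ.1.symm, hδ.2.2.symm⟩
      · have htape : (C (j + 1)).tape (C (j + 1)).head ≠ M.blank := by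
          rw [ih₁ _ le_rfl, (h.mono (by omega : j + 1 ≤ t)).tape_eq_init]
          · push_cast
            rw [initCfg_tape, List.getElem?_eq_getElem (by simp; omega)]
            simp [M.input_ne_blank]
          · intro i hi
            rw [ih₁ _ (by omega)]
            norm_cast
            omega
        obtain ⟨v, hv⟩ := hq _ htape
        rw [ih₂ (by omega), hv] at hδ
        simp at hδ
        exact ⟨hδ.1.symm, hδ.2.2.symm⟩
    refine ⟨fun i hi => ?_, fun _ => by rw [hs, key.1]⟩
    rcases Nat.lt_or_ge i (j + 1) with hi' | hi'
    · exact ih₁ i (by omega)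
    · obtain rfl : i = j + 1 := by omega
      rw [hh, ih₁ j le_rfl, key.2]
      simp [Move.toInt]

/-- Cells visited so far form an interval starting at the initial cell. -/
theorem exists_head_eq (hM : M.NormalForm) (h : M.IsRun w t C) {j : ℕ} (hj : j ≤ t) {z : ℤ}
    (hz : 0 ≤ z) (hz' : z ≤ (C j).head) : ∃ i ≤ j, (C i).head = z := by
  induction j with
  | zero => exact ⟨0, le_rfl, by have := h.head_zero; omega⟩
  | succ j ih =>
    rcases h.head_succ hM (j := j) (by omega) with h' | h'
    · rcases eq_or_lt_of_le hz' with rfl | hlt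
      · exact ⟨j + 1, le_rfl, rfl⟩
      · obtain ⟨i, hi, hi'⟩ := ih (by omega) (by omega)
        exact ⟨i, by omega, hi'⟩
    · obtain ⟨i, hi, hi'⟩ := ih (by omega) (by omega)
      exact ⟨i, by omega, hi'⟩

/-- On its first visit to a cell, the head comes from the left neighbour, which is the rightmost
cell visited so far. -/
theorem head_lt_of_new (hM : M.NormalForm) (h : M.IsRun w (t + 1) C)
    (hnew : ∀ j ≤ t, (C j).head ≠ (C (t + 1)).head) {j : ℕ} (hj : j ≤ t) :
    (C j).head < (C (t + 1)).head := by
  by_contra hle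
  obtain ⟨i, hi, hi'⟩ := h.exists_head_eq hM (by omega : j ≤ t + 1)
    (h.head_nonneg hM (le_refl (t + 1))) (not_lt.1 hle)
  exact hnew i (by omega) hi'

/-- The input is indexed by time, which the network knows as its own position. For t ≤ n the head is
still in its reading phase and stands on cell t + 1. Later a new cell lies to the right of cell n,
which was visited at time n, and both sides are blank. -/
theorem symbol_of_new (hM : M.NormalForm) (h : M.IsRun w (t + 1) C)
    (hnew : ∀ j ≤ t, (C j).head ≠ (C (t + 1)).head) :
    (C (t + 1)).tape (C (t + 1)).head = ((w.map M.input)[t]?).getD M.blank := by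
  rw [h.tape_eq_init _ fun j hj => hnew j (by omega)]
  rcases Nat.lt_or_ge t (w.length + 1) with hlt | hge
  · rw [h.head_reading hM le_rfl (by omega)]
    push_cast
    exact initCfg_tape w t
  · have hlt := h.head_lt_of_new hM hnew (j := w.length) (by omega)
    rw [h.head_reading hM (by omega) (by omega)] at hlt
    obtain ⟨k, hk⟩ := Int.eq_ofNat_of_zero_le (a := (C (t + 1)).head - 1) (by omega)
    rw [show (C (t + 1)).head = (k : ℤ) + 1 by omega, initCfg_tape,
      List.getElem?_eq_none (by simp; omega), List.getElem?_eq_none (by simp; omega)]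

end IsRun

/-- The configuration after `t` steps, if there is one. -/
def cfgAt (w : List S) (t : ℕ) : Option M.Cfg := (fun o => o.bind M.step)^[t] (some (M.initCfg w))

theorem cfgAt_zero (w : List S) : M.cfgAt w 0 = some (M.initCfg w) := rfl

theorem cfgAt_succ (w : List S) (t : ℕ) : M.cfgAt w (t + 1) = (M.cfgAt w t).bind M.step :=
  Function.iterate_succ_apply' _ _ _

theorem reaches_iff_cfgAt {w : List S} {c : M.Cfg} :
    StateTransition.Reaches M.step (M.initCfg w) c ↔ ∃ t, M.cfgAt w t = some c := by
  constructor
  · intro h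
    induction h with
    | refl => exact ⟨0, rfl⟩
    | tail _ h ih =>
      obtain ⟨t, ht⟩ := ih
      exact ⟨t + 1, by rw [cfgAt_succ, ht]; exact h⟩
  · rintro ⟨t, ht⟩
    induction t generalizing c with
    | zero => cases ht; exact .refl
    | succ t ih =>
      rw [cfgAt_succ, Option.bind_eq_some_iff] at ht
      obtain ⟨c', h, h'⟩ := ht
      exact (ih h).tail h'

theorem isRun_of_cfgAt {w : List S} {t : ℕ} (h : (M.cfgAt w t).isSome) :
    M.IsRun w t fun j => (M.cfgAt w j).getD (M.initCfg w) := by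
  refine ⟨by simp [cfgAt_zero], ?_⟩
  induction t with
  | zero => simp
  | succ t ih =>
    intro j hj
    obtain ⟨c', hc'⟩ := Option.isSome_iff_exists.1 h
    have h' := hc'
    rw [cfgAt_succ, Option.bind_eq_some_iff] at h'
    obtain ⟨c, h₁, h₂⟩ := h'
    rcases eq_or_ne j t with rfl | hne
    · simp [h₁, hc', h₂]
    · exact ih (by simp [h₁]) j (by omega)

end TuringMachine

end TransformerTC

namespace TransformerTC

open Coord

/-! ### The parameter functions of the simulating Transformer -/

/-- A map between vectors with named coordinates as a map between vectors. -/
def onCoord {Q Γ : Type} {d : ℕ} (e : Coord Q Γ ≃ Fin d)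
    (f : (Coord Q Γ → ℚ) → Coord Q Γ → ℚ) : Vec d → Vec d :=
  fun x i => f (fun c => x (e c)) (e.symm i)

@[simp] theorem onCoord_apply {Q Γ : Type} {d : ℕ} (e : Coord Q Γ ≃ Fin d)
    (f : (Coord Q Γ → ℚ) → Coord Q Γ → ℚ) (x : Vec d) (c : Coord Q Γ) :
    onCoord e f x (e c) = f (fun c => x (e c)) c := by
  simp [onCoord]

section Maps

variable {Q Γ : Type}

/-- Values of the second decoder layer. -/
def historyValue (x : Coord Q Γ → ℚ) : Coord Q Γ → ℚ
  | headPos => x nextMove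
  | curPos => x move
  | _ => 0

/-- Queries of the third decoder layer. -/
def lookupQuery (x : Coord Q Γ → ℚ) : Coord Q Γ → ℚ
  -- At time t, with N = t + 1, this query contains 1/N, -c/N and 1/(3N²), while the key of time j
  -- contains head(j)/J, 1/J and 1/J². The pairing is (head(j) - c)/(NJ) + 1/(3N²J²). The factor 1/3
  -- keeps the tie-breaking term at most 1/(3N²), whereas a wrong cell costs at least 2/(3N²).
  | curPos => x inv
  | inv => -x headPos
  | invSq => 1 / 3 * x invSq
  | _ => 0

/-- Values of the third decoder layer. -/
def lookupValue (x : Coord Q Γ → ℚ) : Coord Q Γ → ℚ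
  | lastWritten a => x (written a)
  | lastTime => x pos
  | _ => 0

/-- External keys. -/
def encKey (x : Coord Q Γ → ℚ) : Coord Q Γ → ℚ
  -- Against a query with `one` equal to 1 and `pos` equal to N, input position i pairs to i - N, so
  -- the input position nearest to N wins.
  | one => x pos
  | pos => -x one
  | _ => 0

/-- External values. -/
def encValue (x : Coord Q Γ → ℚ) : Coord Q Γ → ℚ
  | input a => x (input a)
  | inputPos => x pos
  | _ => 0

end Maps

namespace TuringMachine

variable {S : Type} (M : TuringMachine S)

/-- The function `g` of the transition that applies to the state and symbol stored in `x`. -/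
def transSum (g : M.Q × M.Γ × Move → ℚ) (x : Coord M.Q M.Γ → ℚ) : ℚ :=
  -- On one-hot data the activation is the conjunction of the two bits, so only the term of the
  -- actual state and symbol survives.
  ∑ q, ∑ a, (M.δ q a).elim 0 g * sigma (x (state q) + x (sym a) - 1)

open Classical in
/-- The transition function. -/
noncomputable def transitionNet (x : Coord M.Q M.Γ → ℚ) : Coord M.Q M.Γ → ℚ
  | nextState q => M.transSum (fun r => if r.1 = q then 1 else 0) x
  | written a => M.transSum (fun r => if r.2.1 = a then 1 else 0) x
  | nextMove => M.transSum (fun r => r.2.2.toInt) x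
  | _ => 0

open Classical in
/-- The output function. -/
noncomputable def outputNet (x : Coord M.Q M.Γ → ℚ) : Coord M.Q M.Γ → ℚ
  | acc => ∑ q, (if q ∈ M.accept then 1 else 0) * sigma (x (nextState q))
  | state q => sigma (x (nextState q))
  -- Put v = `sigma (x pos - x lastTime)` (the cell was visited before) and u = `sigma (3 * x pos -
  -- x inputPos)` (the input is exhausted). The three summands are the last written symbol for v =
  -- 1, the input letter for u = v = 0, and the blank for v = 0, u = 1. The factor 3 is due to
  -- external attention, which adds the same input position in each of the three decoder layers. The
  -- outermost `sigma` keeps the value at most 1 even after the machine has halted.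
  | sym a => sigma
      (sigma (sigma (x (lastWritten a)) + sigma (x pos - x lastTime) - 1) +
        sigma (sigma (x (.input a)) - sigma (x pos - x lastTime)
          - sigma (3 * x pos - x inputPos)) +
        (if a = M.blank then 1 else 0) *
          sigma (sigma (3 * x pos - x inputPos) - sigma (x pos - x lastTime)))
  -- The identity on [-1, 1], written with activations because a network cannot carry a bare
  -- coordinate through its layers.
  | move => sigma (x nextMove) - sigma (-x nextMove)
  | _ => 0

open Classical in
/-- The embedding of the input alphabet. -/
noncomputable def embedNet (s : S) : Coord M.Q M.Γ → ℚ
  | .input a => if M.input s = a then 1 else 0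
  | _ => 0

open Classical in
/-- The vector describing configuration `C t`. -/
noncomputable def cfgNet (C : ℕ → M.Cfg) (t : ℕ) : Coord M.Q M.Γ → ℚ
  | acc => if (C t).state ∈ M.accept then 1 else 0
  | state q => if (C t).state = q then 1 else 0
  | sym a => if (C t).tape (C t).head = a then 1 else 0
  -- At time 0 truncated subtraction makes the displacement 0, as required of the seed.
  | move => (C t).head - (C (t - 1)).head
  | _ => 0

open Classical in
/-- The result of external attention at position `N`. -/
noncomputable def externalNet (w : List S) (N : ℕ) : Coord M.Q M.Γ → ℚ
  -- The letter at the 1-based position `min N w.length`. For the empty word the lookup fails and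
  -- all values are 0, as for attention over an empty sequence.
  | .input a => if (w.map M.input)[min N w.length - 1]? = some a then 1 else 0
  | inputPos => (min N w.length : ℕ)
  | _ => 0

section Layers

variable {M} {d : ℕ} (e : Coord M.Q M.Γ ≃ Fin d)

/-- The encoder layer computing the identity. -/
def idLayer (d : ℕ) : LayerParams d := ⟨fun _ => 0, fun _ => 0, fun _ => 0, fun _ => 0⟩

/-- The first decoder layer. -/
def transitionLayer (O : Vec d → Vec d) : LayerParams d := ⟨fun _ => 0, fun _ => 0, fun _ => 0, O⟩

/-- The second decoder layer. -/
def historyLayer : LayerParams d := ⟨fun _ => 0, fun _ => 0, onCoord e historyValue, fun _ => 0⟩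

/-- The third decoder layer. -/
def lookupLayer : LayerParams d :=
  ⟨onCoord e lookupQuery, id, onCoord e lookupValue, fun _ => 0⟩

/-- The Transformer simulating `M`; the first decoder layer has output function `O`. -/
noncomputable def machineTransformer (O : Vec d → Vec d) : Transformer d where
  score := absScore d
  normalize := hardmax
  enc := [idLayer d]
  Kenc := onCoord e encKey
  Venc := onCoord e encValue
  dec := [transitionLayer O, historyLayer e, lookupLayer e]
  F := onCoord e M.outputNet

/-- Positional encodings, and output functions of the first decoder layer, that provide the
position of a vector and, after the first decoder layer, its inverse and the square of its
inverse. -/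
structure Positional (P : ℕ → Vec d) (O : Vec d → Vec d) : Prop where
  one_eq : ∀ i, P i (e .one) = 1
  pos_eq : ∀ i, P i (e .pos) = i
  other_eq : ∀ i (c : Coord M.Q M.Γ), c ≠ .one → c ≠ .pos → c ≠ .inv → c ≠ .invSq → P i (e c) = 0
  -- The sum `O a + a` is what leaves the layer. The inverse may come from the encoding, with `O`
  -- vanishing there, or from `O`, with the encoding vanishing there.
  inv_eq : ∀ (i : ℕ) (a : Vec d), 1 ≤ i → a (e .pos) = i → a (e .inv) = P i (e .inv) →
    O a (e .inv) + a (e .inv) = 1 / i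
  invSq_eq : ∀ (i : ℕ) (a : Vec d), 1 ≤ i → a (e .pos) = i → a (e .invSq) = P i (e .invSq) →
    O a (e .invSq) + a (e .invSq) = 1 / (i : ℚ) ^ 2
  transition_eq : ∀ (a : Vec d) (c : Coord M.Q M.Γ), c ≠ .inv → c ≠ .invSq →
    O a (e c) = M.transitionNet (fun c => a (e c)) c

theorem absScore_eq (q k : Vec d) {s : Finset (Coord M.Q M.Γ)}
    (h : ∀ c, c ∉ s → q (e c) * k (e c) = 0) :
    absScore d q k = -|∑ c ∈ s, q (e c) * k (e c)| := by
  let _ := Fintype.ofEquiv _ e.symm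
  rw [absScore, ← Equiv.sum_comp e, Finset.sum_subset (Finset.subset_univ s)]
  exact fun c _ hc => h c hc

theorem encode_eq (O : Vec d → Vec d) {n : ℕ} (X : Fin n → Vec d) :
    (machineTransformer e O).encode X = X := by
  funext i
  simp [Transformer.encode, machineTransformer, encLayer, idLayer, att]

variable {e}

/-- The score of input position i is -|i - N|, with its unique maximum at min(N, n). The query
enters only through `one` and `pos`, so all three decoder layers receive the same value. -/
theorem external_att (O : Vec d → Vec d) {P : ℕ → Vec d} (hp : Positional e P O)
    (w : List S) {p : Vec d} {N : ℕ} (hN : 1 ≤ N) (h₁ : p (e .one) = 1) (h₂ : p (e .pos) = N)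
    (c : Coord M.Q M.Γ) :
    att (absScore d) hardmax p
      (fun i : Fin w.length => onCoord e encKey
        ((fun j => M.embedNet (w.get i) (e.symm j)) + P (i + 1)))
      (fun i : Fin w.length => onCoord e encValue
        ((fun j => M.embedNet (w.get i) (e.symm j)) + P (i + 1))) (e c) =
      M.externalNet w N c := by
  classical
  rcases Nat.eq_zero_or_pos w.length with h0 | h0
  · have : IsEmpty (Fin w.length) := by rw [h0]; infer_instance
    obtain rfl : w = [] := List.length_eq_zero_iff.1 h0
    cases c <;> simp [att, externalNet]
  have hs : ∀ i : Fin w.length, absScore d p (onCoord e encKey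
        ((fun j => M.embedNet (w.get i) (e.symm j)) + P (i + 1))) = -|(i : ℚ) + 1 - N| := by
    intro i
    rw [absScore_eq e _ _ (s := {.one, .pos})]
    · rw [Finset.sum_pair (by simp)]
      simp [encKey, embedNet, hp.one_eq, hp.pos_eq, h₁, h₂, sub_eq_add_neg]
    · intro c hc
      cases c <;> simp_all [encKey]
  have hlt : min N w.length - 1 < w.length := by omega
  rw [att_hardmax_of_unique ⟨min N w.length - 1, hlt⟩]
  · have hv : ((⟨min N w.length - 1, hlt⟩ : Fin w.length) : ℕ) + 1 = min N w.length := by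
      simp only; omega
    cases c <;> simp [encValue, embedNet, externalNet, hp.pos_eq, hp.other_eq, hv, hlt]
  · intro j hj
    have hj' : (j : ℕ) ≠ min N w.length - 1 := fun h => hj (Fin.ext h)
    have hjl := j.isLt
    rw [hs, hs]
    simp only
    rcases le_total N w.length with hle | hle
    · rw [min_eq_left hle] at hj' ⊢
      have h1 : ((N - 1 : ℕ) : ℚ) + 1 - N = 0 := by
        push_cast [hN]; ring
      rw [h1, abs_zero, neg_lt_neg_iff, abs_pos]
      intro h
      apply hj'
      have : (j : ℚ) + 1 = N := by linarith
      norm_cast at this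
      omega
    · rw [min_eq_right hle] at hj' ⊢
      have h1 : ((w.length - 1 : ℕ) : ℚ) + 1 = w.length := by
        push_cast [Nat.one_le_iff_ne_zero.2 h0.ne']; ring
      have h2 : (j : ℚ) + 1 < w.length := by
        norm_cast
        omega
      have h3 : (w.length : ℚ) ≤ N := by exact_mod_cast hle
      rw [h1, abs_of_nonpos (by linarith), abs_of_nonpos (by linarith)]
      linarith

end Layers

end TuringMachine

end TransformerTC

namespace TransformerTC

open Coord

namespace TuringMachine

variable {S : Type} {M : TuringMachine S} {d : ℕ}

/-! ### The decoder layers of the simulating Transformer -/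

section Layers

variable (e : Coord M.Q M.Γ ≃ Fin d) (O : Vec d → Vec d) (P : ℕ → Vec d) (w : List S)

/-- The encoder input. -/
noncomputable def encInput (i : Fin w.length) : Vec d :=
  (fun j => M.embedNet (w.get i) (e.symm j)) + P (i + 1)

variable {k : ℕ} (Y : Fin k → Vec d) (i : Fin k)

/-- A decoder layer of the simulating Transformer. -/
noncomputable def simLayer (θ : LayerParams d) : Fin k → Vec d :=
  decLayer (absScore d) hardmax θ (fun i => onCoord e encKey (encInput e P w i))
    (fun i => onCoord e encValue (encInput e P w i)) Y

/-- The part of a decoder layer of the simulating Transformer that precedes its output function. -/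
noncomputable def simAtt (θ : LayerParams d) : Fin k → Vec d :=
  decAtt (absScore d) hardmax θ (fun i => onCoord e encKey (encInput e P w i))
    (fun i => onCoord e encValue (encInput e P w i)) Y

theorem simLayer_eq (θ : LayerParams d) :
    simLayer e P w Y θ i = θ.O (simAtt e P w Y θ i) + simAtt e P w Y θ i := rfl

theorem tDec_machineTransformer {t : ℕ} (Y : Fin (t + 1) → Vec d) :
    (machineTransformer e O).tDec ((machineTransformer e O).tEnc (encInput e P w)) Y =
      onCoord e M.outputNet (simLayer e P w (simLayer e P w (simLayer e P w Y
        (transitionLayer O)) (historyLayer e)) (lookupLayer e) (Fin.last t)) := by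
  simp only [Transformer.tDec, Transformer.tEnc, encode_eq]
  rfl

variable {e O P Y i}

theorem simAtt_apply (hp : Positional e P O) {θ : LayerParams d}
    (h₁ : decSelf (absScore d) hardmax θ Y i (e one) = 1)
    (h₂ : decSelf (absScore d) hardmax θ Y i (e pos) = ((i + 1 : ℕ) : ℚ)) (c : Coord M.Q M.Γ) :
    simAtt e P w Y θ i (e c) =
      M.externalNet w (i + 1) c + decSelf (absScore d) hardmax θ Y i (e c) := by
  rw [← external_att O hp w (by omega) h₁ h₂]
  rfl

variable (h₁ : Y i (e one) = 1) (h₂ : Y i (e pos) = ((i + 1 : ℕ) : ℚ))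
include h₁ h₂

theorem simAtt_transition (hp : Positional e P O) (c : Coord M.Q M.Γ) :
    simAtt e P w Y (transitionLayer O) i (e c) = M.externalNet w (i + 1) c + Y i (e c) := by
  have hself : decSelf (absScore d) hardmax (transitionLayer O) Y i = Y i :=
    funext fun _ => decSelf_apply _ _ _ _ fun _ => rfl
  rw [simAtt_apply w hp (by rw [hself, h₁]) (by rw [hself, h₂]), hself]

theorem simLayer_transition (hp : Positional e P O) (c : Coord M.Q M.Γ) (hc : c ≠ .inv)
    (hc' : c ≠ .invSq) : simLayer e P w Y (transitionLayer O) i (e c) =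
      M.transitionNet (fun c => Y i (e c)) c + (M.externalNet w (i + 1) c + Y i (e c)) := by
  rw [simLayer_eq, Pi.add_apply, simAtt_transition w h₁ h₂ hp]
  congr 1
  change O _ (e c) = _
  rw [hp.transition_eq _ _ hc hc']
  simp only [simAtt_transition w h₁ h₂ hp]
  cases c <;> simp [transitionNet, transSum, externalNet]

theorem simLayer_transition_inv (hp : Positional e P O) (h : Y i (e .inv) = P (i + 1) (e .inv)) :
    simLayer e P w Y (transitionLayer O) i (e .inv) = 1 / ((i + 1 : ℕ) : ℚ) := by
  rw [simLayer_eq, Pi.add_apply]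
  refine hp.inv_eq (i + 1) _ (by omega) ?_ ?_ <;>
  rw [simAtt_transition w h₁ h₂ hp] <;> simp [externalNet, h₂, h]

theorem simLayer_transition_invSq (hp : Positional e P O)
    (h : Y i (e .invSq) = P (i + 1) (e .invSq)) :
    simLayer e P w Y (transitionLayer O) i (e .invSq) = 1 / ((i + 1 : ℕ) : ℚ) ^ 2 := by
  rw [simLayer_eq, Pi.add_apply]
  refine hp.invSq_eq (i + 1) _ (by omega) ?_ ?_ <;>
  rw [simAtt_transition w h₁ h₂ hp] <;> simp [externalNet, h₂, h]

theorem simLayer_history (hp : Positional e P O) (c : Coord M.Q M.Γ) :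
    simLayer e P w Y (historyLayer e) i (e c) =
      M.externalNet w (i + 1) c + (1 / ((i + 1 : ℕ) : ℚ) *
        ∑ j : Fin (i.val + 1), historyValue (fun c => Y (Fin.castLE i.isLt j) (e c)) c
          + Y i (e c)) := by
  have hself : ∀ c, decSelf (absScore d) hardmax (historyLayer e) Y i (e c) =
      1 / ((i + 1 : ℕ) : ℚ) *
        ∑ j : Fin (i.val + 1), historyValue (fun c => Y (Fin.castLE i.isLt j) (e c)) c
          + Y i (e c) := by
    intro c
    simp only [decSelf, Pi.add_apply]
    rw [att_hardmax_of_const (fun _ _ => rfl)]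
    simp [historyLayer]
  have := simAtt_apply w hp (θ := historyLayer e) (Y := Y) (i := i)
    (by rw [hself]; simp [historyValue, h₁]) (by rw [hself]; simp [historyValue, h₂])
  rw [simLayer_eq, Pi.add_apply, this, hself]
  simp [historyLayer]

theorem simLayer_lookup (hp : Positional e P O) {l : Fin (i.val + 1)}
    (hl : ∀ j, j ≠ l →
      |Y i (e .inv) * Y (Fin.castLE i.isLt l) (e curPos)
          - Y i (e headPos) * Y (Fin.castLE i.isLt l) (e .inv)
          + 1 / 3 * Y i (e .invSq) * Y (Fin.castLE i.isLt l) (e .invSq)| <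
      |Y i (e .inv) * Y (Fin.castLE i.isLt j) (e curPos)
          - Y i (e headPos) * Y (Fin.castLE i.isLt j) (e .inv)
          + 1 / 3 * Y i (e .invSq) * Y (Fin.castLE i.isLt j) (e .invSq)|) (c : Coord M.Q M.Γ) :
    simLayer e P w Y (lookupLayer e) i (e c) =
      M.externalNet w (i + 1) c +
        (lookupValue (fun c => Y (Fin.castLE i.isLt l) (e c)) c + Y i (e c)) := by
  have hs : ∀ v : Vec d, absScore d (onCoord e lookupQuery (Y i)) v =
      -|Y i (e .inv) * v (e curPos) - Y i (e headPos) * v (e .inv)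
          + 1 / 3 * Y i (e .invSq) * v (e .invSq)| := by
    classical
    intro v
    rw [absScore_eq e _ _ (s := {curPos, .inv, .invSq})]
    · rw [Finset.sum_insert (by simp), Finset.sum_pair (by simp)]
      simp only [onCoord_apply, lookupQuery]
      ring_nf
    · intro c hc
      cases c <;> simp_all [lookupQuery]
  have hself : ∀ c, decSelf (absScore d) hardmax (lookupLayer e) Y i (e c) =
      lookupValue (fun c => Y (Fin.castLE i.isLt l) (e c)) c + Y i (e c) := by
    intro c
    simp only [decSelf, Pi.add_apply]
    rw [att_hardmax_of_unique l]
    · simp [lookupLayer]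
    · intro j hj
      simp only [lookupLayer, id, hs, neg_lt_neg_iff]
      exact hl j hj
  have := simAtt_apply w hp (θ := lookupLayer e) (Y := Y) (i := i)
    (by rw [hself]; simp [lookupValue, h₁]) (by rw [hself]; simp [lookupValue, h₂])
  rw [simLayer_eq, Pi.add_apply, this, hself]
  simp [lookupLayer]

end Layers

/-! ### Locating the last visit of a cell -/

/-- The left side is 1/(3N²L²), hence at most 1/(3N²). On another cell the first term is at least
1/(NJ) ≥ 1/N² in absolute value and the second is at most 1/(3N²), so at least 2/(3N²) remains. On
the same cell J < L, and only the tie-breaking terms are compared. -/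
theorem lookup_lt_of_visited {N J L : ℕ} {c cJ : ℤ} (hJ : 1 ≤ J) (hJN : J ≤ N)
    (hL : 1 ≤ L) (hJL : cJ = c → J < L) :
    |1 / (N : ℚ) * (c / L) - c / N * (1 / L) + 1 / 3 * (1 / (N : ℚ) ^ 2) * (1 / (L : ℚ) ^ 2)| <
    |1 / (N : ℚ) * (cJ / J) - c / N * (1 / J) + 1 / 3 * (1 / (N : ℚ) ^ 2) * (1 / (J : ℚ) ^ 2)| := by
  have hJ0 : (1 : ℚ) ≤ J := by exact_mod_cast hJ
  have hL0 : (1 : ℚ) ≤ L := by exact_mod_cast hL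
  have hJN0 : (J : ℚ) ≤ N := by exact_mod_cast hJN
  have hN0 : (1 : ℚ) ≤ N := hJ0.trans hJN0
  set a : ℚ := 1 / N with ha
  set b : ℚ := 1 / J with hb
  set l : ℚ := 1 / L with hl
  have ha0 : 0 < a := by positivity
  have hb0 : 0 < b := by positivity
  have hl0 : 0 < l := by positivity
  have hl1 : l ≤ 1 := by rw [hl, div_le_one (by linarith)]; exact hL0
  have hb1 : b ≤ 1 := by rw [hb, div_le_one (by linarith)]; exact hJ0
  have hab : a ≤ b := one_div_le_one_div_of_le (by linarith) hJN0
  have e1 : a * ((c : ℚ) / L) - c / N * l + 1 / 3 * (1 / (N : ℚ) ^ 2) * (1 / (L : ℚ) ^ 2) =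
      1 / 3 * (a ^ 2 * l ^ 2) := by rw [ha, hl]; ring
  have e2 : a * ((cJ : ℚ) / J) - c / N * b + 1 / 3 * (1 / (N : ℚ) ^ 2) * (1 / (J : ℚ) ^ 2) =
      (cJ - c) * (a * b) + 1 / 3 * (a ^ 2 * b ^ 2) := by rw [ha, hb]; ring
  rw [e1, e2, abs_of_pos (by positivity)]
  rcases eq_or_ne cJ c with rfl | hne
  · have hlt : l < b := one_div_lt_one_div_of_lt (by linarith) (by exact_mod_cast hJL rfl)
    rw [sub_self, zero_mul, zero_add, abs_of_pos (by positivity)]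
    have : l ^ 2 < b ^ 2 := by gcongr
    gcongr
  · have h1 : (1 : ℚ) ≤ |(cJ - c : ℚ)| := by
      exact_mod_cast Int.one_le_abs (sub_ne_zero.2 hne)
    have h2 : a * b ≤ |(cJ - c : ℚ) * (a * b)| := by
      rw [abs_mul, abs_of_pos (by positivity : 0 < a * b)]
      nlinarith [mul_pos ha0 hb0]
    have h3 := abs_sub_abs_le_abs_add ((cJ - c : ℚ) * (a * b)) (1 / 3 * (a ^ 2 * b ^ 2))
    rw [abs_of_pos (by positivity : 0 < 1 / 3 * (a ^ 2 * b ^ 2))] at h3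
    have h4 : a ^ 2 * b ^ 2 ≤ a ^ 2 * 1 := by gcongr; nlinarith
    have h5 : a ^ 2 * l ^ 2 ≤ a ^ 2 * 1 := by gcongr; nlinarith
    have h6 : a ^ 2 ≤ a * b := by rw [sq]; gcongr
    have h7 : 0 < a ^ 2 := by positivity
    linarith

/-- With v = 1/(NJ) ≤ 1, the right side is (c - cJ)v - v²/3 ≥ v - v²/3. The function v - v²/3
increases strictly on [0, 1], and v > 1/N² for J < N; the left side is its value at 1/N². -/
theorem lookup_lt_of_new {N J : ℕ} {c cJ : ℤ} (hJ : 1 ≤ J) (hJN : J < N) (hc : cJ ≤ c - 1) :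
    |1 / (N : ℚ) * ((c - 1 : ℤ) / N) - c / N * (1 / N) +
      1 / 3 * (1 / (N : ℚ) ^ 2) * (1 / (N : ℚ) ^ 2)| <
    |1 / (N : ℚ) * (cJ / J) - c / N * (1 / J) + 1 / 3 * (1 / (N : ℚ) ^ 2) * (1 / (J : ℚ) ^ 2)| := by
  have hJ0 : (1 : ℚ) ≤ J := by exact_mod_cast hJ
  have hJN0 : (J : ℚ) < N := by exact_mod_cast hJN
  have hN0 : (1 : ℚ) ≤ N := hJ0.trans hJN0.le
  set a : ℚ := 1 / N with ha
  set b : ℚ := 1 / J with hb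
  have ha0 : 0 < a := by positivity
  have hb0 : 0 < b := by positivity
  have hb1 : b ≤ 1 := by rw [hb, div_le_one (by linarith)]; exact hJ0
  have hab : a < b := one_div_lt_one_div_of_lt (by linarith) hJN0
  have e1 : a * (((c - 1 : ℤ) : ℚ) / N) - c / N * a + 1 / 3 * (1 / (N : ℚ) ^ 2) * (1 / (N : ℚ) ^ 2) =
      -(a * a - 1 / 3 * (a * a) ^ 2) := by rw [ha]; push_cast; ring
  have e2 : a * ((cJ : ℚ) / J) - c / N * b + 1 / 3 * (1 / (N : ℚ) ^ 2) * (1 / (J : ℚ) ^ 2) =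
      -((c - cJ) * (a * b) - 1 / 3 * (a * b) ^ 2) := by rw [ha, hb]; ring
  have hc' : (1 : ℚ) ≤ c - cJ := by
    have : (cJ : ℚ) ≤ c - 1 := by exact_mod_cast hc
    linarith
  have h1 : a * a < a * b := by gcongr
  have h2 : a * b ≤ 1 := by nlinarith
  have h0 : 0 < a * a := by positivity
  have h3 : a * b ≤ (c - cJ) * (a * b) := by nlinarith
  generalize a * a = u at *
  generalize a * b = v at *
  have h4 : (0 : ℚ) < u - 1 / 3 * u ^ 2 := by nlinarith
  have h5 : u - 1 / 3 * u ^ 2 < v - 1 / 3 * v ^ 2 := by nlinarith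
  rw [e1, e2, abs_neg, abs_neg, abs_of_pos h4, abs_of_pos (by linarith)]
  linarith

end TuringMachine

end TransformerTC

namespace TransformerTC

open Coord

namespace TuringMachine

variable {S : Type} {M : TuringMachine S} {d : ℕ}

/-! ### Correctness of the simulation -/

section Simulation

variable (e : Coord M.Q M.Γ ≃ Fin d) (O : Vec d → Vec d) (P : ℕ → Vec d) (w : List S)

/-- The seed, which describes an initial configuration. -/
noncomputable def simSeed : Vec d := fun j => M.cfgNet (fun _ => M.initCfg []) 0 (e.symm j)

/-- The outputs of the simulating Transformer on input `w`. -/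
noncomputable def simOut (t : ℕ) : Vec d :=
  (machineTransformer e O).out P (fun i j => M.embedNet (w.get i) (e.symm j)) (simSeed e) t

/-- The inputs of the decoder. -/
noncomputable def simInput (t : ℕ) (j : Fin (t + 1)) : Vec d := simOut e O P w j + P (j + 1)

/-- The output of the first decoder layer. -/
noncomputable def simFirst (t : ℕ) : Fin (t + 1) → Vec d :=
  simLayer e P w (simInput e O P w t) (transitionLayer O)

/-- The output of the second decoder layer. -/
noncomputable def simSecond (t : ℕ) : Fin (t + 1) → Vec d :=
  simLayer e P w (simFirst e O P w t) (historyLayer e)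

/-- The output of the third decoder layer. -/
noncomputable def simThird (t : ℕ) : Fin (t + 1) → Vec d :=
  simLayer e P w (simSecond e O P w t) (lookupLayer e)

variable {e O P w}

theorem simOut_succ (t : ℕ) (c : Coord M.Q M.Γ) : simOut e O P w (t + 1) (e c) =
    M.outputNet (fun c => simThird e O P w t (Fin.last t) (e c)) c := by
  rw [simOut, Transformer.out_succ]
  exact (congrFun (tDec_machineTransformer e O P w (simInput e O P w t)) (e c)).trans
    (onCoord_apply _ _ _ _)

theorem simOut_eq_zero (t : ℕ) (c : Coord M.Q M.Γ) (h₁ : c ≠ acc) (h₂ : ∀ q, c ≠ state q)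
    (h₃ : ∀ a, c ≠ sym a) (h₄ : c ≠ move) : simOut e O P w t (e c) = 0 := by
  rcases t with _ | t
  · rw [simOut, Transformer.out_zero]
    cases c <;> simp_all [simSeed, cfgNet]
  · rw [simOut_succ]
    cases c <;> simp_all [outputNet]

variable (hp : Positional e P O)
include hp

theorem simInput_one (t : ℕ) (j : Fin (t + 1)) : simInput e O P w t j (e one) = 1 := by
  simp [simInput, simOut_eq_zero, hp.one_eq]

theorem simInput_pos (t : ℕ) (j : Fin (t + 1)) :
    simInput e O P w t j (e pos) = ((j + 1 : ℕ) : ℚ) := by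
  simp [simInput, simOut_eq_zero, hp.pos_eq]

theorem simFirst_apply (t : ℕ) (j : Fin (t + 1)) (c : Coord M.Q M.Γ) (hc : c ≠ .inv)
    (hc' : c ≠ .invSq) : simFirst e O P w t j (e c) =
      M.transitionNet (fun c => simOut e O P w j (e c)) c +
        (M.externalNet w (j + 1) c + (simOut e O P w j (e c) + P (j + 1) (e c))) := by
  rw [simFirst, simLayer_transition w (simInput_one hp t j) (simInput_pos hp t j) hp c hc hc']
  congr 1
  have h₁ : ∀ q, P (j + 1) (e (state q)) = 0 := fun q => hp.other_eq _ _ nofun nofun nofun nofun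
  have h₂ : ∀ q, P (j + 1) (e (sym q)) = 0 := fun q => hp.other_eq _ _ nofun nofun nofun nofun
  cases c <;> simp [transitionNet, transSum, simInput, h₁, h₂]

theorem simFirst_one (t : ℕ) (j : Fin (t + 1)) : simFirst e O P w t j (e one) = 1 := by
  rw [simFirst_apply hp t j _ (by simp) (by simp)]
  simp [transitionNet, externalNet, simOut_eq_zero, hp.one_eq]

theorem simFirst_pos (t : ℕ) (j : Fin (t + 1)) :
    simFirst e O P w t j (e pos) = ((j + 1 : ℕ) : ℚ) := by
  rw [simFirst_apply hp t j _ (by simp) (by simp)]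
  simp [transitionNet, externalNet, simOut_eq_zero, hp.pos_eq]

theorem simFirst_inv (t : ℕ) (j : Fin (t + 1)) :
    simFirst e O P w t j (e .inv) = 1 / ((j + 1 : ℕ) : ℚ) := by
  refine simLayer_transition_inv w (simInput_one hp t j) (simInput_pos hp t j) hp ?_
  simp [simInput, simOut_eq_zero]

theorem simFirst_invSq (t : ℕ) (j : Fin (t + 1)) :
    simFirst e O P w t j (e .invSq) = 1 / ((j + 1 : ℕ) : ℚ) ^ 2 := by
  refine simLayer_transition_invSq w (simInput_one hp t j) (simInput_pos hp t j) hp ?_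
  simp [simInput, simOut_eq_zero]

theorem simSecond_apply (t : ℕ) (j : Fin (t + 1)) (c : Coord M.Q M.Γ) :
    simSecond e O P w t j (e c) =
      M.externalNet w (j + 1) c + (1 / ((j + 1 : ℕ) : ℚ) *
        ∑ i : Fin (j.val + 1),
          historyValue (fun c => simFirst e O P w t (Fin.castLE j.isLt i) (e c)) c
          + simFirst e O P w t j (e c)) :=
  simLayer_history w (simFirst_one hp t j) (simFirst_pos hp t j) hp c

theorem simThird_nextState (t : ℕ) (j : Fin (t + 1)) (q : M.Q) :
    simThird e O P w t j (e (nextState q)) =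
      M.transitionNet (fun c => simOut e O P w j (e c)) (nextState q) := by
  refine (decLayer_apply _ _ _ _ _ (by simp [lookupLayer, lookupValue])
    (by simp [encValue])).trans ?_
  rw [simSecond_apply hp, simFirst_apply hp t j _ (by simp) (by simp)]
  simp [lookupLayer, historyValue, externalNet, simOut_eq_zero, hp.other_eq]

/-- Once the state coordinates are all zero, they remain zero. -/
theorem simOut_dead (t : ℕ) (hs : ∀ q, simOut e O P w t (e (state q)) = 0)
    (ha : ∀ a, simOut e O P w t (e (sym a)) ≤ 1) (c : Coord M.Q M.Γ)
    (hc : c = acc ∨ ∃ q, c = state q) : simOut e O P w (t + 1) (e c) = 0 := by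
  have : ∀ q, simThird e O P w t (Fin.last t) (e (nextState q)) = 0 := by
    intro q
    rw [simThird_nextState hp]
    refine Finset.sum_eq_zero fun q' _ => Finset.sum_eq_zero fun a _ => ?_
    simp only [Fin.val_last]
    rw [hs, sigma_of_nonpos (by linarith [ha a]), mul_zero]
  rw [simOut_succ]
  rcases hc with rfl | ⟨q, rfl⟩ <;> simp [outputNet, this]

omit hp in
theorem simOut_sym_le_one (t : ℕ) (a : M.Γ) : simOut e O P w t (e (sym a)) ≤ 1 := by
  rcases t with _ | t
  · rw [simOut, Transformer.out_zero]
    simp only [simSeed, cfgNet, Equiv.symm_apply_apply]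
    split_ifs <;> simp
  · rw [simOut_succ]
    exact sigma_le_one _

omit hp in
open Classical in
theorem transSum_eq (g : M.Q × M.Γ × Move → ℚ) {x : Coord M.Q M.Γ → ℚ} {q : M.Q} {a : M.Γ}
    (hq : ∀ q', x (state q') = if q = q' then 1 else 0)
    (ha : ∀ a', x (sym a') = if a = a' then 1 else 0) :
    M.transSum g x = (M.δ q a).elim 0 g := by
  have : ∀ q' a', sigma (x (state q') + x (sym a') - 1) =
      if q = q' then if a = a' then 1 else 0 else 0 := by
    intro q' a'
    rw [hq, ha]
    split_ifs <;> norm_num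
    exact sigma_of_nonpos (by norm_num)
  simp [transSum, this]

omit hp in
theorem sum_sub_telescope (f : ℕ → ℤ) (t : ℕ) :
    ∑ i : Fin (t + 1), ((f i : ℚ) - f (i - 1 : ℕ)) = f t - f 0 := by
  -- The term with index 0 is zero by truncated subtraction; the others telescope.
  rw [Fin.sum_univ_eq_sum_range (fun i => (f i : ℚ) - f (i - 1 : ℕ)), Finset.sum_range_succ']
  simpa using Finset.sum_range_sub (fun i => (f i : ℚ)) t

section Live

variable {t : ℕ} {C : ℕ → M.Cfg}
  (hout : ∀ j ≤ t, ∀ c, simOut e O P w j (e c) = M.cfgNet C j c)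
include hout

omit hp in
theorem transSum_simOut {j : ℕ} (hj : j ≤ t) (g : M.Q × M.Γ × Move → ℚ) :
    M.transSum g (fun c => simOut e O P w j (e c)) =
      (M.δ (C j).state ((C j).tape (C j).head)).elim 0 g :=
  transSum_eq g (fun q => by simp [hout j hj, cfgNet]) (fun q => by simp [hout j hj, cfgNet])

theorem simOut_halted (hδ : M.step (C t) = none) (c : Coord M.Q M.Γ)
    (hc : c = acc ∨ ∃ q, c = state q) : simOut e O P w (t + 1) (e c) = 0 := by
  have : ∀ q, simThird e O P w t (Fin.last t) (e (nextState q)) = 0 := by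
    intro q
    have hδ' : M.δ (C t).state ((C t).tape (C t).head) = none := by simpa [step] using hδ
    rw [simThird_nextState hp, transitionNet, Fin.val_last, transSum_simOut hout le_rfl, hδ']
    rfl
  rw [simOut_succ]
  rcases hc with rfl | ⟨q, rfl⟩ <;> simp [outputNet, this]

variable (hrun : M.IsRun w (t + 1) C)
include hrun

theorem simFirst_nextMove (j : Fin (t + 1)) :
    simFirst e O P w t j (e nextMove) = (C (j + 1)).head - (C j).head := by
  obtain ⟨q, a, m, hδ, -, hh, -⟩ := step_eq_some (hrun.step j (by omega))
  rw [simFirst_apply hp t j _ (by simp) (by simp), transitionNet, transSum_simOut hout (by omega),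
    hδ, hh]
  simp [externalNet, simOut_eq_zero, hp.other_eq]

open Classical in
theorem simFirst_written (j : Fin (t + 1)) (b : M.Γ) : simFirst e O P w t j (e (written b)) =
    if (C (j + 1)).tape (C j).head = b then 1 else 0 := by
  obtain ⟨q, a, m, hδ, -, -, ht⟩ := step_eq_some (hrun.step j (by omega))
  rw [simFirst_apply hp t j _ (by simp) (by simp), transitionNet, transSum_simOut hout (by omega),
    hδ, ht]
  simp [externalNet, simOut_eq_zero, hp.other_eq]

open Classical in
theorem simThird_nextState_live (q : M.Q) :
    simThird e O P w t (Fin.last t) (e (nextState q)) =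
      if (C (t + 1)).state = q then 1 else 0 := by
  obtain ⟨q, a, m, hδ, hq, -, -⟩ := step_eq_some (hrun.step t (by omega))
  rw [simThird_nextState hp, transitionNet, Fin.val_last, transSum_simOut hout le_rfl, hδ, hq]
  rfl

omit hrun in
theorem simFirst_move (j : Fin (t + 1)) :
    simFirst e O P w t j (e move) = (C j).head - (C (j - 1)).head := by
  rw [simFirst_apply hp t j _ (by simp) (by simp), hout j (by omega)]
  simp [transitionNet, externalNet, hp.other_eq, cfgNet]

theorem simSecond_headPos (j : Fin (t + 1)) :
    simSecond e O P w t j (e headPos) = (C (j + 1)).head / ((j + 1 : ℕ) : ℚ) := by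
  rw [simSecond_apply hp, simFirst_apply hp t j _ (by simp) (by simp)]
  simp only [historyValue, simFirst_nextMove hp hout hrun]
  have := Fin.sum_univ_eq_sum_range (fun i => ((C (i + 1)).head : ℚ) - (C i).head) (j + 1)
  rw [Finset.sum_range_sub (fun i => ((C i).head : ℚ)), hrun.head_zero] at this
  simp only [Fin.val_castLE, this]
  simp [externalNet, simOut_eq_zero, hp.other_eq, transitionNet]
  ring

theorem simSecond_curPos (j : Fin (t + 1)) :
    simSecond e O P w t j (e curPos) = (C j).head / ((j + 1 : ℕ) : ℚ) := by
  rw [simSecond_apply hp, simFirst_apply hp t j _ (by simp) (by simp)]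
  simp only [historyValue, simFirst_move hp hout]
  have := sum_sub_telescope (fun i => (C i).head) j
  simp only [hrun.head_zero] at this
  simp only [Fin.val_castLE, this]
  simp [externalNet, simOut_eq_zero, hp.other_eq, transitionNet]
  ring

omit hout hrun in
theorem simSecond_inv (j : Fin (t + 1)) :
    simSecond e O P w t j (e .inv) = 1 / ((j + 1 : ℕ) : ℚ) := by
  rw [simSecond_apply hp, simFirst_inv hp]
  simp [externalNet, historyValue]

omit hout hrun in
theorem simSecond_invSq (j : Fin (t + 1)) :
    simSecond e O P w t j (e .invSq) = 1 / ((j + 1 : ℕ) : ℚ) ^ 2 := by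
  rw [simSecond_apply hp, simFirst_invSq hp]
  simp [externalNet, historyValue]

/-- The output of the decoder layers if the third layer attends to position `l`. -/
theorem simThird_apply (hM : M.NormalForm) {l : ℕ} (hlt : l ≤ t)
    (hl : (l < t ∧ (C l).head = (C (t + 1)).head ∧
        ∀ j ≤ t, (C j).head = (C (t + 1)).head → j ≤ l) ∨
      (l = t ∧ ∀ j ≤ t, (C j).head ≠ (C (t + 1)).head)) (c : Coord M.Q M.Γ) :
    simThird e O P w t (Fin.last t) (e c) = M.externalNet w (t + 1) c +
      (lookupValue (fun c => simSecond e O P w t ⟨l, by omega⟩ (e c)) c +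
        simSecond e O P w t (Fin.last t) (e c)) := by
  refine simLayer_lookup w (i := Fin.last t) (l := ⟨l, Nat.lt_succ_of_le hlt⟩) ?_ ?_ hp ?_ c
  · rw [simSecond_apply hp, simFirst_one hp]
    simp [externalNet, historyValue]
  · rw [simSecond_apply hp, simFirst_pos hp]
    simp [externalNet, historyValue]
  · intro j hj
    have hj' : (j : ℕ) ≠ l := fun h => hj (Fin.ext h)
    have hjt : (j : ℕ) ≤ t := Nat.le_of_lt_succ j.isLt
    simp only [simSecond_inv hp, simSecond_invSq hp, simSecond_curPos hp hout hrun,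
      simSecond_headPos hp hout hrun, Fin.val_castLE, Fin.val_last]
    rcases hl with ⟨hlt', hlc, hlast⟩ | ⟨rfl, hnew⟩
    · rw [hlc]
      refine lookup_lt_of_visited (by omega) (by omega) (by omega) fun h => ?_
      have := hlast j hjt h
      omega
    · have hlt := fun j (hj : j ≤ l) => hrun.head_lt_of_new hM hnew hj
      -- A new cell lies to the right of all visited ones and the head moves by one, so at the
      -- preceding time it was on the left neighbour.
      have h1 : (C l).head = (C (l + 1)).head - 1 := by
        have := hlt l le_rfl
        rcases hrun.head_succ hM (j := l) (by omega) with h | h <;> omega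
      rw [h1]
      refine lookup_lt_of_new (by omega) (by omega) ?_
      have := hlt j hjt
      omega

end Live

end Simulation

end TuringMachine

end TransformerTC

/-! ### The induction step of the simulation -/

namespace TransformerTC

open Coord

namespace TuringMachine

variable {S : Type} {M : TuringMachine S} {d : ℕ}

section Simulation

variable {e : Coord M.Q M.Γ ≃ Fin d} {O : Vec d → Vec d} {P : ℕ → Vec d} {w : List S}
  (hp : Positional e P O) {t : ℕ} {C : ℕ → M.Cfg}
  (hout : ∀ j ≤ t, ∀ c, simOut e O P w j (e c) = M.cfgNet C j c)
  (hrun : M.IsRun w (t + 1) C)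

include hp

theorem simSecond_eq_simFirst (j : Fin (t + 1)) (c : Coord M.Q M.Γ) (h₁ : c ≠ headPos)
    (h₂ : c ≠ curPos) : simSecond e O P w t j (e c) =
      M.externalNet w (j + 1) c + simFirst e O P w t j (e c) := by
  rw [simSecond_apply hp]
  cases c <;> simp_all [historyValue]

theorem simFirst_eq_externalNet (j : Fin (t + 1)) (c : Coord M.Q M.Γ)
    (hc : (∃ a, c = lastWritten a) ∨ (∃ a, c = .input a) ∨ c = lastTime ∨ c = inputPos) :
    simFirst e O P w t j (e c) = M.externalNet w (j + 1) c := by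
  rcases hc with ⟨a, rfl⟩ | ⟨a, rfl⟩ | rfl | rfl <;>
  rw [simFirst_apply hp t j _ (by simp) (by simp)] <;>
  simp [simOut_eq_zero, hp.other_eq, transitionNet]

include hout hrun

-- The attended time l is the latest earlier visit of the present cell, or t if there is none. The
-- two cases are distinguished by whether l < t, since the head moves in every step and so the cell
-- of time t cannot be the present one.
open Classical in
theorem simOut_live (hM : M.NormalForm) (c : Coord M.Q M.Γ) :
    simOut e O P w (t + 1) (e c) = M.cfgNet C (t + 1) c := by
  obtain ⟨l, hlt, hl⟩ : ∃ l ≤ t, (l < t ∧ (C l).head = (C (t + 1)).head ∧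
        ∀ j ≤ t, (C j).head = (C (t + 1)).head → j ≤ l) ∨
      (l = t ∧ ∀ j ≤ t, (C j).head ≠ (C (t + 1)).head) := by
    by_cases h : ∃ j ≤ t, (C j).head = (C (t + 1)).head
    · obtain ⟨j, hj, hj'⟩ := h
      have hspec := Nat.findGreatest_spec (P := fun j => (C j).head = (C (t + 1)).head) hj hj'
      have hle := Nat.findGreatest_le (P := fun j => (C j).head = (C (t + 1)).head) t
      refine ⟨_, hle, Or.inl ⟨lt_of_le_of_ne hle fun h => ?_, hspec,
        fun j hj hj' => Nat.le_findGreatest hj hj'⟩⟩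
      rw [h] at hspec
      rcases hrun.head_succ hM (j := t) (by omega) with h | h <;> omega
    · push Not at h
      exact ⟨t, le_rfl, Or.inr ⟨rfl, h⟩⟩
  have hz := simThird_apply hp hout hrun hM hlt hl
  have zpos : simThird e O P w t (Fin.last t) (e pos) = (t : ℚ) + 1 := by
    rw [hz, simSecond_eq_simFirst hp _ _ (by simp) (by simp), simFirst_pos hp]
    simp [externalNet, lookupValue]
  have zlast : simThird e O P w t (Fin.last t) (e lastTime) = (l : ℚ) + 1 := by
    rw [hz, simSecond_eq_simFirst hp _ _ (by simp) (by simp),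
      simFirst_eq_externalNet hp _ _ (by simp), lookupValue,
      simSecond_eq_simFirst hp _ _ (by simp) (by simp), simFirst_pos hp]
    simp [externalNet]
  have zwritten : ∀ a, simThird e O P w t (Fin.last t) (e (lastWritten a)) =
      if (C (l + 1)).tape (C l).head = a then 1 else 0 := by
    intro a
    rw [hz, simSecond_eq_simFirst hp _ _ (by simp) (by simp),
      simFirst_eq_externalNet hp _ _ (by simp), lookupValue,
      simSecond_eq_simFirst hp _ _ (by simp) (by simp), simFirst_written hp hout hrun]
    simp [externalNet]
  -- Nothing but external attention writes these coordinates, and each of the three layers adds the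
  -- same amount.
  have zinput : ∀ c : Coord M.Q M.Γ, (∃ a, c = .input a) ∨ c = inputPos →
      simThird e O P w t (Fin.last t) (e c) = 3 * M.externalNet w (t + 1) c := by
    intro c hc
    rw [hz, simSecond_eq_simFirst hp _ _ (by rintro rfl; simp at hc) (by rintro rfl; simp at hc),
      simFirst_eq_externalNet hp _ _ (by tauto)]
    rcases hc with ⟨a, rfl⟩ | rfl <;> simp only [lookupValue, Fin.val_last] <;> ring
  have zmove : simThird e O P w t (Fin.last t) (e nextMove) =
      (C (t + 1)).head - (C t).head := by
    rw [hz, simSecond_eq_simFirst hp _ _ (by simp) (by simp), simFirst_nextMove hp hout hrun]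
    simp [externalNet, lookupValue]
  have zstate := simThird_nextState_live hp hout hrun
  have s01 : ∀ p : Prop, [Decidable p] → sigma (if p then 1 else 0) = if p then 1 else 0 := by
    intro p _; split_ifs <;> simp
  rw [simOut_succ]
  cases c with
  | acc =>
    simp only [outputNet, cfgNet, zstate, s01]
    simp
  | state q =>
    simp only [outputNet, cfgNet, zstate, s01]
  | move =>
    simp only [outputNet, cfgNet, zmove, Nat.add_sub_cancel]
    rcases hrun.head_succ hM (j := t) (by omega) with h | h <;> rw [h] <;> push_cast
    · rw [show ((C t).head : ℚ) + 1 - (C t).head = 1 by ring]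
      rw [sigma_of_nonpos (x := -1) (by norm_num)]; simp
    · rw [show ((C t).head : ℚ) - 1 - (C t).head = -1 by ring]
      rw [sigma_of_nonpos (x := -1) (by norm_num)]; simp
  | sym a =>
    simp only [outputNet, cfgNet, zwritten, zpos, zlast, zinput _ (Or.inl ⟨a, rfl⟩),
      zinput _ (Or.inr rfl)]
    rcases hl with ⟨hlt', hlc, hlast⟩ | ⟨rfl, hnew⟩
    · have htape : (C (t + 1)).tape (C (t + 1)).head = (C (l + 1)).tape (C l).head := by
        rw [← hlc]
        refine hrun.tape_eq_written (by omega) fun j hj hlj h => ?_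
        have := hlast j (by omega) (h.trans hlc)
        omega
      -- Old cell: the visited bit is 1, which cancels the summands for the input letter and for the
      -- blank.
      have h1 : sigma ((t : ℚ) + 1 - (l + 1)) = 1 := by
        refine sigma_of_one_le ?_
        have : (l : ℚ) + 1 ≤ t := by exact_mod_cast hlt'
        linarith
      have h2 : ∀ x y : ℚ, sigma (sigma x - 1 - sigma y) = 0 := fun x y =>
        sigma_of_nonpos (by linarith [sigma_le_one x, sigma_nonneg y])
      have h3 : ∀ x : ℚ, sigma (sigma x - 1) = 0 := fun x =>
        sigma_of_nonpos (by linarith [sigma_le_one x])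
      rw [htape, h1, h2, h3, s01]
      simp [s01]
    · rw [hrun.symbol_of_new hM hnew]
      -- New cell: the visited bit is 0, which cancels the summand for the last written symbol.
      have h1 : sigma ((l : ℚ) + 1 - (l + 1)) = 0 := by simp
      have h3 : ∀ x : ℚ, sigma (sigma x + 0 - 1) = 0 := fun x =>
        sigma_of_nonpos (by linarith [sigma_le_one x])
      rw [h1, h3]
      simp only [externalNet]
      rcases Nat.lt_or_ge l w.length with hlw | hlw
      · rw [min_eq_left (by omega : l + 1 ≤ w.length)]
        have h4 : sigma (3 * ((l : ℚ) + 1) - 3 * ((l + 1 : ℕ) : ℚ)) = 0 := by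
          push_cast; simp
        -- The letter bit has been accumulated three times; truncation restores it.
        have h5 : ∀ p : Prop, [Decidable p] → sigma (3 * if p then (1 : ℚ) else 0) =
            if p then 1 else 0 := by
          intro p _
          split_ifs
          · exact sigma_of_one_le (by norm_num)
          · simp
        rw [h4, h5]
        simp [hlw, s01]
      · rw [min_eq_right (by omega : w.length ≤ l + 1)]
        have h4 : sigma (3 * ((l : ℚ) + 1) - 3 * ((w.length : ℕ) : ℚ)) = 1 := by
          refine sigma_of_one_le ?_
          have : (w.length : ℚ) ≤ l := by exact_mod_cast hlw
          linarith
        have h6 : ∀ x : ℚ, sigma (sigma x - 0 - 1) = 0 := fun x =>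
          sigma_of_nonpos (by linarith [sigma_le_one x])
        rw [h4, h6, List.getElem?_eq_none (by simpa using hlw)]
        simp [s01, eq_comm]
  | _ => simp [outputNet, cfgNet]

end Simulation

theorem init_not_mem_accept (hM : M.NormalForm) : M.init ∉ M.accept := by
  intro h
  obtain ⟨q, ⟨v, hv⟩, -⟩ := hM.reads
  simp [hM.accept_halts _ h] at hv

variable {e : Coord M.Q M.Γ ≃ Fin d} {O : Vec d → Vec d} {P : ℕ → Vec d}

theorem simOut_eq_cfgNet (hM : M.NormalForm) (hp : Positional e P O) {w : List S} {t : ℕ}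
    {C : ℕ → M.Cfg} (h : M.IsRun w t C) :
    ∀ j ≤ t, ∀ c, simOut e O P w j (e c) = M.cfgNet C j c := by
  induction t with
  | zero =>
    intro j hj c
    obtain rfl : j = 0 := by omega
    rw [simOut, Transformer.out_zero]
    have h0 := h.zero
    cases c <;> simp only [simSeed, cfgNet, Equiv.symm_apply_apply] <;> (try rw [h0]) <;>
      simp [initCfg] <;> rfl
  | succ t ih =>
    have ih := ih (h.mono t.le_succ)
    intro j hj c
    rcases Nat.lt_or_ge t j with hj' | hj'
    · obtain rfl : j = t + 1 := by omega
      exact simOut_live hp ih h hM c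
    · exact ih j hj' c

/-- Either the machine halted exactly one step before, or it halted earlier and the state bits were
already zero; without state bits no transition fires. -/
theorem simOut_of_cfgAt_eq_none (hM : M.NormalForm) (hp : Positional e P O) {w : List S} {t : ℕ}
    (h : M.cfgAt w t = none) (c : Coord M.Q M.Γ) (hc : c = acc ∨ ∃ q, c = state q) :
    simOut e O P w t (e c) = 0 := by
  induction t generalizing c with
  | zero => simp [cfgAt_zero] at h
  | succ t ih =>
    rcases ht : M.cfgAt w t with _ | c'
    · exact simOut_dead hp t (fun q => ih ht _ (Or.inr ⟨q, rfl⟩)) (simOut_sym_le_one t) c hc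
    · rw [cfgAt_succ, ht] at h
      refine simOut_halted hp
        (simOut_eq_cfgNet hM hp (isRun_of_cfgAt (by rw [ht]; rfl))) ?_ c hc
      simpa [ht] using h

theorem simOut_acc_pos_iff (hM : M.NormalForm) (hp : Positional e P O) (w : List S) (t : ℕ) :
    0 < simOut e O P w t (e acc) ↔ ∃ c, M.cfgAt w t = some c ∧ c.state ∈ M.accept := by
  rcases ht : M.cfgAt w t with _ | c'
  · simp [simOut_of_cfgAt_eq_none hM hp ht]
  · rw [simOut_eq_cfgNet hM hp (isRun_of_cfgAt (by rw [ht]; rfl)) t le_rfl]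
    simp only [cfgNet, ht]
    split_ifs with h <;> simp only [ht, Option.getD_some] at h <;> simpa using h

/-- The seed, which is time 0, is not an output. No acceptance is lost, as the initial state of a
normal form has a transition and so is not accepting. -/
theorem accepts_iff_simOut (hM : M.NormalForm) (hp : Positional e P O) (w : List S) :
    M.Accepts w ↔ ∃ r, 0 < simOut e O P w (r + 1) (e acc) := by
  simp only [simOut_acc_pos_iff hM hp]
  constructor
  · rintro ⟨c, hc, hacc⟩
    obtain ⟨t, ht⟩ := reaches_iff_cfgAt.1 hc
    rcases t with _ | t
    · cases ht
      exact absurd hacc (init_not_mem_accept hM)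
    · exact ⟨t, c, ht, hacc⟩
  · rintro ⟨r, c, hr, hacc⟩
    exact ⟨c, reaches_iff_cfgAt.2 ⟨_, hr⟩, hacc⟩

/-! ### The parameter functions are feed-forward networks -/

theorem feedForward_onCoord_of_isAffine {f : (Coord M.Q M.Γ → ℚ) → Coord M.Q M.Γ → ℚ}
    (h : ∀ c, IsAffine (fun x : Vec d => f (fun c => x (e c)) c)) : FeedForward (onCoord e f) :=
  .of_isAffine fun j => h (e.symm j)

theorem boundedNet_transSum (g : M.Q × M.Γ × Move → ℚ) :
    BoundedNet 1 (fun x : Vec d => M.transSum g (fun c => x (e c))) := by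
  refine .sum _ fun q => .sum _ fun a => .smul _ ?_
  exact .affine 0 (((IsAffine.coord _).add (.coord _)).sub (.const 1))

theorem feedForward_transitionNet : FeedForward (onCoord e M.transitionNet) := by
  refine .of_boundedNet 1 fun j => ?_
  simp only [onCoord]
  cases e.symm j <;> simp only [transitionNet] <;>
  first | exact boundedNet_transSum _ | exact .const _ _

theorem feedForward_outputNet : FeedForward (onCoord e M.outputNet) := by
  -- The symbol coordinates nest three activations; the other coordinates enter at the last round.
  refine .of_boundedNet 3 fun j => ?_
  have hc : ∀ c, IsAffine (fun x : Vec d => x (e c)) := fun c => .coord _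
  simp only [onCoord]
  cases e.symm j with
  | acc => exact .sum _ fun q => (BoundedNet.affine 2 (hc _)).smul _
  | state q => exact .affine 2 (hc _)
  | move => exact (BoundedNet.affine 2 (hc _)).sub (.affine 2 (hc _).neg)
  | sym a =>
    have h₁ := BoundedNet.affine 0 ((hc pos).sub (hc lastTime))
    have h₂ := BoundedNet.affine 0 (((hc pos).smul 3).sub (hc inputPos))
    have h₃ := BoundedNet.affine 0 (hc (lastWritten a))
    have h₄ := BoundedNet.affine 0 (hc (.input a))
    exact ((((h₃.add h₁).sub (.const _ 1)).layer.add ((h₄.sub h₁).sub h₂).layer).add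
      ((h₂.sub h₁).layer.smul _)).layer
  | _ => exact .const _ _

theorem feedForward_zero : FeedForward (fun _ : Vec d => (0 : Vec d)) :=
  .of_isAffine fun _ => .const 0

theorem feedForward_machineTransformer {Pr : (Vec d → Vec d) → Prop}
    (hPr : ∀ f : Vec d → Vec d, FeedForward f → Pr f) (hO : Pr O) :
    (machineTransformer e O).All Pr := by
  have h0 := hPr _ feedForward_zero
  have hc : ∀ c, IsAffine (fun x : Vec d => x (e c)) := fun c => .coord _
  refine ⟨?_, hPr (onCoord e encKey) ?_, hPr (onCoord e encValue) ?_, ?_,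
    hPr _ feedForward_outputNet⟩
  · simp only [machineTransformer, List.mem_singleton]
    rintro θ rfl
    exact ⟨h0, h0, h0, h0⟩
  · refine feedForward_onCoord_of_isAffine fun c => ?_
    cases c with
    | one => exact hc _
    | pos => exact (hc _).neg
    | _ => exact .const 0
  · refine feedForward_onCoord_of_isAffine fun c => ?_
    cases c with
    | input a => exact hc _
    | inputPos => exact hc _
    | _ => exact .const 0
  · simp only [machineTransformer, List.mem_cons, List.not_mem_nil, or_false]
    rintro θ (rfl | rfl | rfl)
    · exact ⟨h0, h0, h0, hO⟩
    · refine ⟨h0, h0, hPr (onCoord e historyValue) (feedForward_onCoord_of_isAffine fun c => ?_),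
        h0⟩
      cases c with
      | headPos => exact hc _
      | curPos => exact hc _
      | _ => exact .const 0
    · refine ⟨hPr (onCoord e lookupQuery) (feedForward_onCoord_of_isAffine fun c => ?_),
        hPr id (.of_isAffine fun j => .coord j),
        hPr (onCoord e lookupValue) (feedForward_onCoord_of_isAffine fun c => ?_), h0⟩
      · cases c with
        | curPos => exact hc _
        | inv => exact (hc _).neg
        | invSq => exact (hc _).smul _
        | _ => exact .const 0
      · cases c with
        | lastWritten a => exact hc _
        | lastTime => exact hc _
        | _ => exact .const 0

/-! ### Positional encodings -/

/-- The positional encoding by the position alone. -/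
def linearPos (d : ℕ) (i : ℕ) : Vec d := fun c =>
  if c.val + 4 = d then 1 else if c.val + 3 = d then (i : ℚ) else 0

/-- The transition function, together with the computation of inverses of positions. -/
noncomputable def transitionInvNet (x : Coord M.Q M.Γ → ℚ) : Coord M.Q M.Γ → ℚ
  -- The denominator equals the position for positions at least 1 and is at least 1 everywhere, as
  -- division in an admissible function requires.
  | .inv => 1 / (relu (x pos - 1) + 1)
  | .invSq => 1 / (relu (x pos - 1) + 1) * (1 / (relu (x pos - 1) + 1))
  | c => M.transitionNet x c

section Pos

variable (h₁ : (e one).val + 4 = d) (h₂ : (e pos).val + 3 = d)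
include h₁ h₂

/-- The variant for Turing completeness. Its encoding merely copies i, which is clearly a
linear-time task, whereas 1/i² would call for squaring; the inverses are left to an admissible
division in the first decoder layer. -/
theorem positional_linearPos : Positional e (linearPos d) (onCoord e M.transitionInvNet) where
  one_eq i := by simp [linearPos, h₁]
  pos_eq i := by
    rw [linearPos, if_neg (by omega), if_pos h₂]
  other_eq i c hc₁ hc₂ _ _ := by
    have n₁ : (e c).val ≠ (e one).val := fun h => hc₁ (e.injective (Fin.ext h))
    have n₂ : (e c).val ≠ (e pos).val := fun h => hc₂ (e.injective (Fin.ext h))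
    rw [linearPos, if_neg (by omega), if_neg (by omega)]
  inv_eq i a hi ha hinv := by
    have n₁ : (e .inv).val ≠ (e one).val := fun h => by simpa using e.injective (Fin.ext h)
    have n₂ : (e .inv).val ≠ (e pos).val := fun h => by simpa using e.injective (Fin.ext h)
    rw [linearPos, if_neg (by omega), if_neg (by omega)] at hinv
    have : (0 : ℚ) ≤ (i : ℚ) - 1 := by
      rw [sub_nonneg]; exact_mod_cast hi
    rw [hinv, onCoord_apply, transitionInvNet, ha, relu, max_eq_left this]
    ring
  invSq_eq i a hi ha hinv := by
    have n₁ : (e .invSq).val ≠ (e one).val := fun h => by simpa using e.injective (Fin.ext h)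
    have n₂ : (e .invSq).val ≠ (e pos).val := fun h => by simpa using e.injective (Fin.ext h)
    rw [linearPos, if_neg (by omega), if_neg (by omega)] at hinv
    have : (0 : ℚ) ≤ (i : ℚ) - 1 := by
      rw [sub_nonneg]; exact_mod_cast hi
    rw [hinv, onCoord_apply, transitionInvNet, ha, relu, max_eq_left this]
    ring
  transition_eq a c hc hc' := by
    cases c <;> simp_all [transitionInvNet]

/-- Here the encoding supplies the inverses, so the output function of the first decoder layer can
be a feed-forward network. -/
theorem positional_recipPos (h₃ : (e .inv).val + 2 = d) (h₄ : (e .invSq).val + 1 = d) :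
    Positional e (recipPos d) (onCoord e M.transitionNet) where
  one_eq i := by simp [recipPos, h₁]
  pos_eq i := by rw [recipPos, if_neg (by omega), if_pos h₂]
  other_eq i c hc₁ hc₂ hc₃ hc₄ := by
    have n₁ : (e c).val ≠ (e one).val := fun h => hc₁ (e.injective (Fin.ext h))
    have n₂ : (e c).val ≠ (e pos).val := fun h => hc₂ (e.injective (Fin.ext h))
    have n₃ : (e c).val ≠ (e .inv).val := fun h => hc₃ (e.injective (Fin.ext h))
    have n₄ : (e c).val ≠ (e .invSq).val := fun h => hc₄ (e.injective (Fin.ext h))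
    rw [recipPos, if_neg (by omega), if_neg (by omega), if_neg (by omega), if_neg (by omega)]
  inv_eq i a _ _ ha := by
    rw [ha, onCoord_apply]
    change 0 + _ = _
    rw [zero_add, recipPos, if_neg (by omega),
      if_neg (by omega), if_pos h₃]
  invSq_eq i a _ _ ha := by
    rw [ha, onCoord_apply]
    change 0 + _ = _
    rw [zero_add, recipPos, if_neg (by omega),
      if_neg (by omega), if_neg (by omega), if_pos h₄]
  transition_eq a c _ _ := by simp

end Pos

theorem piecewiseRationalMap_transitionInvNet :
    PiecewiseRationalMap (onCoord e M.transitionInvNet) := by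
  intro j
  have hden : PiecewiseRational (fun x : Vec d => 1 / (relu (x (e pos) - 1) + 1)) := by
    refine .div (.const 1) (.add (.relu ?_) (.const 1)) fun x => ?_
    · simpa [sub_eq_add_neg] using (PiecewiseRational.coord (e pos)).add (.const (-1))
    · have : 0 ≤ relu (x (e pos) - 1) := le_max_right _ _
      linarith
  have h := feedForward_transitionNet (e := e).piecewiseRationalMap j
  simp only [onCoord] at h ⊢
  cases hj : e.symm j with
  | inv => exact hden
  | invSq => exact hden.mul hden
  | _ => rw [hj] at h; exact h

theorem admissible_machineTransformer (hO : PiecewiseRationalMap O) :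
    (machineTransformer e O).Admissible where
  params := feedForward_machineTransformer (fun _ h => h.piecewiseRationalMap) hO
  score := piecewiseRational_absScore d
  normalize := Or.inl rfl

end TuringMachine

end TransformerTC

namespace TransformerTC

open Turing Computability

/-! ### Linear-time machines -/

section Push

variable {K : Type} [DecidableEq K] {Γ : K → Type} {Λ σ : Type}

/-- Push the elements of a list, the last one ending on top. -/
def pushAll (k : K) : List (Γ k) → TM2.Stmt Γ Λ σ → TM2.Stmt Γ Λ σ
  | [], q => q
  | a :: l, q => .push k (fun _ => a) (pushAll k l q)

theorem stepAux_pushAll (k : K) (l : List (Γ k)) (q : TM2.Stmt Γ Λ σ) (v : σ)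
    (S : ∀ k, List (Γ k)) : TM2.stepAux (pushAll k l q) v S =
      TM2.stepAux q v (Function.update S k (l.reverse ++ S k)) := by
  induction l generalizing S with
  | nil => simp [pushAll]
  | cons a l ih => simp [pushAll, ih]

end Push

/-! ### Functions on a finite alphabet -/

section FiniteFunction

variable {S Δ : Type} (L : S → List Δ)

/-- The alphabets of a machine with an input stack and an output stack. -/
abbrev ioAlphabet (α β : Type) : Bool → Type
  | false => α
  | true => β

open Classical in
/-- A program branching on the input symbol. -/
noncomputable def lookupStmt : List S → TM2.Stmt (ioAlphabet S Δ) Unit (Option S)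
  | [] => .halt
  | a :: l => .branch (fun v => v = some a)
      -- The output is read from the top of the stack, hence the reversal. A halting configuration
      -- has to carry the initial internal state, hence the reset.
      (pushAll (Γ := ioAlphabet S Δ) true (L a).reverse (.load (fun _ => none) .halt))
      (lookupStmt l)

theorem stepAux_lookupStmt {a : S} {l : List S} (h : a ∈ l) (T : ∀ k, List (ioAlphabet S Δ k)) :
    TM2.stepAux (lookupStmt L l) (some a) T =
      ⟨none, none, Function.update T true (L a ++ T true)⟩ := by
  induction l with
  | nil => simp at h
  | cons b l ih =>
    rcases eq_or_ne a b with rfl | hne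
    · simp [lookupStmt, stepAux_pushAll]
    · simp [lookupStmt, hne, ih (by simpa [hne] using h)]

/-- A machine computing a function on a finite alphabet in one step. -/
noncomputable def finiteFunctionMachine [Fintype S] : FinTM2 where
  K := Bool
  k₀ := false
  k₁ := true
  Γ := ioAlphabet S Δ
  Λ := Unit
  main := ()
  σ := Option S
  initialState := none
  Γk₀Fin := inferInstanceAs (Fintype S)
  m _ := .pop false (fun _ o => o) (lookupStmt L Finset.univ.toList)

/-- Functions on a finite alphabet are computable in constant time. -/
noncomputable def finiteFunctionComputable [Fintype S] {β : Type} (eb : β → List Δ) (f : S → β) :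
    TM2ComputableInTime (fun a : S => [a]) eb f where
  tm := finiteFunctionMachine fun a => eb (f a)
  inputAlphabet := Equiv.refl S
  outputAlphabet := Equiv.refl Δ
  time _ := Fintype.card S
  outputsFun a :=
    { steps := 1
      evals_in_steps := by
        change some (TM2.stepAux (lookupStmt (fun a => eb (f a)) Finset.univ.toList) (some a)
          (Function.update _ false _)) = some _
        rw [stepAux_lookupStmt _ (by simp)]
        refine congrArg some ?_
        unfold haltList
        congr 1
        funext k
        cases k
        · rfl
        · change eb (f a) ++ [] = List.map id (eb (f a))
          simp
      steps_le_m := Fintype.card_pos_iff.2 ⟨a⟩ }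

end FiniteFunction

/-! ### Finite automata -/

section Scan

variable {αΓ τ : Type} (step : τ → αΓ → τ) (init : τ) (out : τ → Bool)

/-- The program of a machine that folds over the input. -/
def scanStmt : TM2.Stmt (ioAlphabet αΓ Bool) Unit (τ × Bool) :=
  .pop false (fun v o => o.elim (v.1, true) fun a => (step v.1 a, false))
    (.branch (fun v => v.2)
      (.push true (fun v => out v.1) (.load (fun _ => (init, false)) .halt))
      (.goto fun _ => ()))

/-- A machine that folds over the input. -/
def scanMachine [Fintype αΓ] [Fintype τ] : FinTM2 where
  K := Bool
  k₀ := false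
  k₁ := true
  Γ := ioAlphabet αΓ Bool
  Λ := Unit
  main := ()
  σ := τ × Bool
  initialState := (init, false)
  Γk₀Fin := inferInstanceAs (Fintype αΓ)
  m _ := scanStmt step init out

/-- Stack contents given by the contents of the input and output stacks. -/
def ioStacks {α β : Type} (l : List α) (l' : List β) : ∀ k, List (ioAlphabet α β k)
  | false => l
  | true => l'

theorem scan_evals (l : List αΓ) (t : τ) :
    (flip bind (TM2.step fun _ : Unit => scanStmt step init out))^[l.length + 1]
      (some ⟨some (), (t, false), ioStacks l []⟩) =
    some ⟨none, (init, false), ioStacks [] [out (l.foldl step t)]⟩ := by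
  induction l generalizing t with
  | nil =>
    refine congrArg some ?_
    change TM2.stepAux (scanStmt step init out) _ _ = _
    simp only [scanStmt, TM2.stepAux, ioStacks, List.head?_nil, Option.elim, List.foldl_nil, cond]
    congr 1
    funext k
    cases k <;> rfl
  | cons a l ih =>
    rw [List.length_cons, Function.iterate_succ_apply, List.foldl_cons, ← ih]
    congr 1
    refine congrArg some ?_
    change TM2.stepAux (scanStmt step init out) _ _ = _
    simp only [scanStmt, TM2.stepAux, ioStacks, List.head?_cons, Option.elim, cond]
    congr 1
    funext k
    cases k <;> rfl

/-- Languages of finite automata are decided in linear time. -/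
theorem linearTime_foldl [Fintype αΓ] [Fintype τ] {α : Type} (ea : α → List αΓ) (f : α → Bool)
    (hf : ∀ a, f a = out ((ea a).foldl step init)) : LinearTime ea encodeBool f := by
  refine ⟨1, { tm := scanMachine step init out
               inputAlphabet := Equiv.refl αΓ
               outputAlphabet := Equiv.refl Bool
               time := fun n => n + 1
               outputsFun := fun a =>
                { steps := (ea a).length + 1
                  evals_in_steps := ?_
                  steps_le_m := le_rfl } }, fun n => by simp⟩
  have hinit : initList (scanMachine step init out) (List.map (Equiv.refl αΓ).invFun (ea a)) =
      (⟨some (), (init, false), ioStacks (ea a) []⟩ :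
        TM2.Cfg (ioAlphabet αΓ Bool) Unit (τ × Bool)) := by
    unfold initList
    congr 1
    funext k
    cases k
    · change List.map id _ = _
      simp [ioStacks]
    · rfl
  have hhalt : haltList (scanMachine step init out)
      (List.map (Equiv.refl Bool).invFun (encodeBool (f a))) =
      (⟨none, (init, false), ioStacks [] [out ((ea a).foldl step init)]⟩ :
        TM2.Cfg (ioAlphabet αΓ Bool) Unit (τ × Bool)) := by
    unfold haltList
    congr 1
    funext k
    cases k
    · rfl
    · change List.map id _ = _
      simp [ioStacks, encodeBool, hf]
  exact (congrArg _ (congrArg some hinit)).trans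
    ((scan_evals step init out (ea a) init).trans (congrArg some hhalt.symm))

end Scan

/-! ### Copying between two constant words -/

section Copy

/-- The alphabets of a machine with an input stack, an auxiliary stack and an output stack. -/
abbrev copyAlphabet (α β : Type) : Option Bool → Type
  | none => α
  | some false => α
  | some true => β

variable {α β : Type} [Inhabited α] (pre suf : List β) (g : α → β)

/-- The program of a machine that copies its input, between two constant words. -/
def copyStmt : Bool → TM2.Stmt (copyAlphabet α β) Bool (Option α)
  -- The first phase moves the input to the auxiliary stack, which reverses it, and then pushes the
  -- final constant word. The second phase moves it on to the output, which restores the order, and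
  -- then pushes the initial constant word.
  | false => .pop none (fun _ o => o)
      (.branch (fun v => v.isNone)
        (pushAll (Γ := copyAlphabet α β) (some true) suf.reverse (.goto fun _ => true))
        (.push (some false) (fun v => v.getD default) (.goto fun _ => false)))
  | true => .pop (some false) (fun _ o => o)
      (.branch (fun v => v.isNone)
        (pushAll (Γ := copyAlphabet α β) (some true) pre.reverse (.load (fun _ => none) .halt))
        (.push (some true) (fun v => g (v.getD default)) (.goto fun _ => true)))

/-- A machine that copies its input, between two constant words. -/
def copyMachine [Fintype α] : FinTM2 where
  K := Option Bool
  k₀ := none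
  k₁ := some true
  Γ := copyAlphabet α β
  Λ := Bool
  main := false
  σ := Option α
  initialState := none
  Γk₀Fin := inferInstanceAs (Fintype α)
  m := copyStmt pre suf g

/-- Stack contents given by the contents of the input, auxiliary and output stacks. -/
def copyStacks (l l' : List α) (l'' : List β) : ∀ k, List (copyAlphabet α β k)
  | none => l
  | some false => l'
  | some true => l''

theorem copy_evals_input (l l' : List α) (v : Option α) : ∃ v',
    (flip bind (TM2.step (copyStmt pre suf g)))^[l.length + 1]
      (some ⟨some false, v, copyStacks l l' []⟩) =
    some ⟨some true, v', copyStacks [] (l.reverse ++ l') suf⟩ := by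
  induction l generalizing l' v with
  | nil =>
    refine ⟨none, congrArg some ?_⟩
    simp only [copyStmt, TM2.stepAux, copyStacks, List.head?_nil, Option.isNone, cond,
      stepAux_pushAll]
    congr 1
    funext k
    rcases k with _ | _ | _ <;> simp [copyStacks]
  | cons a l ih =>
    obtain ⟨v', h⟩ := ih (a :: l') (some a)
    refine ⟨v', ?_⟩
    rw [List.length_cons, Function.iterate_succ_apply, List.reverse_cons, List.append_assoc,
      List.singleton_append, ← h]
    congr 1
    refine congrArg some ?_
    simp only [copyStmt, TM2.stepAux, copyStacks, List.head?_cons, Option.isNone, cond]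
    congr 1
    funext k
    rcases k with _ | _ | _ <;> rfl

theorem copy_evals_output (l : List α) (l' : List β) (v : Option α) :
    (flip bind (TM2.step (copyStmt pre suf g)))^[l.length + 1]
      (some ⟨some true, v, copyStacks [] l l'⟩) =
    some ⟨none, none, copyStacks [] [] (pre ++ l.reverse.map g ++ l')⟩ := by
  induction l generalizing l' v with
  | nil =>
    refine congrArg some ?_
    simp only [copyStmt, TM2.stepAux, copyStacks, List.head?_nil, Option.isNone, cond,
      stepAux_pushAll]
    congr 1
    funext k
    rcases k with _ | _ | _ <;> simp [copyStacks]
  | cons a l ih =>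
    have h := ih (g a :: l') (some a)
    rw [List.length_cons, Function.iterate_succ_apply, List.reverse_cons, List.map_append,
      List.map_singleton, ← List.append_assoc, List.append_assoc (_ ++ _), List.singleton_append,
      ← h]
    congr 1
    refine congrArg some ?_
    simp only [copyStmt, TM2.stepAux, copyStacks, List.head?_cons, Option.isNone, cond]
    congr 1
    funext k
    rcases k with _ | _ | _ <;> rfl

/-- Copying the input between two constant words takes linear time. -/
theorem linearTime_copy [Fintype α] {A B : Type} (ea : A → List α) (eb : B → List β) (f : A → B)
    (hf : ∀ a, eb (f a) = pre ++ (ea a).map g ++ suf) : LinearTime ea eb f := by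
  refine ⟨2, { tm := copyMachine pre suf g
               inputAlphabet := Equiv.refl α
               outputAlphabet := Equiv.refl β
               time := fun n => (n + 1) + (n + 1)
               outputsFun := fun a =>
                { steps := ((ea a).length + 1) + ((ea a).length + 1)
                  evals_in_steps := ?_
                  steps_le_m := le_rfl } }, fun n => by simp only; omega⟩
  obtain ⟨v', h₁⟩ := copy_evals_input pre suf g (ea a) [] none
  have h₂ := copy_evals_output pre suf g (ea a).reverse suf v'
  rw [List.length_reverse] at h₂
  rw [List.append_nil] at h₁
  rw [← h₁, ← Function.iterate_add_apply] at h₂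
  have hinit : initList (copyMachine pre suf g) (List.map (Equiv.refl α).invFun (ea a)) =
      (⟨some false, none, copyStacks (ea a) [] []⟩ :
        TM2.Cfg (copyAlphabet α β) Bool (Option α)) := by
    unfold initList
    congr 1
    funext k
    rcases k with _ | _ | _
    · change List.map id _ = _
      simp [copyStacks]
    · rfl
    · rfl
  have hhalt : haltList (copyMachine pre suf g)
      (List.map (Equiv.refl β).invFun (eb (f a))) =
      (⟨none, none, copyStacks [] [] (pre ++ (ea a).reverse.reverse.map g ++ suf)⟩ :
        TM2.Cfg (copyAlphabet α β) Bool (Option α)) := by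
    unfold haltList
    congr 1
    funext k
    rcases k with _ | _ | _
    · rfl
    · rfl
    · change List.map id _ = _
      simp [copyStacks, hf]
  exact (congrArg _ (congrArg some hinit)).trans (h₂.trans (congrArg some hhalt.symm))

end Copy

/-- Only coordinate d - 3 depends on i, and the reduced fraction i/1 is written as the binary digits
of i followed by fixed symbols. The encoded value is therefore the input between two constant words.
-/
theorem linearTime_linearPos {d : ℕ} (hd : 3 < d) :
    LinearTime encodeNat encodeVec (TuringMachine.linearPos d) := by
  let p : Fin d := ⟨d - 3, by omega⟩
  obtain ⟨l₁, l₂, hl⟩ := List.append_of_mem (List.mem_finRange p)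
  have hnd := List.nodup_finRange d
  rw [hl, List.nodup_append] at hnd
  have h₁ : ∀ c ∈ l₁, c ≠ p := fun c hc => hnd.2.2 c hc p (by simp)
  have h₂ : ∀ c ∈ l₂, c ≠ p := fun c hc h => by
    have := hnd.2.1
    simp_all
  have hother : ∀ i (c : Fin d), c ≠ p → TuringMachine.linearPos d i c =
      TuringMachine.linearPos d 0 c := by
    intro i c hc
    have : c.val ≠ d - 3 := fun h => hc (Fin.ext h)
    have : ¬ c.val + 3 = d := by omega
    simp [TuringMachine.linearPos, this]
  have hp : ∀ i, TuringMachine.linearPos d i p = (i : ℚ) := by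
    intro i
    rw [TuringMachine.linearPos, if_neg (by simp only [p]; omega), if_pos (by simp only [p]; omega)]
  have hcongr : ∀ i (l : List (Fin d)), (∀ c ∈ l, c ≠ p) →
      (l.flatMap fun c => encodeRat (TuringMachine.linearPos d i c)) =
        l.flatMap fun c => encodeRat (TuringMachine.linearPos d 0 c) := by
    intro i l hl
    exact List.flatMap_congr fun c hc => by rw [hother i c (hl c hc)]
  refine linearTime_copy (l₁.flatMap fun c => encodeRat (TuringMachine.linearPos d 0 c))
    ([Sum.inr 1] ++ (encodeNat 1).map Sum.inl ++ [Sum.inr 2] ++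
      l₂.flatMap fun c => encodeRat (TuringMachine.linearPos d 0 c)) Sum.inl _ _ _ fun i => ?_
  rw [encodeVec, hl, List.flatMap_append, List.flatMap_cons, hcongr i _ h₁, hcongr i _ h₂, hp]
  simp [encodeRat]

/-- The first symbol decides: a negative number begins with the minus sign, zero with the fraction
slash since 0 has no binary digits, and a positive number with a bit. An automaton only has to
remember whether the first symbol was a bit. -/
theorem linearTime_pos {d : ℕ} (hd : 0 < d) {p : Vec d → Prop} [DecidablePred p]
    (hp : ∀ x, p x ↔ 0 < x ⟨0, hd⟩) :
    LinearTime encodeVec encodeBool (fun x : Vec d => decide (p x)) := by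
  refine linearTime_foldl (τ := Option Bool) (fun t a => some (t.getD a.isLeft)) none
    (fun t => t.getD false) _ _ fun x => ?_
  have hfold : ∀ (l : List VecSym) (b : Bool),
      l.foldl (fun t a => some (Option.getD t a.isLeft)) (some b) = some b := by
    intro l b
    induction l with
    | nil => rfl
    | cons a l ih => simpa using ih
  obtain ⟨d, rfl⟩ := Nat.exists_eq_succ_of_ne_zero hd.ne'
  rw [encodeVec, List.finRange_succ, List.flatMap_cons]
  generalize List.flatMap _ _ = l
  have hp' : p x ↔ 0 < x 0 := hp x
  generalize x 0 = q at hp'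
  simp only [hp', encodeRat]
  rcases lt_trichotomy q 0 with h | rfl | h
  · simp [h, h.le.not_gt, hfold]
  · simp [encodeNat, encodeNum, hfold]
  · have hq : ¬ q < 0 := h.le.not_gt
    obtain ⟨b, t, hbt⟩ : ∃ b t, encodeNat q.num.natAbs = b :: t := by
      refine List.exists_cons_of_ne_nil fun h' => ?_
      have := decode_encodeNat q.num.natAbs
      rw [h'] at this
      have : q.num.natAbs = 0 := this.symm
      simp at this
      exact h.ne' this
    simp [h, hq, hbt, hfold]

end TransformerTC

namespace TransformerTC

open StateTransition

namespace TuringMachine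

variable {S : Type}

/-! ### Normal form -/

/-- States of the machine simulating a machine on a folded tape. -/
inductive FoldState (Q : Type)
  | start
  | read
  | back
  | sim (q : Q) (upper : Bool)
  | bounce (q : Q) (upper : Bool)

instance {Q : Type} [Fintype Q] : Fintype (FoldState Q) :=
  Fintype.ofEquiv (Fin 3 ⊕ (Q × Bool) ⊕ (Q × Bool))
    { toFun := fun
        | .inl 0 => .start
        | .inl 1 => .read
        | .inl 2 => .back
        | .inr (.inl (q, b)) => .sim q b
        | .inr (.inr (q, b)) => .bounce q b
      invFun := fun
        | .start => .inl 0
        | .read => .inl 1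
        | .back => .inl 2
        | .sim q b => .inr (.inl (q, b))
        | .bounce q b => .inr (.inr (q, b))
      left_inv := by
        rintro (i | ⟨q, b⟩ | ⟨q, b⟩)
        · fin_cases i <;> rfl
        · rfl
        · rfl
      right_inv := by rintro (_ | _ | _ | ⟨q, b⟩ | ⟨q, b⟩) <;> rfl }

variable (M : TuringMachine S)

/-- Symbols of the folded tape: a symbol of `M`, or a mark for the initial cell and the symbols in
the upper and the lower track. -/
abbrev FoldSym : Type := M.Γ ⊕ (Bool × M.Γ × M.Γ)

/-- The mark and the two tracks of a symbol of the folded tape. -/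
def foldView : M.FoldSym → Bool × M.Γ × M.Γ
  | .inl a => (false, a, M.blank)
  | .inr x => x

/-- Writing a symbol in one of the tracks. -/
def foldWrite (x : Bool × M.Γ × M.Γ) (upper : Bool) (a : M.Γ) : M.FoldSym :=
  .inr (x.1, if upper then (a, x.2.2) else (x.2.1, a))

/-- The state after a simulated movement, and the actual movement. -/
def foldMove (q : M.Q) (mark upper : Bool) : Move → FoldState M.Q × Move
  -- Cell -z lies on the lower track at z, so directions are reversed there. A move to the left from
  -- the origin enters the lower track by a physical move to the right. A stay becomes a move to the
  -- right and back, which is possible everywhere.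
  | .right => if upper then (.sim q true, .right) else (.sim q false, .left)
  | .left => if upper then (if mark then (.sim q false, .right) else (.sim q true, .left))
      else (.sim q false, .right)
  | .stay => (.bounce q upper, .right)

open Classical in
/-- The transition function of the machine with folded tape. -/
noncomputable def foldδ : FoldState M.Q → M.FoldSym → Option (FoldState M.Q × M.FoldSym × Move)
  | .start, s => some (.read, .inr (true, (M.foldView s).2), .right)
  | .read, s => if s = .inl M.blank then some (.back, s, .left) else some (.read, s, .right)
  -- As no step may stay on its cell, the simulation is entered by a move to the right and back.
  | .back, s => if (M.foldView s).1 then some (.bounce M.init true, s, .right)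
      else some (.back, s, .left)
  | .bounce q b, s => some (.sim q b, s, .left)
  | .sim q b, s =>
    if q ∈ M.accept then none else
      let x := M.foldView s
      -- On return to the origin from the lower track the flag is outdated; the mark overrides it,
      -- since the origin belongs to the upper track.
      let upper := b || x.1
      (M.δ q (if upper then x.2.1 else x.2.2)).map fun r =>
        let m := M.foldMove r.1 x.1 upper r.2.2
        (m.1, M.foldWrite x upper r.2.1, m.2)

/-- A machine in normal form simulating `M` on a folded tape. -/
noncomputable abbrev fold : TuringMachine S where
  Q := FoldState M.Q
  Γ := M.FoldSym
  blank := .inl M.blank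
  input := M.input.trans ⟨Sum.inl, Sum.inl_injective⟩
  input_ne_blank a h := M.input_ne_blank a (Sum.inl_injective h)
  δ := M.foldδ
  init := .start
  accept := {s | ∃ q ∈ M.accept, ∃ b, s = .sim q b}

theorem fold_initCfg_tape (w : List S) (z : ℤ) :
    (M.fold.initCfg w).tape z = .inl ((M.initCfg w).tape z) := by
  simp only [initCfg, fold]
  split_ifs
  · rw [← List.getD_map (f := (Sum.inl : M.Γ → M.FoldSym)), List.map_map]
    rfl
  · rfl

theorem fold_step {c : M.fold.Cfg} {q : FoldState M.Q} {s : M.FoldSym} {m : Move}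
    (h : M.foldδ c.state (c.tape c.head) = some (q, s, m)) :
    M.fold.step c = some ⟨q, c.head + m.toInt, Function.update c.tape c.head s⟩ := by
  have : M.fold.δ c.state (c.tape c.head) = some (q, s, m) := h
  rw [step, this]
  rfl

/-- The invariant of the configurations of the machine with folded tape. -/
structure FoldInv (c : M.fold.Cfg) : Prop where
  head_nonneg : 0 ≤ c.head
  mark : c.state ≠ FoldState.start → ∀ z, (M.foldView (c.tape z)).1 = true ↔ z = 0
  start : c.state = FoldState.start → c.head = 0 ∧ ∀ z, (M.foldView (c.tape z)).1 = false
  -- In these states the next step may go left without a test for the mark. The remaining leftward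
  -- moves start from cells known to be unmarked.
  pos : c.state = FoldState.read ∨ (∃ q b, c.state = FoldState.bounce q b) → 1 ≤ c.head

theorem foldInv_initCfg (w : List S) : M.FoldInv (M.fold.initCfg w) where
  head_nonneg := le_rfl
  mark h := absurd rfl h
  start _ := ⟨rfl, fun z => by rw [fold_initCfg_tape]; rfl⟩
  pos h := by rcases h with h | ⟨_, _, h⟩ <;> cases h

variable {M}

theorem FoldInv.update {c : M.fold.Cfg} (h : M.FoldInv c) (hs : c.state ≠ FoldState.start)
    {s : M.FoldSym} (hm : (M.foldView s).1 = (M.foldView (c.tape c.head)).1) (z : ℤ) :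
    (M.foldView (Function.update c.tape c.head s z)).1 = true ↔ z = 0 := by
  rcases eq_or_ne z c.head with rfl | hz
  · rw [Function.update_self, hm, h.mark hs]
  · rw [Function.update_of_ne hz, h.mark hs]

theorem FoldInv.step {c c' : M.fold.Cfg} (h : M.FoldInv c) (hc : M.fold.step c = some c') :
    M.FoldInv c' := by
  have h0 := h.head_nonneg
  obtain ⟨q, s, m, hδ, hq, hh, ht⟩ := step_eq_some hc
  change M.foldδ c.state (c.tape c.head) = some (q, s, m) at hδ
  suffices (q ≠ FoldState.start ∧
      (∀ z, (M.foldView (Function.update c.tape c.head s z)).1 = true ↔ z = 0)) ∧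
      0 ≤ c.head + m.toInt ∧
      (q = FoldState.read ∨ (∃ q' b, q = FoldState.bounce q' b) → 1 ≤ c.head + m.toInt) by
    obtain ⟨⟨h₁, h₂⟩, h₃, h₄⟩ := this
    constructor
    · rw [hh]; exact h₃
    · rw [ht]; exact fun _ => h₂
    · rw [hq]; exact fun h => absurd h h₁
    · rw [hh, hq]; exact h₄
  rcases hst : c.state with _ | _ | _ | ⟨q₀, b⟩ | ⟨q₀, b⟩ <;> rw [hst] at hδ
  · obtain ⟨hz, hm⟩ := h.start hst
    cases hδ
    refine ⟨⟨nofun, fun z => ?_⟩, by simp [hz, Move.toInt], by simp [hz, Move.toInt]⟩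
    rcases eq_or_ne z c.head with rfl | hz'
    · simp [hz, foldView]
    · rw [Function.update_of_ne hz', hm]
      simp
      omega
  all_goals
    have hns : c.state ≠ FoldState.start := by rw [hst]; nofun
    have hmark := h.mark hns c.head
  · have := h.pos (Or.inl hst)
    simp only [foldδ] at hδ
    split_ifs at hδ <;> cases hδ <;>
    refine ⟨⟨nofun, h.update hns rfl⟩, ?_, ?_⟩ <;> simp [Move.toInt] <;> omega
  · simp only [foldδ] at hδ
    split_ifs at hδ with hm <;> cases hδ <;>
    refine ⟨⟨nofun, h.update hns rfl⟩, ?_, ?_⟩ <;> simp [Move.toInt] <;> grind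
  · simp only [foldδ] at hδ
    by_cases hacc : q₀ ∈ M.accept
    · rw [if_pos hacc] at hδ
      cases hδ
    rw [if_neg hacc] at hδ
    simp only [Option.map_eq_some_iff] at hδ
    obtain ⟨⟨q', a, m'⟩, -, hr⟩ := hδ
    simp only [Prod.mk.injEq] at hr
    obtain ⟨rfl, rfl, rfl⟩ := hr
    refine ⟨⟨?_, h.update hns rfl⟩, ?_⟩
    · cases m' <;> simp only [foldMove] <;> (try split_ifs) <;> nofun
    · rcases hm : (M.foldView (c.tape c.head)).1 <;> rw [hm] at hmark <;>
      cases m' <;> cases b <;> simp [foldMove, Move.toInt] <;> grind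
  · have := h.pos (Or.inr ⟨_, _, hst⟩)
    cases hδ
    refine ⟨⟨nofun, h.update hns rfl⟩, ?_, ?_⟩ <;> simp [Move.toInt] <;> omega

theorem foldInv_of_reaches {w : List S} {c : M.fold.Cfg}
    (h : Reaches M.fold.step (M.fold.initCfg w) c) : M.FoldInv c := by
  induction h with
  | refl => exact M.foldInv_initCfg w
  | tail _ h ih => exact ih.step h

variable (M) in
theorem normalForm_fold : M.fold.NormalForm where
  no_stay q s q' s' m h := by
    change M.foldδ q s = _ at h
    rcases q with _ | _ | _ | ⟨q₀, b⟩ | ⟨q₀, b⟩ <;> simp only [foldδ] at h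
    · cases h; nofun
    · split_ifs at h <;> cases h <;> nofun
    · split_ifs at h <;> cases h <;> nofun
    · by_cases hacc : q₀ ∈ M.accept
      · rw [if_pos hacc] at h
        cases h
      rw [if_neg hacc] at h
      simp only [Option.map_eq_some_iff] at h
      obtain ⟨⟨q', a, m'⟩, -, hr⟩ := h
      simp only [Prod.mk.injEq] at hr
      obtain ⟨rfl, rfl, rfl⟩ := hr
      cases m' <;> simp only [foldMove] <;> (try split_ifs) <;> nofun
    · cases h; nofun
  head_nonneg _ _ h := (foldInv_of_reaches h).head_nonneg
  reads := by
    refine ⟨.read, ⟨_, rfl⟩, fun s hs => ⟨s, ?_⟩⟩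
    exact if_neg hs
  accept_halts := by
    rintro _ ⟨q, hq, b, rfl⟩ s
    exact if_pos hq

/-- The relation between configurations of a machine and of the machine with folded tape. -/
structure FoldRel (c : M.Cfg) (c' : M.fold.Cfg) : Prop where
  state : ∃ b, c'.state = FoldState.sim c.state b ∧ (c.head ≠ 0 → b = decide (0 < c.head))
  head : c'.head = c.head.natAbs
  tape : ∀ z, c.tape z = if 0 ≤ z then (M.foldView (c'.tape z.natAbs)).2.1
    else (M.foldView (c'.tape z.natAbs)).2.2
  mark : ∀ z, (M.foldView (c'.tape z)).1 = true ↔ z = 0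

variable (M) in
open Classical in
/-- The step function of a machine that halts in accepting states. -/
noncomputable def haltStep (c : M.Cfg) : Option M.Cfg := if c.state ∈ M.accept then none else M.step c

/-- The given machine may continue after accepting, whereas its folded version must halt. Cutting
the run at its first accepting configuration reconciles the two. -/
theorem accepts_iff_haltStep {w : List S} :
    M.Accepts w ↔ ∃ c, Reaches M.haltStep (M.initCfg w) c ∧ c.state ∈ M.accept := by
  constructor
  · rintro ⟨c, hc, hacc⟩
    refine Relation.ReflTransGen.head_induction_on hc ⟨c, .refl, hacc⟩ fun {a b} h _ ih => ?_
    by_cases ha : a.state ∈ M.accept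
    · exact ⟨a, .refl, ha⟩
    · obtain ⟨c', h', hacc'⟩ := ih
      refine ⟨c', .head ?_ h', hacc'⟩
      simpa [haltStep, ha] using h
  · rintro ⟨c, hc, hacc⟩
    refine ⟨c, Relation.ReflTransGen.mono (fun a b h => ?_) _ _ hc, hacc⟩
    rw [haltStep] at h
    split_ifs at h
    · simp at h
    · exact h

theorem FoldRel.tape_update {c : M.Cfg} {c' : M.fold.Cfg} (h : FoldRel c c') (a : M.Γ) (z : ℤ) :
    Function.update c.tape c.head a z =
      if 0 ≤ z then (M.foldView (Function.update c'.tape c'.head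
          (M.foldWrite (M.foldView (c'.tape c'.head)) (decide (0 ≤ c.head)) a) z.natAbs)).2.1
        else (M.foldView (Function.update c'.tape c'.head
          (M.foldWrite (M.foldView (c'.tape c'.head)) (decide (0 ≤ c.head)) a) z.natAbs)).2.2 := by
  by_cases hz : (z.natAbs : ℤ) = c'.head
  · rw [hz, Function.update_self, Function.update_apply, h.tape, hz]
    have := h.head
    by_cases h0 : 0 ≤ z <;> by_cases h1 : 0 ≤ c.head <;> by_cases h2 : z = c.head <;>
      simp [foldView, foldWrite, h0, h1, h2] <;> omega
  · rw [Function.update_of_ne hz, Function.update_of_ne, h.tape]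
    rintro rfl
    exact hz h.head.symm

theorem FoldRel.mark_update {c : M.Cfg} {c' : M.fold.Cfg} (h : FoldRel c c') (a : M.Γ) (b : Bool)
    (z : ℤ) : (M.foldView (Function.update c'.tape c'.head
      (M.foldWrite (M.foldView (c'.tape c'.head)) b a) z)).1 = true ↔ z = 0 := by
  rcases eq_or_ne z c'.head with rfl | hz
  · rw [Function.update_self, ← h.mark]
    rfl
  · rw [Function.update_of_ne hz, h.mark]

/-- The sign of the head position selects the track and its absolute value the cell. Moves take one
step and stays take two. -/
theorem fold_respects : Respects M.haltStep M.fold.step FoldRel := by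
  intro c c' h
  obtain ⟨b, hst, hb⟩ := h.state
  have hhead := h.head
  have hmark := h.mark c'.head
  by_cases hacc : c.state ∈ M.accept
  · have : M.foldδ c'.state (c'.tape c'.head) = none := by rw [hst]; exact if_pos hacc
    simp only [haltStep, hacc, if_true]
    rw [TuringMachine.step]
    change Option.map _ (M.foldδ c'.state (c'.tape c'.head)) = _
    rw [this]
    rfl
  -- The flag is reliable away from the origin, and at the origin the mark replaces it.
  have hup : (b || (M.foldView (c'.tape c'.head)).1) = decide (0 ≤ c.head) := by
    rcases lt_trichotomy c.head 0 with h0 | h0 | h0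
    · have h1 : (M.foldView (c'.tape c'.head)).1 = false := by
        rw [← Bool.not_eq_true, hmark]; omega
      rw [hb (by omega), h1]
      simp; omega
    · have h1 : (M.foldView (c'.tape c'.head)).1 = true := by
        rw [hmark]; omega
      rw [h1]
      simp; omega
    · rw [hb (by omega)]
      simp [h0, h0.le]
  have hsym : (if decide (0 ≤ c.head) = true then (M.foldView (c'.tape c'.head)).2.1
      else (M.foldView (c'.tape c'.head)).2.2) = c.tape c.head := by
    rw [h.tape, hhead]
    simp
  have hδ : M.foldδ c'.state (c'.tape c'.head) = (M.δ c.state (c.tape c.head)).map fun r =>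
      let m := M.foldMove r.1 (M.foldView (c'.tape c'.head)).1 (decide (0 ≤ c.head)) r.2.2
      (m.1, M.foldWrite (M.foldView (c'.tape c'.head)) (decide (0 ≤ c.head)) r.2.1, m.2) := by
    rw [hst]
    simp only [foldδ, if_neg hacc, hup, hsym]
  simp only [haltStep, hacc, if_false]
  rcases hr : M.δ c.state (c.tape c.head) with _ | ⟨q, a, m⟩
  · have h1 : M.step c = none := by rw [TuringMachine.step, hr]; rfl
    rw [h1]
    rw [hr] at hδ
    change Option.map _ (M.foldδ c'.state (c'.tape c'.head)) = _
    rw [hδ]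
    rfl
  have h1 : M.step c = some ⟨q, c.head + m.toInt, Function.update c.tape c.head a⟩ := by
    rw [TuringMachine.step, hr]; rfl
  rw [h1]
  rw [hr, Option.map_some] at hδ
  have hstep := M.fold_step hδ
  have htape := h.tape_update a
  have hmark' := h.mark_update a (decide (0 ≤ c.head))
  generalize Function.update c'.tape c'.head _ = T at hstep htape hmark'
  rcases m with _ | _ | _
  · refine ⟨_, ?_, .single hstep⟩
    constructor
    · simp only [foldMove]
      split_ifs with h2 h3 <;> simp only [decide_eq_true_eq] at h2 <;> (try rw [hmark] at h3) <;>
        refine ⟨_, rfl, fun h4 => ?_⟩ <;> simp only [Move.toInt] at h4 ⊢ <;>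
        first
        | exact (decide_eq_true (by omega)).symm
        | exact (decide_eq_false (by omega)).symm
    · simp only [foldMove]
      split_ifs with h2 h3 <;> simp only [decide_eq_true_eq] at h2 <;> (try rw [hmark] at h3) <;>
        simp only [Move.toInt] <;> omega
    · exact htape
    · exact hmark'
  · refine ⟨⟨.sim q (decide (0 ≤ c.head)), c'.head, T⟩, ?_, .head hstep (.single ?_)⟩
    · constructor
      · refine ⟨_, rfl, fun h4 => ?_⟩
        simp [Move.toInt] at h4 ⊢
        omega
      · simp [Move.toInt, hhead]
      · exact htape
      · exact hmark'
    · refine (M.fold_step rfl).trans ?_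
      simp [foldMove, Move.toInt]
  · refine ⟨_, ?_, .single hstep⟩
    constructor
    · simp only [foldMove]
      split_ifs with h2 <;> simp only [decide_eq_true_eq] at h2 <;>
        refine ⟨_, rfl, fun h4 => ?_⟩ <;> simp only [Move.toInt] at h4 ⊢ <;>
        first
        | exact (decide_eq_true (by omega)).symm
        | exact (decide_eq_false (by omega)).symm
    · simp only [foldMove]
      split_ifs with h2 <;> simp only [decide_eq_true_eq] at h2 <;>
        simp only [Move.toInt] <;> omega
    · exact htape
    · exact hmark'

variable (M) in
/-- The tape when the simulation starts. -/
def foldTape (w : List S) (z : ℤ) : M.FoldSym :=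
  if z = 0 then .inr (true, M.blank, M.blank) else .inl ((M.initCfg w).tape z)

theorem fold_step_same {q q' : FoldState M.Q} {z : ℤ} {T : ℤ → M.FoldSym} {m : Move}
    (h : M.foldδ q (T z) = some (q', T z, m)) :
    M.fold.step ⟨q, z, T⟩ = some ⟨q', z + m.toInt, T⟩ := by
  rw [M.fold_step (c := ⟨q, z, T⟩) h]
  simp

theorem fold_reaches_read (w : List S) {j : ℕ} (hj : j ≤ w.length) :
    Reaches M.fold.step (M.fold.initCfg w) ⟨.read, j + 1, M.foldTape w⟩ := by
  induction j with
  | zero =>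
    refine .single ?_
    rw [M.fold_step (c := M.fold.initCfg w) rfl]
    simp only [Option.mem_def, Option.some.injEq]
    congr 1
    funext z
    rcases eq_or_ne z 0 with rfl | hz
    · change Function.update _ 0 _ 0 = _
      rw [Function.update_self]
      change (.inr (true, (M.foldView ((M.fold.initCfg w).tape 0)).2) : M.FoldSym) = _
      rw [fold_initCfg_tape]
      simp [foldTape, foldView, initCfg]
    · change Function.update _ 0 _ z = _
      rw [Function.update_of_ne hz, fold_initCfg_tape, foldTape, if_neg hz]
  | succ j ih =>
    refine (ih (by omega)).tail ?_
    have : M.foldTape w ((j : ℤ) + 1) ≠ .inl M.blank := by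
      rw [foldTape, if_neg (by omega), IsRun.initCfg_tape, List.getElem?_eq_getElem (by simp; omega)]
      simp [M.input_ne_blank]
    have := fold_step_same (M := M) (q := .read) (T := M.foldTape w) (z := (j : ℤ) + 1)
      (if_neg this)
    rw [Option.mem_def, this]
    simp [Move.toInt]

theorem fold_reaches_back (w : List S) (j : ℕ) :
    Reaches M.fold.step ⟨.back, j, M.foldTape w⟩ ⟨.back, 0, M.foldTape w⟩ := by
  induction j with
  | zero => exact .refl
  | succ j ih =>
    refine .head ?_ ih
    rw [Option.mem_def, fold_step_same (q' := .back) (m := .left)]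
    · simp [Move.toInt]
    · have : M.foldTape w ((j + 1 : ℕ) : ℤ) = .inl ((M.initCfg w).tape ((j + 1 : ℕ) : ℤ)) :=
        if_neg (by omega)
      rw [this]
      rfl

theorem fold_reaches_sim (w : List S) : Reaches M.fold.step (M.fold.initCfg w)
    ⟨.sim M.init true, 0, M.foldTape w⟩ := by
  refine (fold_reaches_read w le_rfl).trans (.head (b := ⟨.back, w.length, M.foldTape w⟩) ?_
    ((fold_reaches_back w w.length).trans
      (.head (b := ⟨.bounce M.init true, 1, M.foldTape w⟩) ?_ (.single ?_))))
  · have : M.foldTape w ((w.length : ℤ) + 1) = .inl M.blank := by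
      rw [foldTape, if_neg (by omega), IsRun.initCfg_tape, List.getElem?_eq_none (by simp)]
      rfl
    have hδ : M.foldδ .read (M.foldTape w ((w.length : ℤ) + 1)) =
        some (.back, M.foldTape w ((w.length : ℤ) + 1), .left) := if_pos this
    rw [Option.mem_def, fold_step_same hδ]
    simp [Move.toInt]
  · have hδ : M.foldδ .back (M.foldTape w 0) =
        some (.bounce M.init true, M.foldTape w 0, .right) := by
      have : (M.foldView (M.foldTape w 0)).1 = true := rfl
      simp only [foldδ, if_pos this]
    exact fold_step_same hδ
  · exact fold_step_same (q' := .sim M.init true) (m := .left) rfl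

theorem foldRel_initCfg (w : List S) :
    FoldRel (M.initCfg w) ⟨.sim M.init true, 0, M.foldTape w⟩ where
  state := ⟨true, rfl, fun h => absurd rfl h⟩
  head := rfl
  tape z := by
    simp only [foldTape]
    rcases lt_trichotomy z 0 with h | rfl | h
    · rw [if_neg (by omega), if_neg (by omega)]
      simp only [initCfg]
      rw [if_neg (by omega)]
      rfl
    · simp [initCfg, foldView]
    · rw [if_pos h.le, if_neg (by omega), show (z.natAbs : ℤ) = z by omega]
      rfl
  mark z := by
    simp only [foldTape]
    split_ifs with h <;> simp [foldView, h]

-- The preparatory phase ends in a configuration related to the initial one. An accepting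
-- configuration of the folded machine halts, so by determinism it comes after that phase, and the
-- simulation can be traced back from it.
variable (M) in
theorem language_fold : M.fold.language = M.language := by
  ext w
  change M.fold.Accepts w ↔ M.Accepts w
  rw [accepts_iff_haltStep (M := M)]
  constructor
  · rintro ⟨c', hc', q, hq, b, hst⟩
    have hhalt : M.fold.step c' = none := by
      have : M.fold.δ c'.state (c'.tape c'.head) = none :=
        M.normalForm_fold.accept_halts _ ⟨q, hq, b, hst⟩ _
      rw [TuringMachine.step, this]
      rfl
    have heq_end : ∀ {d}, Reaches M.fold.step c' d → d = c' := by
      intro d hd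
      rcases Relation.ReflTransGen.cases_head hd with rfl | ⟨e, he, -⟩
      · rfl
      · rw [Option.mem_def, hhalt] at he
        cases he
    have hreach : Reaches M.fold.step ⟨.sim M.init true, 0, M.foldTape w⟩ c' := by
      rcases reaches_total (fold_reaches_sim w) hc' with h | h
      · exact h
      · rw [heq_end h]
        exact .refl
    obtain ⟨c₁, c₂, h₁, h₂, h₃⟩ := tr_reaches_rev fold_respects (foldRel_initCfg w) hreach
    obtain rfl := heq_end h₁
    obtain ⟨b', h₄, -⟩ := h₂.state
    rw [hst] at h₄
    injection h₄ with h₄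
    exact ⟨c₁, h₃, h₄ ▸ hq⟩
  · rintro ⟨c, hc, hacc⟩
    obtain ⟨c', h₁, h₂⟩ := tr_reaches fold_respects (foldRel_initCfg w) hc
    obtain ⟨b, h₃, -⟩ := h₁.state
    exact ⟨c', (fold_reaches_sim w).trans h₂, c.state, hacc, b, h₃⟩

end TuringMachine

end TransformerTC

/-! ### The converse: from Transformers to Turing machines -/

namespace TransformerTC

open Turing StateTransition

/-! ### From Post-Turing machines to Turing machines -/

namespace TuringMachine

/-- States of the Turing machine simulating a Post-Turing machine. -/
inductive PostState (Λ : Type)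
  | start
  | mark
  | accept
  | run (q : Λ)

instance {Λ : Type} [Fintype Λ] : Fintype (PostState Λ) :=
  Fintype.ofEquiv (Fin 3 ⊕ Λ)
    { toFun := fun
        | .inl 0 => .start
        | .inl 1 => .mark
        | .inl 2 => .accept
        | .inr q => .run q
      invFun := fun
        | .start => .inl 0
        | .mark => .inl 1
        | .accept => .inl 2
        | .run q => .inr q
      left_inv := by rintro (i | q) <;> [fin_cases i <;> rfl; rfl]
      right_inv := by rintro (_ | _ | _ | _) <;> rfl }

section Post

variable {S Γ Λ : Type} [Fintype Γ] [Inhabited Γ] [Inhabited Λ] (N : TM0.Machine Γ Λ)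
  (T : Finset Λ) (inp : S ↪ Γ) (hinp : ∀ a, inp a ≠ default) (μ : Γ → Γ)

/-- What a Post-Turing machine statement writes. -/
def stmtSymbol (g : Γ) : TM0.Stmt Γ → Γ
  | .move _ => g
  | .write a => a

/-- How a Post-Turing machine statement moves the head. -/
def stmtMove : TM0.Stmt Γ → Move
  | .move .left => .left
  | .move .right => .right
  | .write _ => .stay

open Classical in
/-- A Turing machine that goes to the first input cell, applies `μ` to its contents, simulates the
Post-Turing machine `N` restricted to the states in `T`, and accepts when `N` halts. -/
noncomputable abbrev ofPost : TuringMachine S where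
  Q := PostState T
  Γ := Γ
  blank := default
  input := inp
  input_ne_blank := hinp
  δ := fun
    | .start, g => some (.mark, g, .right)
    | .mark, g =>
      if h : default ∈ T then some (.run ⟨default, h⟩, μ g, .stay) else none
    | .run q, g =>
      match N q g with
      | none => some (.accept, g, .stay)
      | some (q', s) =>
        if h : q' ∈ T then some (.run ⟨q', h⟩, stmtSymbol g s, stmtMove s) else none
    | .accept, _ => none
  init := .start
  accept := {.accept}

variable {N T inp hinp μ}

/-- Configurations of the Post-Turing machine represented by those of the Turing machine. -/
def PostRel (c : TM0.Cfg Γ Λ) (C : (ofPost N T inp hinp μ).Cfg) : Prop :=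
  (∃ h : c.q ∈ T, C.state = .run ⟨c.q, h⟩) ∧ ∀ z, C.tape (C.head + z) = c.Tape.nth z

theorem PostRel.step (hT : TM0.Supports N T) {c : TM0.Cfg Γ Λ}
    {C : (ofPost N T inp hinp μ).Cfg} (h : PostRel c C) :
    (∀ c', TM0.step N c = some c' →
      ∃ C', (ofPost N T inp hinp μ).step C = some C' ∧ PostRel c' C') ∧
    (TM0.step N c = none →
      ∃ C', (ofPost N T inp hinp μ).step C = some C' ∧ C'.state = .accept) := by
  obtain ⟨⟨hq, hs⟩, ht⟩ := h
  obtain ⟨q, tp⟩ := c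
  have h0 : C.tape C.head = tp.head := by simpa using ht 0
  constructor
  · intro c' hc'
    simp only [TM0.step, Option.map_eq_some_iff] at hc'
    obtain ⟨⟨q', s⟩, hN, rfl⟩ := hc'
    have hq' : q' ∈ T := by simpa using hT.2 hN hq
    refine ⟨⟨.run ⟨q', hq'⟩, C.head + (stmtMove s).toInt,
      Function.update C.tape C.head (stmtSymbol tp.head s)⟩, ?_, ⟨hq', rfl⟩, ?_⟩
    · simp [TuringMachine.step, hs, h0, hN, hq']
    · intro z
      rcases s with (_ | _) | a
      · have h1 : Function.update C.tape C.head tp.head = C.tape := by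
          rw [← h0, Function.update_eq_self]
        simp only [stmtSymbol, stmtMove, h1, Tape.move_left_nth, ← ht, Move.toInt]
        congr 1; ring
      · have h1 : Function.update C.tape C.head tp.head = C.tape := by
          rw [← h0, Function.update_eq_self]
        simp only [stmtSymbol, stmtMove, h1, Tape.move_right_nth, ← ht, Move.toInt]
        congr 1; ring
      · simp only [stmtSymbol, stmtMove, Tape.write_nth, Move.toInt, add_zero,
          Function.update_apply, ← ht]
        by_cases hz : z = 0 <;> simp [hz]
  · intro hN
    simp only [TM0.step, Option.map_eq_none_iff] at hN
    exact ⟨⟨.accept, C.head + 0, Function.update C.tape C.head tp.head⟩,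
      by simp [TuringMachine.step, hs, h0, hN, Move.toInt], rfl⟩

theorem PostRel.accepts_iff (hT : TM0.Supports N T) {c : TM0.Cfg Γ Λ}
    {C : (ofPost N T inp hinp μ).Cfg} (h : PostRel c C) :
    (∃ C', Reaches (ofPost N T inp hinp μ).step C C' ∧ C'.state = .accept) ↔
      (StateTransition.eval (TM0.step N) c).Dom := by
  constructor
  · rintro ⟨C', hr, ha⟩
    induction hr using Relation.ReflTransGen.head_induction_on generalizing c with
    | refl =>
      obtain ⟨⟨hq, hs⟩, -⟩ := h
      rw [hs] at ha
      cases ha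
    | head hstep hr ih =>
      rcases hc : TM0.step N c with _ | c'
      · exact Part.dom_iff_mem.2 ⟨c, mem_eval.2 ⟨.refl, hc⟩⟩
      · obtain ⟨C₁, h₁, h₂⟩ := (h.step hT).1 c' hc
        rw [Option.mem_def, h₁, Option.some.injEq] at hstep
        subst hstep
        rw [reaches_eval (Relation.ReflTransGen.single hc)]
        exact ih h₂
  · intro hd
    obtain ⟨b, hb⟩ := Part.dom_iff_mem.1 hd
    obtain ⟨hr, hn⟩ := mem_eval.1 hb
    clear hb hd
    induction hr using Relation.ReflTransGen.head_induction_on generalizing C with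
    | refl =>
      obtain ⟨C', h₁, h₂⟩ := (h.step hT).2 hn
      exact ⟨C', .single h₁, h₂⟩
    | head hstep hr ih =>
      obtain ⟨C₁, h₁, h₂⟩ := (h.step hT).1 _ hstep
      obtain ⟨C', hr', ha⟩ := ih h₂
      exact ⟨C', .head h₁ hr', ha⟩

/-- Two steps bring the head from cell 0 to cell 1 and apply `μ` there, which establishes `PostRel`.
For the empty word both `headI` and cell 1 are blank. -/
theorem ofPost_accepts_iff (hT : TM0.Supports N T) (w : List S) :
    (ofPost N T inp hinp μ).Accepts w ↔
      (TM0.eval N (μ (w.map inp).headI :: (w.map inp).tail)).Dom := by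
  have hd : default ∈ T := by simpa using hT.1
  set M := ofPost N T inp hinp μ with hM
  set C₂ : M.Cfg := ⟨.run ⟨default, hd⟩, 1,
    Function.update (M.initCfg w).tape 1 (μ ((M.initCfg w).tape 1))⟩ with hC₂
  have h1 : M.step (M.initCfg w) = some ⟨.mark, 1, (M.initCfg w).tape⟩ := by
    simp [TuringMachine.step, M, initCfg, Move.toInt]
  have h2 : M.step ⟨.mark, 1, (M.initCfg w).tape⟩ = some C₂ := by
    simp [TuringMachine.step, M, hd, hC₂, Move.toInt]
  have hrel : PostRel (TM0.init (μ (w.map inp).headI :: (w.map inp).tail)) C₂ := by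
    refine ⟨⟨hd, rfl⟩, fun z => ?_⟩
    have h0 : (w.map inp).headI = (w.map inp).getD 0 default := by cases w <;> rfl
    rcases lt_trichotomy z 0 with hz | rfl | hz
    · obtain ⟨n, rfl⟩ : ∃ n : ℕ, z = -((n : ℤ) + 1) := ⟨(-z - 1).toNat, by omega⟩
      have : (TM0.init (μ (w.map inp).headI :: (w.map inp).tail) : TM0.Cfg Γ Λ).Tape.nth
          (-((n : ℤ) + 1)) = (ListBlank.mk ([] : List Γ)).nth n := rfl
      rw [this, ListBlank.nth_mk]
      simp only [hC₂]
      rw [Function.update_of_ne (by omega)]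
      simp only [initCfg]
      rw [if_neg (by omega)]
      simp [M, List.getI]
    · have : (TM0.init (μ (w.map inp).headI :: (w.map inp).tail) : TM0.Cfg Γ Λ).Tape.nth 0
          = μ (w.map inp).headI := rfl
      rw [this, h0]
      simp [hC₂, initCfg, M]
    · obtain ⟨n, rfl⟩ : ∃ n : ℕ, z = (n : ℤ) + 1 := ⟨(z - 1).toNat, by omega⟩
      have : (TM0.init (μ (w.map inp).headI :: (w.map inp).tail) : TM0.Cfg Γ Λ).Tape.nth
          ((n : ℤ) + 1) = (ListBlank.mk (w.map inp).tail).nth n := rfl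
      rw [this, ListBlank.nth_mk]
      simp only [hC₂]
      rw [Function.update_of_ne (by omega)]
      simp only [initCfg]
      rw [if_pos (by omega)]
      have : (1 + ((n : ℤ) + 1) - 1).toNat = n + 1 := by omega
      rw [this]
      cases w <;> simp [M, List.getI, List.getD_eq_getElem?_getD]
  rw [TM0.eval, Part.map_Dom, ← hrel.accepts_iff hT]
  constructor
  · rintro ⟨C, hr, ha⟩
    rcases Relation.ReflTransGen.cases_head hr with rfl | ⟨C', hs, hr⟩
    · cases ha
    rw [Option.mem_def, h1, Option.some.injEq] at hs
    subst hs
    rcases Relation.ReflTransGen.cases_head hr with rfl | ⟨C', hs, hr⟩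
    · cases ha
    rw [Option.mem_def, h2, Option.some.injEq] at hs
    subst hs
    exact ⟨C, hr, ha⟩
  · rintro ⟨C, hr, ha⟩
    exact ⟨C, .head h1 (.head h2 hr), ha⟩

end Post

/-! ### From stack machines to Turing machines -/

/-- A finitely supported stack machine whose input is written on its stack `k` (in reverse order)
is simulated by a Turing machine, which accepts when it halts. -/
theorem exists_accepts_iff_tm2 {K : Type} [DecidableEq K] [Fintype K] {Γ : K → Type}
    [∀ k, Fintype (Γ k)] {Λ σ : Type} [Inhabited Λ] [Inhabited σ] [Fintype σ]
    (N : Λ → TM2.Stmt Γ Λ σ) {T : Finset Λ} (hT : TM2.Supports N T) (k : K) :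
    ∃ M : TuringMachine (Γ k), ∀ w, M.Accepts w ↔ (TM2.eval N k w.reverse).Dom := by
  -- In the one-tape form of a stack machine a cell holds one entry per stack and a flag for the
  -- bottom. Letters are written with the flag `false`; the map passed as `μ` sets it on the first
  -- cell.
  let inp : Γ k ↪ TM2to1.Γ' K Γ :=
    ⟨fun a => (false, Function.update (fun _ => none) k (some a)), fun a b h => by
      simpa using congrFun (Prod.ext_iff.1 h).2 k⟩
  have hinp : ∀ a, inp a ≠ default := fun a h => by
    have h' : Function.update (fun k => (none : Option (Γ k))) k (some a) k = none :=
      congrFun (Prod.ext_iff.1 h).2 k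
    simp at h'
  refine ⟨ofPost (TM1to0.tr (TM2to1.tr N)) (TM1to0.trStmts _ (TM2to1.trSupp N T)) inp hinp
    (fun g => (⟨true, Prod.snd g⟩ : Bool × ∀ k, Option (Γ k))), fun w => ?_⟩
  refine (ofPost_accepts_iff (TM1to0.tr_supports _ (TM2to1.tr_supports N hT)) w).trans ?_
  rw [TM1to0.tr_eval, ← TM2to1.tr_eval_dom, TM2to1.trInit, List.reverse_reverse]
  rfl

end TuringMachine

end TransformerTC

namespace TransformerTC

open Turing StateTransition PartrecToTM2

/-! ### Feeding words to stack machines for partial recursive functions -/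

section WordInput

variable {S : Type}

/-- The stack alphabets of a machine with an additional stack for the input word. -/
abbrev WordStack (S : Type) : Option K' → Type
  | none => S
  | some _ => Γ'

instance [Fintype S] : ∀ k, Fintype (WordStack S k)
  | none => inferInstanceAs (Fintype S)
  | some _ => inferInstanceAs (Fintype Γ')

instance : Fintype K' := ⟨{.main, .rev, .aux, .stack}, by rintro (_ | _ | _ | _) <;> simp⟩

instance : Inhabited (Bool ⊕ PartrecToTM2.Λ') := ⟨.inl true⟩

/-- A statement executed on a machine with an additional stack. -/
def liftStmt (S : Type) : TM2.Stmt (fun _ : K' => Γ') PartrecToTM2.Λ' (Option Γ') →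
    TM2.Stmt (WordStack S) (Bool ⊕ PartrecToTM2.Λ') (Option S × Option Γ')
  | .push k f q => .push (some k) (fun v => f v.2) (liftStmt S q)
  | .peek k f q => .peek (some k) (fun v a => (v.1, f v.2 a)) (liftStmt S q)
  | .pop k f q => .pop (some k) (fun v a => (v.1, f v.2 a)) (liftStmt S q)
  | .load f q => .load (fun v => (v.1, f v.2)) (liftStmt S q)
  | .branch f q₁ q₂ => .branch (fun v => f v.2) (liftStmt S q₁) (liftStmt S q₂)
  | .goto l => .goto fun v => .inr (l v.2)
  | .halt => .halt

/-- The contents of the stacks of a machine with an additional stack. -/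
def liftStk (u : List S) (s : K' → List Γ') : ∀ k, List (WordStack S k)
  | none => u
  | some k => s k

/-- A configuration of a machine with an additional stack. -/
def liftCfg (x : Option S) (u : List S)
    (c : TM2.Cfg (fun _ : K' => Γ') PartrecToTM2.Λ' (Option Γ')) :
    TM2.Cfg (WordStack S) (Bool ⊕ PartrecToTM2.Λ') (Option S × Option Γ') :=
  ⟨c.l.map .inr, (x, c.var), liftStk u c.stk⟩

theorem update_liftStk_some (u : List S) (s : K' → List Γ') (k : K') (l : List Γ') :
    Function.update (liftStk u s) (some k) l = liftStk u (Function.update s k l) := by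
  funext k'
  rcases k' with _ | k'
  · rfl
  · by_cases h : k' = k
    · subst h; simp [liftStk]
    · have : (some k' : Option K') ≠ some k := by simpa using h
      simp [liftStk, Function.update_of_ne h, Function.update_of_ne this]

theorem update_liftStk_none (u u' : List S) (s : K' → List Γ') :
    Function.update (liftStk u s) none u' = liftStk u' s := by
  funext k'
  rcases k' with _ | k' <;> rfl

theorem stepAux_liftStmt (x : Option S) (u : List S)
    (q : TM2.Stmt (fun _ : K' => Γ') PartrecToTM2.Λ' (Option Γ')) (v : Option Γ')
    (s : K' → List Γ') :
    TM2.stepAux (liftStmt S q) (x, v) (liftStk u s) = liftCfg x u (TM2.stepAux q v s) := by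
  induction q generalizing v s with
  | push k f q ih => rw [liftStmt, TM2.stepAux, TM2.stepAux, update_liftStk_some]; exact ih _ _
  | peek k f q ih => exact ih _ _
  | pop k f q ih => rw [liftStmt, TM2.stepAux, TM2.stepAux, update_liftStk_some]; exact ih _ _
  | load f q ih => exact ih _ _
  | branch f q₁ q₂ ih₁ ih₂ =>
    rw [liftStmt, TM2.stepAux, TM2.stepAux]
    dsimp only
    cases f v
    · exact ih₂ _ _
    · exact ih₁ _ _
  | goto l => rfl
  | halt => rfl

theorem supportsStmt_liftStmt {T : Finset PartrecToTM2.Λ'}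
    {T' : Finset (Bool ⊕ PartrecToTM2.Λ')} (hT : ∀ l ∈ T, .inr l ∈ T')
    (q : TM2.Stmt (fun _ : K' => Γ') PartrecToTM2.Λ' (Option Γ')) (hq : TM2.SupportsStmt T q) :
    TM2.SupportsStmt T' (liftStmt S q) := by
  induction q with
  | branch f q₁ q₂ ih₁ ih₂ => exact ⟨ih₁ hq.1, ih₂ hq.2⟩
  | goto l => exact fun v => hT _ (hq v.2)
  | halt => trivial
  | _ => rename_i ih; exact ih hq

/-- The stack symbol for a bit. -/
def bitSym (b : Bool) : Γ' := cond b .bit1 .bit0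

/-- Folding from the left puts the push for the last element outermost, so it is executed first and
the list ends on the stack in its original order. -/
theorem stepAux_foldl_push [DecidableEq S] (x : S) (l : List S)
    (q : TM2.Stmt (WordStack S) (Bool ⊕ PartrecToTM2.Λ') (Option S × Option Γ'))
    (u : List S) (m : List Γ') :
    TM2.stepAux (l.foldl
        (fun q s => .push (some .main) (fun v => bitSym (decide (some s = v.1))) q) q)
      (some x, none) (liftStk u (K'.elim m [] [] [])) =
    TM2.stepAux q (some x, none)
      (liftStk u (K'.elim ((l.map fun s => decide (s = x)).map bitSym ++ m) [] [] [])) := by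
  induction l generalizing q with
  | nil => rfl
  | cons s l ih =>
    rw [List.foldl_cons, ih, TM2.stepAux, update_liftStk_some, K'.elim_update_main]
    simp [liftStk]

variable [Fintype S] [DecidableEq S]

/-- The one-hot code of a letter. -/
noncomputable def oneHot (a : S) : List Bool := (Finset.univ.toList).map fun s => decide (s = a)

/-- A natural number coding a word; its binary expansion is the concatenation of the codes of the
letters, each of which ends in `1`. -/
noncomputable def wordCode (w : List S) : ℕ :=
  w.foldr (fun a n => (oneHot a).foldr Nat.bit (Nat.bit true n)) 0

theorem trNat_bit_true (n : ℕ) : trNat (Nat.bit true n) = .bit1 :: trNat n := by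
  rw [trNat, trNat, ← Num.ofNat'_eq, ← Num.ofNat'_eq, Num.ofNat'_bit]
  cases Num.ofNat' n <;> rfl

theorem trNat_bit_false {n : ℕ} (hn : n ≠ 0) : trNat (Nat.bit false n) = .bit0 :: trNat n := by
  rw [trNat, trNat, ← Num.ofNat'_eq, ← Num.ofNat'_eq, Num.ofNat'_bit]
  rcases h : Num.ofNat' n with _ | p
  · rw [Num.ofNat'_eq] at h
    have : ((n : Num) : ℕ) = 0 := by rw [h]; rfl
    rw [Num.to_of_nat] at this
    exact absurd this hn
  · rfl

/-- Digits are listed with the least significant first, and `n ≠ 0` prevents the loss of leading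
zeros. The closing `1` of each letter code exists to guarantee this. -/
theorem trNat_foldr_bit (l : List Bool) {n : ℕ} (hn : n ≠ 0) :
    trNat (l.foldr Nat.bit n) = l.map bitSym ++ trNat n := by
  have key : l.foldr Nat.bit n ≠ 0 ∧ trNat (l.foldr Nat.bit n) = l.map bitSym ++ trNat n := by
    induction l with
    | nil => exact ⟨hn, rfl⟩
    | cons b l ih =>
      refine ⟨Nat.bit_ne_zero b ih.1, ?_⟩
      cases b
      · rw [List.foldr_cons, trNat_bit_false ih.1, ih.2]; rfl
      · rw [List.foldr_cons, trNat_bit_true, ih.2]; rfl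
  exact key.2

theorem trNat_wordCode_cons (a : S) (w : List S) :
    trNat (wordCode (a :: w)) = (oneHot a).map bitSym ++ .bit1 :: trNat (wordCode w) := by
  rw [wordCode, List.foldr_cons, trNat_foldr_bit _ (by simp [Nat.bit]), trNat_bit_true]
  rfl

/-- The stack machine for the code `c`, preceded by a conversion of the input word. -/
noncomputable def wordMachine (S : Type) [Fintype S] [DecidableEq S] (c : ToPartrec.Code) :
    Bool ⊕ PartrecToTM2.Λ' →
      TM2.Stmt (WordStack S) (Bool ⊕ PartrecToTM2.Λ') (Option S × Option Γ')
  -- `Γ'.cons` terminates the number; the digits are then pushed on top of it.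
  | .inl true => .push (some .main) (fun _ => Γ'.cons) (.goto fun _ => .inl false)
  | .inl false =>
    .pop none (fun v a => (a, v.2))
      (.branch (fun v => v.1.isNone) (.goto fun _ => .inr (trNormal c .halt))
        -- The closing digit of the letter code is pushed first because it lies below the one-hot
        -- digits.
        (.push (some .main) (fun _ => Γ'.bit1)
          ((Finset.univ.toList (α := S)).foldl
            (fun q s => .push (some .main) (fun v => bitSym (decide (some s = v.1))) q)
            (.goto fun _ => .inl false))))
  | .inr l => liftStmt S (tr l)

/-- The labels used by `wordMachine`. -/
noncomputable def wordSupp (c : ToPartrec.Code) : Finset (Bool ⊕ PartrecToTM2.Λ') :=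
  {.inl true, .inl false} ∪ (codeSupp c .halt).map ⟨.inr, Sum.inr_injective⟩

theorem supports_wordMachine (c : ToPartrec.Code) :
    TM2.Supports (wordMachine S c) (wordSupp c) := by
  have hsupp := tr_supports c .halt
  have hinr : ∀ l ∈ codeSupp c .halt, (.inr l : Bool ⊕ PartrecToTM2.Λ') ∈ wordSupp c := by
    intro l hl
    simp [wordSupp, hl]
  refine ⟨by simp [wordSupp, default], fun q hq => ?_⟩
  rcases q with (_ | _) | l
  · refine ⟨fun _ => hinr _ hsupp.1, ?_⟩
    have : ∀ (l : List S) (q : TM2.Stmt (WordStack S) (Bool ⊕ PartrecToTM2.Λ')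
        (Option S × Option Γ')), TM2.SupportsStmt (wordSupp c) q →
        TM2.SupportsStmt (wordSupp c) (l.foldl
            (fun q s => .push (some .main) (fun v => bitSym (decide (some s = v.1))) q) q) := by
      intro l
      induction l with
      | nil => exact fun q hq => hq
      | cons s l ih => exact fun q hq => ih _ hq
    exact this _ _ fun _ => by simp [wordSupp]
  · exact fun _ => by simp [wordSupp]
  · refine supportsStmt_liftStmt hinr _ (hsupp.2 l ?_)
    simpa [wordSupp] using hq

/-- Loop invariant: `u` is still on the input stack, last letter of the remaining prefix on top, and
`w` has been coded. Each popped letter is put in front of `w`. -/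
theorem wordMachine_reaches (c : ToPartrec.Code) (u w : List S) (x : Option S) :
    Reaches (TM2.step (wordMachine S c))
      ⟨some (.inl false), (x, none), liftStk u (K'.elim (trList [wordCode w]) [] [] [])⟩
      (liftCfg none [] (PartrecToTM2.init c [wordCode (u.reverse ++ w)])) := by
  induction u generalizing w x with
  | nil => 
    refine Relation.ReflTransGen.single ?_
    rw [Option.mem_def, TM2.step]
    congr 1
    rw [wordMachine, TM2.stepAux, TM2.stepAux, TM2.stepAux, update_liftStk_none]
    rfl
  | cons a u ih =>
    have := ih (a :: w) (some a)
    rw [List.reverse_cons, List.append_assoc]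
    refine Relation.ReflTransGen.head ?_ this
    rw [Option.mem_def, TM2.step]
    congr 1
    rw [wordMachine, TM2.stepAux, TM2.stepAux, TM2.stepAux, update_liftStk_none,
      update_liftStk_some]
    simp only [liftStk, List.head?_cons, Option.isNone_some, cond_false, List.tail_cons,
      K'.elim_update_main, K'.elim_main]
    refine (stepAux_foldl_push a _ _ _ _).trans ?_
    rw [TM2.stepAux]
    simp only [trList, trNat_wordCode_cons, List.append_assoc, List.cons_append]
    rfl

theorem wordMachine_eval_dom (c : ToPartrec.Code) (w : List S) :
    (TM2.eval (wordMachine S c) none w.reverse).Dom ↔ (c.eval [wordCode w]).Dom := by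
  have h0 : Reaches (TM2.step (wordMachine S c)) (TM2.init none w.reverse)
      ⟨some (.inl false), (none, none), liftStk w.reverse (K'.elim (trList [wordCode ([] : List S)])
        [] [] [])⟩ := by
    refine Relation.ReflTransGen.single ?_
    have : Function.update (fun k => ([] : List (WordStack S k))) none w.reverse =
        liftStk w.reverse (K'.elim [] [] [] []) := by
      funext k
      rcases k with _ | (_ | _ | _ | _) <;> rfl
    rw [Option.mem_def, TM2.init, this]
    change some _ = _
    congr 1
    change TM2.stepAux (wordMachine S c (.inl true)) _ _ = _
    rw [wordMachine, TM2.stepAux, update_liftStk_some, K'.elim_update_main]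
    simp [liftStk, wordCode]
    rfl
  have h1 := h0.trans (wordMachine_reaches c w.reverse [] none)
  rw [List.reverse_reverse, List.append_nil] at h1
  rw [TM2.eval, Part.map_Dom, reaches_eval h1]
  have hr : Respects (TM2.step tr) (TM2.step (wordMachine S c))
      (fun a b => liftCfg none [] a = b) := by
    refine fun_respects.2 fun a => ?_
    rcases a with ⟨_ | l, v, s⟩
    · rfl
    · refine Relation.TransGen.single ?_
      change some _ = some _
      congr 1
      exact stepAux_liftStmt _ _ _ _ _
  refine (tr_eval_dom hr (a₁ := PartrecToTM2.init c [wordCode w]) rfl).trans ?_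
  have := PartrecToTM2.tr_eval c [wordCode w]
  rw [this]
  rfl

theorem primrec_bit : Primrec₂ Nat.bit := by
  refine ((Primrec.cond Primrec.fst (Primrec.nat_double_succ.comp Primrec.snd)
    (Primrec.nat_double.comp Primrec.snd)).of_eq ?_ : Primrec fun p : Bool × ℕ => Nat.bit p.1 p.2)
  rintro ⟨_ | _, n⟩ <;> rfl

theorem primrec_wordCode [Primcodable S] : Primrec (wordCode (S := S)) := by
  have h : Primrec₂ fun (a : S) (n : ℕ) => (oneHot a).foldr Nat.bit (Nat.bit true n) :=
    Primrec.list_foldr ((Primrec.dom_finite oneHot).comp Primrec.fst)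
      (primrec_bit.comp (Primrec.const true) Primrec.snd)
      ((primrec_bit.comp Primrec.fst Primrec.snd).comp Primrec.snd).to₂
  exact Primrec.list_foldr Primrec.id (Primrec.const 0)
    ((h.comp Primrec.fst Primrec.snd).comp Primrec.snd).to₂

/-- All letter codes have the same length, so the digit string splits uniquely into letters. The
rest of the argument recovers a number from its list of digits. -/
theorem wordCode_injective : Function.Injective (wordCode (S := S)) := by
  have h0 : trNat (wordCode ([] : List S)) = [] := by simp [wordCode]
  intro u v h
  induction u generalizing v with
  | nil =>
    cases v with
    | nil => rfl
    | cons b v =>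
      have := trNat_wordCode_cons b v
      rw [← h, h0] at this
      simp at this
  | cons a u ih =>
    have ha := trNat_wordCode_cons a u
    cases v with
    | nil =>
      rw [h, h0] at ha
      simp at ha
    | cons b v =>
      rw [h, trNat_wordCode_cons] at ha
      obtain ⟨h₁, h₂⟩ := List.append_inj ha (by simp [oneHot])
      have hab : b = a := by
        have hinj : Function.Injective bitSym := by
          rintro (_ | _) (_ | _) h <;> first | rfl | cases h
        have h₃ := List.map_injective_iff.2 hinj h₁
        have h₄ := (List.map_inj_left.1 h₃) a (by simp)
        simpa [eq_comm] using h₄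
      have huv : trNat (wordCode v) = trNat (wordCode u) := (List.cons.inj h₂).2
      rw [hab, ih]
      rw [trNat, trNat] at huv
      have hpos : Function.Injective trPosNum := by
        intro m
        induction m with
        | one => rintro (_ | n | n) h <;> simp [trPosNum] at h ⊢; cases n <;> simp [trPosNum] at h
        | bit0 m ih =>
          rintro (_ | n | n) h
          · simp [trPosNum] at h
          · simp [trPosNum] at h
          · simp only [trPosNum, List.cons.injEq, true_and] at h
            rw [ih h]
        | bit1 m ih =>
          rintro (_ | n | n) h
          · cases m <;> simp [trPosNum] at h
          · simp only [trPosNum, List.cons.injEq, true_and] at h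
            rw [ih h]
          · simp [trPosNum] at h
      have hnum : Function.Injective trNum := by
        rintro (_ | m) (_ | n) h
        · rfl
        · cases n <;> simp [trNum, trPosNum] at h
        · cases m <;> simp [trNum, trPosNum] at h
        · rw [hpos h]
      have := congrArg (fun n : Num => (n : ℕ)) (hnum huv)
      simpa only [Num.to_of_nat] using this.symm

/-- Semidecidable languages are recognized by Turing machines. -/
theorem exists_accepts_iff_of_primrec [Primcodable S] {R : List S → ℕ → Bool} (hR : Primrec₂ R) :
    ∃ M : TuringMachine S, ∀ w, M.Accepts w ↔ ∃ k, R w k = true := by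
  -- The search ranges over pairs of a word and a witness and keeps those whose word has the given
  -- code. No decoder for `wordCode` is needed; injectivity suffices.
  let g : ℕ → ℕ → Bool := fun n m =>
    ((Encodable.decode (α := List S × ℕ) m).map
      fun p => decide (wordCode p.1 = n) && R p.1 p.2).getD false
  have hg : Primrec₂ g := by
    refine Primrec.option_getD.comp (Primrec.option_map (Primrec.decode.comp Primrec.snd) ?_)
      (Primrec.const false)
    refine Primrec.and.comp (Primrec.beq.comp ?_ ?_ |>.of_eq fun _ => rfl) ?_
    · exact primrec_wordCode.comp (Primrec.fst.comp Primrec.snd)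
    · exact Primrec.fst.comp Primrec.fst
    · exact hR.comp (Primrec.fst.comp Primrec.snd) (Primrec.snd.comp Primrec.snd)
  have hf : Partrec fun n => Nat.rfind fun m => Part.some (g n m) :=
    Partrec.rfind hg.to_comp.partrec₂
  obtain ⟨c, hc⟩ := ToPartrec.Code.exists_code (Nat.Partrec'.part_iff₁.2 hf)
  obtain ⟨M, hM⟩ := TuringMachine.exists_accepts_iff_tm2 (wordMachine S c)
    (supports_wordMachine c) none
  refine ⟨M, fun w => ?_⟩
  rw [hM, wordMachine_eval_dom]
  have h1 := hc (wordCode w ::ᵥ List.Vector.nil)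
  have h2 : (c.eval [wordCode w]).Dom ↔ ∃ m, g (wordCode w) m = true := by
    change (c.eval (wordCode w ::ᵥ List.Vector.nil : List.Vector ℕ 1).1).Dom ↔ _
    rw [h1]
    refine (Nat.rfind_dom (p := fun m => Part.some (g (wordCode w) m))).trans ?_
    exact ⟨fun ⟨m, hm, _⟩ => ⟨m, (Part.mem_some_iff.1 hm).symm⟩,
      fun ⟨m, hm⟩ => ⟨m, Part.mem_some_iff.2 hm.symm, fun _ => trivial⟩⟩
  rw [h2]
  constructor
  · rintro ⟨m, hm⟩
    rcases h : Encodable.decode (α := List S × ℕ) m with _ | ⟨w', k⟩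
    · simp only [g, h, Option.map_none, Option.getD_none, Bool.false_eq_true] at hm
    · simp only [g, h, Option.map_some, Option.getD_some, Bool.and_eq_true,
        decide_eq_true_eq] at hm
      exact ⟨k, wordCode_injective hm.1 ▸ hm.2⟩
  · rintro ⟨k, hk⟩
    exact ⟨Encodable.encode (w, k), by simp [g, hk]⟩

end WordInput

end TransformerTC

namespace TransformerTC

open Turing StateTransition Computability

/-! ### Functions computed by time-bounded stack machines are primitive recursive -/

section Simulation

theorem primrec_update {α β : Type} [Primcodable α] [Primcodable β] {n : ℕ} {s : α → Fin n → β}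
    {h : α → β} (hs : Primrec s) (hh : Primrec h) (i : Fin n) :
    Primrec fun a => Function.update (s a) i (h a) := by
  refine Primrec.fin_curry.2 ?_
  have : Primrec₂ fun (a : α) (j : Fin n) => if j = i then h a else s a j :=
    Primrec.ite (Primrec.eq.comp Primrec.snd (Primrec.const i)) (hh.comp Primrec.fst)
      (Primrec.fin_app.comp (hs.comp Primrec.fst) Primrec.snd)
  exact this.of_eq fun a j => by rw [Function.update_apply]

theorem primrec_eval {α β : Type} [Primcodable α] [Primcodable β] {n : ℕ} {s : α → Fin n → β}
    (hs : Primrec s) (i : Fin n) : Primrec fun a => s a i :=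
  Primrec.fin_app.comp hs (Primrec.const i)

variable {K : Type} {Γ : K → Type} {Λ σ : Type}

/-- The symbols pushed by a statement. -/
def pushed : TM2.Stmt Γ Λ σ → Set (Σ k, Γ k)
  | .push k f q => Set.range (fun v => ⟨k, f v⟩) ∪ pushed q
  | .peek _ _ q => pushed q
  | .pop _ _ q => pushed q
  | .load _ q => pushed q
  | .branch _ q₁ q₂ => pushed q₁ ∪ pushed q₂
  | .goto _ => ∅
  | .halt => ∅

/-- Stack alphabets other than that of the input may be infinite, but there are finitely many
internal states, so each statement pushes only finitely many symbols. -/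
theorem finite_pushed [Finite σ] (q : TM2.Stmt Γ Λ σ) : (pushed q).Finite := by
  induction q with
  | push k f q ih => exact (Set.finite_range _).union ih
  | branch f q₁ q₂ ih₁ ih₂ => exact ih₁.union ih₂
  | goto l => exact Set.finite_empty
  | halt => exact Set.finite_empty
  | _ => rename_i ih; exact ih

theorem tail_map_eq {X : Type} {g : X → Σ k, Γ k} {k : K} {l : List X} {m : List (Γ k)}
    (h : l.map g = m.map (Sigma.mk k)) : l.tail.map g = m.tail.map (Sigma.mk k) := by
  rw [List.map_tail, List.map_tail, h]

variable [DecidableEq K]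

/-- The symbol, if it belongs to the stack `k`. -/
def symOf (k : K) (p : Σ k, Γ k) : Option (Γ k) :=
  if h : p.1 = k then some (h ▸ p.2) else none

@[simp]
theorem symOf_mk (k : K) (x : Γ k) : symOf k ⟨k, x⟩ = some x := by simp [symOf]

theorem head?_bind_symOf {X : Type} {g : X → Σ k, Γ k} {k : K} {l : List X} {m : List (Γ k)}
    (h : l.map g = m.map (Sigma.mk k)) : (l.head?.bind fun x => symOf k (g x)) = m.head? := by
  cases l <;> cases m <;> simp_all

variable {X : Type} [Finite X] [Primcodable X] [Finite σ] [Primcodable σ] [Primcodable Λ]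

/-- With all stack entries named by elements of one finite type, every operation is either a
function between finite types or an elementary list operation, hence primitive recursive. -/
theorem exists_primrec_stepAux {n : ℕ} (e : K ≃ Fin n) {g : X → Σ k, Γ k}
    (q : TM2.Stmt Γ Λ σ) (hq : pushed q ⊆ Set.range g) :
    ∃ F : σ × (Fin n → List X) → Option Λ × σ × (Fin n → List X), Primrec F ∧
      ∀ (v : σ) (T : ∀ k, List (Γ k)) (s : Fin n → List X),
        (∀ k, (s (e k)).map g = (T k).map (Sigma.mk k)) →
        (F (v, s)).1 = (TM2.stepAux q v T).l ∧ (F (v, s)).2.1 = (TM2.stepAux q v T).var ∧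
        ∀ k, ((F (v, s)).2.2 (e k)).map g = ((TM2.stepAux q v T).stk k).map (Sigma.mk k) := by
  have hrel : ∀ (T : ∀ k, List (Γ k)) (s : Fin n → List X),
      (∀ k, (s (e k)).map g = (T k).map (Sigma.mk k)) → ∀ k (l : List X) (m : List (Γ k)),
      l.map g = m.map (Sigma.mk k) → ∀ k', (Function.update s (e k) l (e k')).map g =
        (Function.update T k m k').map (Sigma.mk k') := by
    intro T s h k l m hlm k'
    by_cases hk : k' = k
    · subst hk; simpa using hlm
    · rw [Function.update_of_ne hk, Function.update_of_ne (by simpa using hk), h]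
  induction q with
  | push k f q ih =>
    obtain ⟨F, hF, h⟩ := ih (Set.subset_union_right.trans hq)
    have hx : ∀ v, ∃ x, g x = ⟨k, f v⟩ := fun v => hq (Or.inl ⟨v, rfl⟩)
    choose x hx using hx
    refine ⟨fun p => F (p.1, Function.update p.2 (e k) (x p.1 :: p.2 (e k))),
      hF.comp (Primrec.fst.pair (primrec_update Primrec.snd (Primrec.list_cons.comp
        ((Primrec.dom_finite x).comp Primrec.fst) (primrec_eval Primrec.snd _)) _)), ?_⟩
    intro v T s hs
    exact h v _ _ (hrel T s hs k _ _ (by simp [hx, hs]))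
  | peek k f q ih =>
    obtain ⟨F, hF, h⟩ := ih hq
    refine ⟨fun p => F (f p.1 ((p.2 (e k)).head?.bind fun x => symOf k (g x)), p.2),
      hF.comp (Primrec.pair ?_ Primrec.snd), ?_⟩
    · exact (Primrec.dom_finite fun z : σ × Option X =>
        f z.1 (z.2.bind fun x => symOf k (g x))).comp
          (Primrec.fst.pair (Primrec.list_head?.comp (primrec_eval Primrec.snd _)))
    · intro v T s hs
      dsimp only
      rw [head?_bind_symOf (hs k)]
      exact h _ T s hs
  | pop k f q ih =>
    obtain ⟨F, hF, h⟩ := ih hq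
    refine ⟨fun p => F (f p.1 ((p.2 (e k)).head?.bind fun x => symOf k (g x)),
      Function.update p.2 (e k) (p.2 (e k)).tail),
      hF.comp (Primrec.pair ?_ (primrec_update Primrec.snd (Primrec.list_tail.comp
        (primrec_eval Primrec.snd _)) _)), ?_⟩
    · exact (Primrec.dom_finite fun z : σ × Option X =>
        f z.1 (z.2.bind fun x => symOf k (g x))).comp
          (Primrec.fst.pair (Primrec.list_head?.comp (primrec_eval Primrec.snd _)))
    · intro v T s hs
      dsimp only
      rw [head?_bind_symOf (hs k)]
      exact h _ _ _ (hrel T s hs k _ _ (tail_map_eq (hs k)))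
  | load f q ih =>
    obtain ⟨F, hF, h⟩ := ih hq
    exact ⟨fun p => F (f p.1, p.2),
      hF.comp (((Primrec.dom_finite f).comp Primrec.fst).pair Primrec.snd),
      fun v T s hs => h _ T s hs⟩
  | branch f q₁ q₂ ih₁ ih₂ =>
    obtain ⟨F₁, hF₁, h₁⟩ := ih₁ (Set.subset_union_left.trans hq)
    obtain ⟨F₂, hF₂, h₂⟩ := ih₂ (Set.subset_union_right.trans hq)
    refine ⟨fun p => cond (f p.1) (F₁ p) (F₂ p),
      Primrec.cond ((Primrec.dom_finite f).comp Primrec.fst) hF₁ hF₂, fun v T s hs => ?_⟩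
    dsimp only
    rw [TM2.stepAux]
    cases f v
    · exact h₂ v T s hs
    · exact h₁ v T s hs
  | goto l =>
    exact ⟨fun p => (some (l p.1), p), ((Primrec.dom_finite fun v => some (l v)).comp
      Primrec.fst).pair Primrec.id, fun v T s hs => ⟨rfl, rfl, hs⟩⟩
  | halt =>
    exact ⟨fun p => (none, p), (Primrec.const none).pair Primrec.id,
      fun v T s hs => ⟨rfl, rfl, hs⟩⟩

/-- A representation of configurations with symbols from a finite type. -/
def CfgRel {n : ℕ} (e : K ≃ Fin n) (g : X → Σ k, Γ k) (z : Option Λ × σ × (Fin n → List X))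
    (c : TM2.Cfg Γ Λ σ) : Prop :=
  z.1 = c.l ∧ z.2.1 = c.var ∧ ∀ k, (z.2.2 (e k)).map g = (c.stk k).map (Sigma.mk k)

theorem exists_primrec_step [Finite Λ] {n : ℕ} (e : K ≃ Fin n) {g : X → Σ k, Γ k}
    (m : Λ → TM2.Stmt Γ Λ σ) (hm : ∀ l, pushed (m l) ⊆ Set.range g) :
    ∃ F : Option Λ × σ × (Fin n → List X) → Option Λ × σ × (Fin n → List X), Primrec F ∧
      ∀ z c, CfgRel e g z c → CfgRel e g (F z) ((TM2.step m c).getD c) := by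
  choose G hG h using fun l => exists_primrec_stepAux e (m l) (hm l)
  obtain ⟨N, ⟨eΛ⟩⟩ := Finite.exists_equiv_fin Λ
  have hG' : Primrec₂ fun l p => G l p := by
    have : Primrec₂ fun (i : Fin N) p => G (eΛ.symm i) p :=
      Primrec.fin_curry₁.2 fun i => hG _
    exact (this.comp ((Primrec.dom_finite eΛ).comp Primrec.fst) Primrec.snd).of_eq
      fun p => by simp
  have hF : Primrec fun z : Option Λ × σ × (Fin n → List X) =>
      (Option.casesOn z.1 z (fun l => G l z.2) : Option Λ × σ × (Fin n → List X)) :=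
    Primrec.option_casesOn (f := fun z : Option Λ × σ × (Fin n → List X) => z)
      (g := fun z l => G l z.2) Primrec.fst Primrec.id
      (hG'.comp Primrec.snd (Primrec.snd.comp Primrec.fst)).to₂
  refine ⟨_, hF, ?_⟩
  rintro ⟨l, v, s⟩ ⟨l', v', T⟩ ⟨h₁, h₂, h₃⟩
  simp only at h₁ h₂ h₃
  subst h₁ h₂
  cases l with
  | none => exact ⟨rfl, rfl, h₃⟩
  | some l => exact h l v T s h₃

end Simulation

/-- A halted configuration is a fixed point of the totalized step function, so the full time bound
may be used in place of the exact number of steps. -/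
theorem iterate_getD_of_iterate_bind {α : Type} {f : α → Option α} {a b : α} {t : ℕ}
    (h : (flip bind f)^[t] (some a) = some b) (hb : f b = none) {t' : ℕ} (ht : t ≤ t') :
    (fun c => (f c).getD c)^[t'] a = b := by
  have hnone : ∀ s, (flip bind f)^[s] (none : Option α) = none := fun s => by
    induction s with
    | zero => rfl
    | succ s ih => rw [Function.iterate_succ_apply]; exact ih
  induction t generalizing a t' with
  | zero =>
    have hab : a = b := by simpa using h
    rw [hab]
    exact Function.iterate_fixed (by simp [hb]) t'
  | succ t ih =>
    obtain ⟨t', rfl⟩ : ∃ s, t' = s + 1 := ⟨t' - 1, by omega⟩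
    rw [Function.iterate_succ_apply] at h ⊢
    have h' : (flip bind f)^[t] (f a) = some b := h
    cases hf : f a with
    | none => rw [hf, hnone] at h'; cases h'
    | some c => rw [hf] at h'; exact ih h' (by omega)

/-- The step function is iterated c·n + c times, a number that is primitive recursive in the length
of the input. The values of `G` on words that are not encodings are of no importance. -/
theorem exists_primrec_of_time {α β αΓ βΓ : Type} {ea : α → List αΓ} {eb : β → List βΓ}
    {f : α → β} [Primcodable αΓ] [Finite αΓ] [Primcodable βΓ] [Finite βΓ]
    (h : TM2ComputableInTime ea eb f) {c : ℕ} (hc : ∀ n, h.time n ≤ c * n + c) :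
    ∃ G : List αΓ → List βΓ, Primrec G ∧ ∀ a, G (ea a) = eb (f a) := by
  obtain ⟨⟨tm, inA, outA⟩, time, hout⟩ := h
  dsimp only at hc hout
  have := tm.kFin
  have := tm.ΛFin
  have := tm.σFin
  have : Finite (tm.Γ tm.k₀) := Finite.of_equiv _ inA.symm
  -- All symbols that can ever occur on a stack: those pushed by some statement and those of the
  -- input alphabet.
  let P : Set (Σ k, tm.Γ k) := (⋃ l, pushed (tm.m l)) ∪ Set.range (fun x => ⟨tm.k₀, x⟩)
  have hP : P.Finite := (Set.finite_iUnion fun l => finite_pushed _).union (Set.finite_range _)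
  have : Finite P := hP
  obtain ⟨N, ⟨eX⟩⟩ := Finite.exists_equiv_fin P
  let g : Fin N → Σ k, tm.Γ k := fun x => (eX.symm x).1
  have hg : Set.range g = P := by
    ext p
    constructor
    · rintro ⟨x, rfl⟩; exact (eX.symm x).2
    · exact fun hp => ⟨eX ⟨p, hp⟩, by simp [g]⟩
  obtain ⟨n, ⟨e⟩⟩ := Finite.exists_equiv_fin tm.K
  let _ : Primcodable tm.Λ := Primcodable.ofEquiv _ (Fintype.equivFin tm.Λ)
  let _ : Primcodable tm.σ := Primcodable.ofEquiv _ (Fintype.equivFin tm.σ)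
  obtain ⟨F, hF, hstep⟩ := exists_primrec_step e (g := g) tm.m fun l => by
    rw [hg]; exact (Set.subset_iUnion (fun l => pushed (tm.m l)) l).trans Set.subset_union_left
  have hx : ∀ x, ∃ i, g i = ⟨tm.k₀, inA.symm x⟩ := fun x => by
    have : (⟨tm.k₀, inA.symm x⟩ : Σ k, tm.Γ k) ∈ Set.range g := by
      rw [hg]; exact Or.inr ⟨_, rfl⟩
    exact this
  choose ix hix using hx
  let z₀ : List αΓ → Option tm.Λ × tm.σ × (Fin n → List (Fin N)) := fun l =>
    (some tm.main, tm.initialState, Function.update (fun _ => []) (e tm.k₀) (l.map ix))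
  have hz₀ : Primrec z₀ :=
    (Primrec.const _).pair ((Primrec.const _).pair (primrec_update (Primrec.const _)
      (Primrec.list_map Primrec.id ((Primrec.dom_finite ix).comp Primrec.snd).to₂) _))
  refine ⟨fun l => ((F^[c * l.length + c] (z₀ l)).2.2 (e tm.k₁)).filterMap
    fun x => (symOf tm.k₁ (g x)).map outA, ?_, fun a => ?_⟩
  · refine Primrec.listFilterMap (primrec_eval (Primrec.snd.comp (Primrec.snd.comp
      (Primrec.nat_iterate ?_ hz₀ (hF.comp Primrec.snd).to₂))) _)
      ((Primrec.dom_finite fun x => (symOf tm.k₁ (g x)).map outA).comp Primrec.snd).to₂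
    exact Primrec.nat_add.comp (Primrec.nat_mul.comp (Primrec.const c) Primrec.list_length)
      (Primrec.const c)
  · have hinit : CfgRel e g (z₀ (ea a)) (initList tm ((ea a).map inA.invFun)) := by
      refine ⟨rfl, rfl, fun k => ?_⟩
      by_cases hk : k = tm.k₀
      · subst hk
        simp [z₀, initList, hix]
      · simp [z₀, initList, hk]
    obtain ⟨⟨steps, hev⟩, hle⟩ := hout a
    have hiter : ∀ z (c : TM2.Cfg tm.Γ tm.Λ tm.σ), CfgRel e g z c → ∀ t,
        CfgRel e g (F^[t] z) ((fun c => (TM2.step tm.m c).getD c)^[t] c) := by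
      intro z c hzc t
      induction t with
      | zero => exact hzc
      | succ t ih =>
        rw [Function.iterate_succ_apply', Function.iterate_succ_apply']
        exact hstep _ _ ih
    have hend := iterate_getD_of_iterate_bind hev rfl (hle.trans (hc _))
    obtain ⟨-, -, h₃⟩ : CfgRel e g (F^[c * (ea a).length + c] (z₀ (ea a)))
      (haltList tm ((eb (f a)).map outA.invFun)) := hend ▸ hiter _ _ hinit _
    have h₄ := h₃ tm.k₁
    have h₅ : (haltList tm ((eb (f a)).map outA.invFun)).stk tm.k₁ =
        (eb (f a)).map outA.invFun := by simp [haltList]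
    have h₆ : ((F^[c * (ea a).length + c] (z₀ (ea a))).2.2 (e tm.k₁)).filterMap
        (fun x => (symOf tm.k₁ (g x)).map outA) =
        (((F^[c * (ea a).length + c] (z₀ (ea a))).2.2 (e tm.k₁)).map g).filterMap
          (fun p => (symOf tm.k₁ p).map outA) := by
      rw [List.filterMap_map]; rfl
    refine h₆.trans ?_
    rw [h₄, h₅]
    simp [List.filterMap_map, Function.comp_def]

end TransformerTC

namespace TransformerTC

/-! ### Primitive recursive functions with rational values -/

/-- The rational number with code `(a, b, c)`. -/
def ratOfCode (r : ℕ × ℕ × ℕ) : ℚ := ((r.1 : ℚ) - r.2.1) / (r.2.2 + 1)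

theorem ratOfCode_surjective : Function.Surjective ratOfCode := by
  intro q
  refine ⟨(q.num.toNat, (-q.num).toNat, q.den - 1), ?_⟩
  have h1 : ((q.num.toNat : ℚ) - ((-q.num).toNat : ℚ)) = q.num := by
    have : (q.num.toNat : ℤ) - ((-q.num).toNat : ℤ) = q.num := by omega
    exact_mod_cast this
  have h2 : ((q.den - 1 : ℕ) : ℚ) + 1 = q.den := by
    have := q.den_pos
    have : q.den - 1 + 1 = q.den := by omega
    exact_mod_cast this
  rw [ratOfCode]
  simp only [h1, h2]
  exact Rat.num_div_den q

/-- A function with rational values given by a primitive recursive function into codes. -/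
def RatPrimrec {α : Type} [Primcodable α] (f : α → ℚ) : Prop :=
  ∃ F : α → ℕ × ℕ × ℕ, Primrec F ∧ ∀ a, ratOfCode (F a) = f a

namespace RatPrimrec

variable {α β : Type} [Primcodable α] [Primcodable β] {f g : α → ℚ}

theorem of_eq (hf : RatPrimrec f) (h : ∀ a, f a = g a) : RatPrimrec g :=
  (funext h : f = g) ▸ hf

theorem comp (hf : RatPrimrec f) {u : β → α} (hu : Primrec u) :
    RatPrimrec fun b => f (u b) := by
  obtain ⟨F, hF, h⟩ := hf
  exact ⟨_, hF.comp hu, fun b => h _⟩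

theorem code : RatPrimrec ratOfCode := ⟨_, Primrec.id, fun _ => rfl⟩

theorem const (c : ℚ) : RatPrimrec fun _ : α => c := by
  obtain ⟨r, rfl⟩ := ratOfCode_surjective c
  exact code.comp (Primrec.const r)

theorem primrec_add {m n : α → ℕ} (hm : Primrec m) (hn : Primrec n) :
    Primrec fun a => m a + n a := Primrec.nat_add.comp hm hn

theorem primrec_mul {m n : α → ℕ} (hm : Primrec m) (hn : Primrec n) :
    Primrec fun a => m a * n a := Primrec.nat_mul.comp hm hn

theorem primrec_sub {m n : α → ℕ} (hm : Primrec m) (hn : Primrec n) :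
    Primrec fun a => m a - n a := Primrec.nat_sub.comp hm hn

/-- Addition of codes. -/
def addCode (r s : ℕ × ℕ × ℕ) : ℕ × ℕ × ℕ :=
  (r.1 * (s.2.2 + 1) + s.1 * (r.2.2 + 1), r.2.1 * (s.2.2 + 1) + s.2.1 * (r.2.2 + 1),
    r.2.2 * s.2.2 + r.2.2 + s.2.2)

theorem primrec_addCode {r s : α → ℕ × ℕ × ℕ} (hr : Primrec r) (hs : Primrec s) :
    Primrec fun a => addCode (r a) (s a) := by
  have h₁ := Primrec.fst.comp hr
  have h₂ := Primrec.fst.comp (Primrec.snd.comp hr)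
  have h₃ := Primrec.snd.comp (Primrec.snd.comp hr)
  have k₁ := Primrec.fst.comp hs
  have k₂ := Primrec.fst.comp (Primrec.snd.comp hs)
  have k₃ := Primrec.snd.comp (Primrec.snd.comp hs)
  have h₄ := primrec_add h₃ (Primrec.const 1)
  have k₄ := primrec_add k₃ (Primrec.const 1)
  exact (primrec_add (primrec_mul h₁ k₄) (primrec_mul k₁ h₄)).pair
    ((primrec_add (primrec_mul h₂ k₄) (primrec_mul k₂ h₄)).pair
      (primrec_add (primrec_add (primrec_mul h₃ k₃) h₃) k₃))

theorem ratOfCode_addCode (r s : ℕ × ℕ × ℕ) :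
    ratOfCode (addCode r s) = ratOfCode r + ratOfCode s := by
  have h₁ : (r.2.2 + 1 : ℚ) ≠ 0 := by positivity
  have h₂ : (s.2.2 + 1 : ℚ) ≠ 0 := by positivity
  have : ((r.2.2 * s.2.2 + r.2.2 + s.2.2 : ℚ) + 1) = (r.2.2 + 1) * (s.2.2 + 1) := by ring
  simp only [ratOfCode, addCode]
  push_cast
  rw [this]
  field_simp
  ring

theorem add (hf : RatPrimrec f) (hg : RatPrimrec g) : RatPrimrec fun a => f a + g a := by
  obtain ⟨F, hF, h⟩ := hf
  obtain ⟨G, hG, k⟩ := hg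
  exact ⟨_, primrec_addCode hF hG, fun a => by rw [ratOfCode_addCode, h, k]⟩

theorem mul (hf : RatPrimrec f) (hg : RatPrimrec g) : RatPrimrec fun a => f a * g a := by
  obtain ⟨F, hF, h⟩ := hf
  obtain ⟨G, hG, k⟩ := hg
  have h₁ := Primrec.fst.comp hF
  have h₂ := Primrec.fst.comp (Primrec.snd.comp hF)
  have h₃ := Primrec.snd.comp (Primrec.snd.comp hF)
  have k₁ := Primrec.fst.comp hG
  have k₂ := Primrec.fst.comp (Primrec.snd.comp hG)
  have k₃ := Primrec.snd.comp (Primrec.snd.comp hG)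
  refine ⟨_, (primrec_add (primrec_mul h₁ k₁) (primrec_mul h₂ k₂)).pair
    ((primrec_add (primrec_mul h₁ k₂) (primrec_mul h₂ k₁)).pair
      (primrec_add (primrec_add (primrec_mul h₃ k₃) h₃) k₃)), fun a => ?_⟩
  change _ = f a * g a
  rw [← h, ← k]
  simp only [ratOfCode]
  have h₁ : ((F a).2.2 + 1 : ℚ) ≠ 0 := by positivity
  have h₂ : ((G a).2.2 + 1 : ℚ) ≠ 0 := by positivity
  have : (((F a).2.2 * (G a).2.2 + (F a).2.2 + (G a).2.2 : ℚ) + 1) =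
    ((F a).2.2 + 1) * ((G a).2.2 + 1) := by ring
  push_cast
  rw [this]
  field_simp
  ring

/-- The sum of the two truncated differences is the absolute value of the numerator, which becomes
the denominator; the old denominator goes to the component matching the sign. A zero numerator
yields a code of 0, in accordance with `0⁻¹ = 0`. -/
theorem inv (hf : RatPrimrec f) : RatPrimrec fun a => (f a)⁻¹ := by
  obtain ⟨F, hF, h⟩ := hf
  have h₁ := Primrec.fst.comp hF
  have h₂ := Primrec.fst.comp (Primrec.snd.comp hF)
  have h₃ := primrec_add (Primrec.snd.comp (Primrec.snd.comp hF)) (Primrec.const 1)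
  refine ⟨_, (Primrec.ite (Primrec.nat_lt.comp h₂ h₁) h₃ (Primrec.const 0)).pair
    ((Primrec.ite (Primrec.nat_lt.comp h₁ h₂) h₃ (Primrec.const 0)).pair
      (primrec_sub (primrec_add (primrec_sub h₁ h₂) (primrec_sub h₂ h₁)) (Primrec.const 1))),
    fun a => ?_⟩
  change _ = (f a)⁻¹
  rw [← h]
  obtain ⟨x, y, z⟩ := F a
  simp only [ratOfCode]
  rcases lt_trichotomy x y with hxy | rfl | hxy
  · obtain ⟨k, rfl⟩ := Nat.exists_eq_add_of_lt hxy
    have e₁ : x - (x + k + 1) + (x + k + 1 - x) - 1 = k := by omega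
    rw [if_neg (by omega), if_pos hxy, e₁, ← inv_inv ((((0 : ℕ) : ℚ) - _) / _)]
    congr 1
    have : (z + 1 : ℚ) ≠ 0 := by positivity
    push_cast
    field_simp
    ring
  · simp
  · obtain ⟨k, rfl⟩ := Nat.exists_eq_add_of_lt hxy
    have e₁ : y + k + 1 - y + (y - (y + k + 1)) - 1 = k := by omega
    rw [if_neg (show ¬ y + k + 1 < y by omega), if_pos hxy, e₁, ← inv_inv ((_ - _) / _ : ℚ)]
    congr 1
    have : (z + 1 : ℚ) ≠ 0 := by positivity
    push_cast
    field_simp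
    ring

theorem div (hf : RatPrimrec f) (hg : RatPrimrec g) : RatPrimrec fun a => f a / g a :=
  (hf.mul hg.inv).of_eq fun _ => (div_eq_mul_inv _ _).symm

theorem le (hf : RatPrimrec f) (hg : RatPrimrec g) : PrimrecPred fun a => f a ≤ g a := by
  obtain ⟨F, hF, h⟩ := hf
  obtain ⟨G, hG, k⟩ := hg
  have h₁ := Primrec.fst.comp hF
  have h₂ := Primrec.fst.comp (Primrec.snd.comp hF)
  have h₃ := primrec_add (Primrec.snd.comp (Primrec.snd.comp hF)) (Primrec.const 1)
  have k₁ := Primrec.fst.comp hG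
  have k₂ := Primrec.fst.comp (Primrec.snd.comp hG)
  have k₃ := primrec_add (Primrec.snd.comp (Primrec.snd.comp hG)) (Primrec.const 1)
  refine (Primrec.nat_le.comp (primrec_add (primrec_mul h₁ k₃) (primrec_mul k₂ h₃))
    (primrec_add (primrec_mul k₁ h₃) (primrec_mul h₂ k₃))).of_eq fun a => ?_
  rw [← h, ← k, ratOfCode, ratOfCode, div_le_div_iff₀ (by positivity) (by positivity),
    ← Nat.cast_le (α := ℚ)]
  push_cast
  constructor <;> intro h <;> linarith

theorem lt (hf : RatPrimrec f) (hg : RatPrimrec g) : PrimrecPred fun a => f a < g a :=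
  (hg.le hf).not.of_eq fun _ => not_le

theorem eq (hf : RatPrimrec f) (hg : RatPrimrec g) : PrimrecPred fun a => f a = g a :=
  ((hf.le hg).and (hg.le hf)).of_eq fun _ => le_antisymm_iff.symm

theorem ite {p : α → Prop} [DecidablePred p] (hp : PrimrecPred p) (hf : RatPrimrec f)
    (hg : RatPrimrec g) : RatPrimrec fun a => if p a then f a else g a := by
  obtain ⟨F, hF, h⟩ := hf
  obtain ⟨G, hG, k⟩ := hg
  exact ⟨_, Primrec.ite hp hF hG, fun a => by
    dsimp only
    rw [← h, ← k]
    split_ifs <;> rfl⟩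

theorem sigma (hf : RatPrimrec f) : RatPrimrec fun a => sigma (f a) :=
  ite (hf.lt (const 0)) (const 0) (ite (hf.le (const 1)) hf (const 1))

theorem relu (hf : RatPrimrec f) : RatPrimrec fun a => relu (f a) :=
  (ite (hf.le (const 0)) (const 0) hf).of_eq fun a => by
    rw [TransformerTC.relu]
    split_ifs with h
    · exact (max_eq_right h).symm
    · exact (max_eq_left (not_le.1 h).le).symm

theorem sum_range {n : α → ℕ} {f : α → ℕ → ℚ} (hn : Primrec n)
    (hf : RatPrimrec fun p : α × ℕ => f p.1 p.2) :
    RatPrimrec fun a => ∑ i ∈ Finset.range (n a), f a i := by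
  obtain ⟨F, hF, h⟩ := hf
  have hstep : Primrec₂ fun (a : α) (q : ℕ × (ℕ × ℕ × ℕ)) => addCode q.2 (F (a, q.1)) :=
    primrec_addCode (Primrec.snd.comp Primrec.snd)
      (hF.comp (Primrec.fst.pair (Primrec.fst.comp Primrec.snd)))
  refine ⟨_, Primrec.nat_rec' hn (Primrec.const (0, 0, 0)) hstep, fun a => ?_⟩
  dsimp only
  induction n a with
  | zero => simp [ratOfCode]
  | succ m ih => rw [Finset.sum_range_succ, ← ih, show f a m = ratOfCode (F (a, m)) from (h (a, m)).symm,
    ← ratOfCode_addCode]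

theorem of_piecewiseRational {ι : Type} {f : (ι → ℚ) → ℚ} (hf : PiecewiseRational f)
    {x : α → ι → ℚ} (hx : ∀ i, RatPrimrec fun a => x a i) : RatPrimrec fun a => f (x a) := by
  induction hf with
  | const c => exact const c
  | coord i => exact hx i
  | add _ _ ih₁ ih₂ => exact ih₁.add ih₂
  | mul _ _ ih₁ ih₂ => exact ih₁.mul ih₂
  | div _ _ _ ih₁ ih₂ => exact ih₁.div ih₂
  | sigma _ ih => exact ih.sigma
  | relu _ ih => exact ih.relu

end RatPrimrec

theorem PrimrecPred.forall_lt_nat {α : Type} [Primcodable α] {n : α → ℕ} {p : α → ℕ → Prop}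
    (hn : Primrec n) (hp : PrimrecPred fun q : α × ℕ => p q.1 q.2) :
    PrimrecPred fun a => ∀ i < n a, p a i := by
  have h : PrimrecRel fun (i : ℕ) (a : α) => p a i := hp.comp (Primrec.snd.pair Primrec.fst)
  exact (h.forall_mem_list.comp (Primrec.list_range.comp hn) Primrec.id).of_eq fun a => by simp

end TransformerTC

namespace TransformerTC

open Computability

/-! ### Primitive recursiveness and injectivity of the encoding of vectors -/

theorem encodeNat_bit (b : Bool) {n : ℕ} (h : Nat.bit b n ≠ 0) :
    encodeNat (Nat.bit b n) = b :: encodeNat n := by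
  rw [encodeNat, encodeNat, ← Num.ofNat'_eq, ← Num.ofNat'_eq, Num.ofNat'_bit]
  rcases hn : Num.ofNat' n with _ | p
  · rw [Num.ofNat'_eq] at hn
    have : ((n : Num) : ℕ) = 0 := by rw [hn]; rfl
    rw [Num.to_of_nat] at this
    subst this
    cases b
    · exact absurd rfl h
    · rfl
  · cases b <;> rfl

theorem primrec_encodeNat : Primrec encodeNat := by
  have h : Primrec₂ fun (_ : Unit) (n : ℕ) => encodeNat n := by
    -- Here `l` lists the values at all smaller arguments: its length is the argument, and its entry
    -- at half the argument provides the remaining digits.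
    refine Primrec.nat_strong_rec _ (g := fun _ l => some (if l.length = 0 then [] else
      l.length.bodd :: (l[l.length.div2]?).getD [])) ?_ ?_
    · have hl : Primrec fun p : Unit × List (List Bool) => p.2.length :=
        Primrec.list_length.comp Primrec.snd
      exact Primrec.option_some.comp (Primrec.ite (Primrec.eq.comp hl (Primrec.const 0))
        (Primrec.const []) (Primrec.list_cons.comp (Primrec.nat_bodd.comp hl)
          (Primrec.option_getD.comp (Primrec.list_getElem?.comp Primrec.snd
            (Primrec.nat_div2.comp hl)) (Primrec.const []))))
    · intro _ n
      rw [List.length_map, List.length_range]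
      congr 1
      split_ifs with hn
      · subst hn; rfl
      · have hlt : n.div2 < n := by rw [Nat.div2_val]; omega
        rw [List.getElem?_map, List.getElem?_range hlt]
        conv_rhs => rw [← Nat.bit_bodd_div2 n]
        rw [encodeNat_bit _ (by rwa [Nat.bit_bodd_div2])]
        rfl
  exact h.comp (Primrec.const ()) Primrec.id

/-- Bounded search for the greatest common divisor; the bound a + b is large enough even if one
argument is 0. -/
theorem primrec_gcd : Primrec₂ Nat.gcd := by
  have hdvd : ∀ {α : Type} [Primcodable α] {m n : α → ℕ}, Primrec m → Primrec n →
      PrimrecPred fun a => m a ∣ n a := fun hm hn =>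
    (Primrec.eq.comp (Primrec.nat_mod.comp hn hm) (Primrec.const 0)).of_eq fun _ =>
      (Nat.dvd_iff_mod_eq_zero ..).symm
  have hp : PrimrecRel fun (p : ℕ × ℕ) (d : ℕ) => d ∣ p.1 ∧ d ∣ p.2 :=
    (hdvd Primrec.snd (Primrec.fst.comp Primrec.fst)).and
      (hdvd Primrec.snd (Primrec.snd.comp Primrec.fst))
  refine (Primrec.nat_findGreatest (f := fun p : ℕ × ℕ => p.1 + p.2)
    (Primrec.nat_add.comp Primrec.fst Primrec.snd) hp).of_eq ?_
  rintro ⟨a, b⟩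
  rcases Nat.eq_zero_or_pos (a + b) with h | h
  · obtain ⟨rfl, rfl⟩ : a = 0 ∧ b = 0 := by omega
    rfl
  · refine Nat.findGreatest_eq_iff.2 ⟨?_, fun _ => ⟨Nat.gcd_dvd_left a b, Nat.gcd_dvd_right a b⟩,
      fun n hn hle hd => ?_⟩
    · rcases Nat.eq_zero_or_pos a with rfl | ha
      · simp
      · exact (Nat.gcd_le_left b ha).trans (Nat.le_add_right a b)
    · have := Nat.le_of_dvd (Nat.gcd_pos_iff.2 (by omega)) (Nat.dvd_gcd hd.1 hd.2)
      exact absurd this (not_le.2 hn)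

/-- Codes need not be reduced, whereas `encodeRat` writes reduced fractions; the common divisor has
to be removed explicitly. -/
theorem natAbs_num_ratOfCode (r : ℕ × ℕ × ℕ) :
    (ratOfCode r).num.natAbs = (r.1 - r.2.1 + (r.2.1 - r.1)) /
      Nat.gcd (r.1 - r.2.1 + (r.2.1 - r.1)) (r.2.2 + 1) ∧
    (ratOfCode r).den = (r.2.2 + 1) /
      Nat.gcd (r.1 - r.2.1 + (r.2.1 - r.1)) (r.2.2 + 1) := by
  obtain ⟨x, y, z⟩ := r
  have h : ratOfCode (x, y, z) = Rat.divInt ((x : ℤ) - y) ((z + 1 : ℕ) : ℤ) := by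
    rw [ratOfCode, Rat.divInt_eq_div]
    push_cast
    rfl
  have habs : x - y + (y - x) = ((x : ℤ) - y).natAbs := by omega
  rw [h, habs]
  constructor
  · rw [Rat.num_divInt, Int.sign_eq_one_of_pos (by omega), one_mul,
      Int.natAbs_ediv_of_dvd (Int.gcd_dvd_right _ _), Int.natAbs_natCast, Int.gcd_comm]
    rfl
  · rw [Rat.den_divInt, if_neg (by omega), Int.natAbs_natCast, Int.gcd_comm]
    rfl

theorem primrec_encodeRat {α : Type} [Primcodable α] {f : α → ℚ} (hf : RatPrimrec f) :
    Primrec fun a => encodeRat (f a) := by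
  have hneg := hf.lt (RatPrimrec.const 0)
  obtain ⟨F, hF, h⟩ := hf
  have h₁ := Primrec.fst.comp hF
  have h₂ := Primrec.fst.comp (Primrec.snd.comp hF)
  have h₃ := RatPrimrec.primrec_add (Primrec.snd.comp (Primrec.snd.comp hF)) (Primrec.const 1)
  have habs := RatPrimrec.primrec_add (RatPrimrec.primrec_sub h₁ h₂)
    (RatPrimrec.primrec_sub h₂ h₁)
  have hgcd := primrec_gcd.comp habs h₃
  have hnum : Primrec fun a => (f a).num.natAbs :=
    (Primrec.nat_div.comp habs hgcd).of_eq fun a => by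
      rw [← h, (natAbs_num_ratOfCode (F a)).1]
  have hden : Primrec fun a => (f a).den :=
    (Primrec.nat_div.comp h₃ hgcd).of_eq fun a => by
      rw [← h, (natAbs_num_ratOfCode (F a)).2]
  have hbits : ∀ {n : α → ℕ}, Primrec n →
      Primrec fun a => (encodeNat (n a)).map (Sum.inl : Bool → VecSym) := fun hn =>
    Primrec.list_map (primrec_encodeNat.comp hn) (Primrec.sumInl.comp Primrec.snd).to₂
  exact Primrec.list_append.comp (Primrec.list_append.comp (Primrec.list_append.comp
    (Primrec.list_append.comp (Primrec.ite hneg (Primrec.const _) (Primrec.const _))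
      (hbits hnum)) (Primrec.const _)) (hbits hden)) (Primrec.const _)

theorem primrec_encodeVec {α : Type} [Primcodable α] {d : ℕ} {f : α → Vec d}
    (hf : ∀ i, RatPrimrec fun a => f a i) : Primrec fun a => encodeVec (f a) := by
  have h : Primrec₂ fun (i : Fin d) (a : α) => encodeRat (f a i) :=
    Primrec.fin_curry₁.2 fun i => primrec_encodeRat (hf i)
  exact Primrec.list_flatMap (Primrec.const _) h.swap

theorem map_inl_append_inj {α β : Type} {l l' : List α} {k k' : β} {r r' : List (α ⊕ β)}
    (h : l.map Sum.inl ++ Sum.inr k :: r = l'.map Sum.inl ++ Sum.inr k' :: r') :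
    l = l' ∧ k = k' ∧ r = r' := by
  induction l generalizing l' with
  | nil =>
    cases l' with
    | nil => simpa using h
    | cons b l' => simp at h
  | cons a l ih =>
    cases l' with
    | nil => simp at h
    | cons b l' =>
      simp only [List.map_cons, List.cons_append, List.cons.injEq, Sum.inl.injEq] at h
      obtain ⟨h₁, h₂, h₃⟩ := ih h.2
      exact ⟨by rw [h.1, h₁], h₂, h₃⟩

theorem encodeNat_injective : Function.Injective encodeNat :=
  Function.LeftInverse.injective decode_encodeNat

/-- The encoding is self-delimiting: the slash and the end mark are not bits, and the sign mark
never begins a nonnegative number. -/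
theorem encodeRat_append_inj {p q : ℚ} {r s : List VecSym}
    (h : encodeRat p ++ r = encodeRat q ++ s) : p = q ∧ r = s := by
  have key : ∀ {m n m' n' : ℕ} {r s : List VecSym},
      (encodeNat m).map Sum.inl ++ Sum.inr 1 :: ((encodeNat n).map Sum.inl ++ Sum.inr 2 :: r) =
      (encodeNat m').map Sum.inl ++ Sum.inr 1 :: ((encodeNat n').map Sum.inl ++ Sum.inr 2 :: s) →
      m = m' ∧ n = n' ∧ r = s := fun h => by
    obtain ⟨h₁, -, h₂⟩ := map_inl_append_inj h
    obtain ⟨h₃, -, h₄⟩ := map_inl_append_inj h₂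
    exact ⟨encodeNat_injective h₁, encodeNat_injective h₃, h₄⟩
  have hsign : ∀ {m : ℕ} {r s : List VecSym},
      Sum.inr 0 :: r ≠ (encodeNat m).map Sum.inl ++ Sum.inr 1 :: s := fun {m r s} h => by
    cases hm : encodeNat m <;> simp [hm] at h
  simp only [encodeRat, List.append_assoc, List.cons_append, List.nil_append] at h
  have hq : ∀ {p q : ℚ}, p.num = q.num → p.den = q.den → p = q := fun h₁ h₂ => Rat.ext h₁ h₂
  by_cases hp : p < 0 <;> by_cases hq' : q < 0
  · simp only [hp, hq', if_true, List.cons_append, List.nil_append, List.cons.injEq,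
      true_and] at h
    obtain ⟨h₁, h₂, h₃⟩ := key h
    have := Rat.num_neg.2 hp
    have := Rat.num_neg.2 hq'
    exact ⟨hq (by omega) h₂, h₃⟩
  · simp only [hp, hq', if_true, if_false, List.cons_append, List.nil_append] at h
    exact absurd h hsign
  · simp only [hp, hq', if_true, if_false, List.cons_append, List.nil_append] at h
    exact absurd h.symm hsign
  · simp only [hp, hq', if_false, List.nil_append] at h
    obtain ⟨h₁, h₂, h₃⟩ := key h
    have := Rat.num_nonneg.2 (not_lt.1 hp)
    have := Rat.num_nonneg.2 (not_lt.1 hq')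
    exact ⟨hq (by omega) h₂, h₃⟩

theorem encodeVec_injective (d : ℕ) : Function.Injective (encodeVec (d := d)) := by
  have key : ∀ (l : List (Fin d)) (x y : Vec d),
      (l.flatMap fun i => encodeRat (x i)) = (l.flatMap fun i => encodeRat (y i)) →
      ∀ i ∈ l, x i = y i := by
    intro l x y h
    induction l with
    | nil => simp
    | cons j l ih =>
      rw [List.flatMap_cons, List.flatMap_cons] at h
      obtain ⟨h₁, h₂⟩ := encodeRat_append_inj h
      intro i hi
      rcases List.mem_cons.1 hi with rfl | hi
      · exact h₁
      · exact ih h₂ i hi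
  exact fun x y h => funext fun i => key _ x y h i (List.mem_finRange i)

end TransformerTC

namespace TransformerTC

/-! ### Transformers on coded sequences -/

/-- A function with rational vectors as values all of whose coordinates are primitive recursive. -/
def VecPrimrec {α : Type} [Primcodable α] {d : ℕ} (f : α → Vec d) : Prop :=
  ∀ i, RatPrimrec fun a => f a i

/-- A family of sequences of vectors that extends to a primitive recursive function. -/
def SeqPrimrec {α : Type} [Primcodable α] {d : ℕ} (n : α → ℕ) (X : ∀ a, Fin (n a) → Vec d) :
    Prop :=
  -- The index type varies with `a`, so primitive recursiveness is expressed through an extension to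
  -- all of ℕ, whose values beyond the length are irrelevant.
  ∃ X' : α → ℕ → Vec d, VecPrimrec (fun p : α × ℕ => X' p.1 p.2) ∧ ∀ a i, X a i = X' a i

section

variable {α β : Type} [Primcodable α] [Primcodable β] {d : ℕ}

theorem VecPrimrec.comp {f : α → Vec d} (hf : VecPrimrec f) {u : β → α} (hu : Primrec u) :
    VecPrimrec fun b => f (u b) := fun i => (hf i).comp hu

theorem VecPrimrec.add {f g : α → Vec d} (hf : VecPrimrec f) (hg : VecPrimrec g) :
    VecPrimrec fun a => f a + g a := fun i => (hf i).add (hg i)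

theorem VecPrimrec.map {f : α → Vec d} (hf : VecPrimrec f) {e : ℕ} {F : Vec d → Vec e}
    (hF : PiecewiseRationalMap F) : VecPrimrec fun a => F (f a) :=
  fun i => RatPrimrec.of_piecewiseRational (hF i) hf

theorem SeqPrimrec.comp {n : α → ℕ} {X : ∀ a, Fin (n a) → Vec d} (hX : SeqPrimrec n X)
    {u : β → α} (hu : Primrec u) : SeqPrimrec (fun b => n (u b)) fun b => X (u b) := by
  obtain ⟨X', hX', h⟩ := hX
  exact ⟨fun b => X' (u b), hX'.comp ((hu.comp Primrec.fst).pair Primrec.snd), fun b => h (u b)⟩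

theorem SeqPrimrec.of_vecPrimrec {n : α → ℕ} {X : ∀ a, Fin (n a) → Vec d} {G : α × ℕ → Vec d}
    (hG : VecPrimrec G) (h : ∀ a (i : Fin (n a)), X a i = G (a, i)) : SeqPrimrec n X :=
  ⟨fun a i => G (a, i), hG, h⟩

theorem SeqPrimrec.map {n : α → ℕ} {X : ∀ a, Fin (n a) → Vec d} (hX : SeqPrimrec n X)
    {F : Vec d → Vec d} (hF : PiecewiseRationalMap F) : SeqPrimrec n fun a i => F (X a i) := by
  obtain ⟨X', hX', h⟩ := hX
  exact ⟨fun a i => F (X' a i), hX'.map hF, fun a i => congrArg F (h a i)⟩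

theorem exists_ratPrimrec_normalization {ρ : Normalization} (hρ : IsNormalization ρ) {n : α → ℕ}
    (hn : Primrec n) {x : α → ℕ → ℚ} (hx : RatPrimrec fun p : α × ℕ => x p.1 p.2) :
    ∃ W : α × ℕ → ℚ, RatPrimrec W ∧
      ∀ a (i : Fin (n a)), ρ (n a) (fun j => x a j) i = W (a, i) := by
  classical
  rcases hρ with rfl | ⟨f, hf, -, hρ⟩
  · have hmax : PrimrecPred fun p : α × ℕ => ∀ j < n p.1, x p.1 j ≤ x p.1 p.2 :=
      PrimrecPred.forall_lt_nat (hn.comp Primrec.fst)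
        ((hx.comp ((Primrec.fst.comp Primrec.fst).pair Primrec.snd)).le
          (hx.comp Primrec.fst))
    have hcard : RatPrimrec fun a => ∑ k ∈ Finset.range (n a),
        if ∀ j < n a, x a j ≤ x a k then (1 : ℚ) else 0 :=
      RatPrimrec.sum_range hn (RatPrimrec.ite hmax (.const 1) (.const 0))
    refine ⟨_, RatPrimrec.ite hmax ((RatPrimrec.const 1).div (hcard.comp Primrec.fst))
      (.const 0), fun a i => ?_⟩
    have hall : ∀ k : ℕ, (∀ j : Fin (n a), x a j ≤ x a k) ↔ ∀ j < n a, x a j ≤ x a k :=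
      fun k => ⟨fun h j hj => h ⟨j, hj⟩, fun h j => h j j.isLt⟩
    rw [Finset.sum_range]
    simp only [hardmax, hall, Finset.sum_boole]
  · have hfx : RatPrimrec fun p : α × ℕ => f (x p.1 p.2) :=
      RatPrimrec.of_piecewiseRational hf (x := fun (p : α × ℕ) _ => x p.1 p.2) fun _ => hx
    refine ⟨_, hfx.div ((RatPrimrec.sum_range (f := fun a i => f (x a i)) hn hfx).comp Primrec.fst), fun a i => ?_⟩
    rw [hρ, Finset.sum_range]

variable {score : Score d} {ρ : Normalization}

theorem vecPrimrec_att
    (hscore : PiecewiseRational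
      (fun x : Fin d ⊕ Fin d → ℚ => score (fun i => x (Sum.inl i)) (fun i => x (Sum.inr i))))
    (hρ : IsNormalization ρ) {n : α → ℕ} (hn : Primrec n) {q : α → Vec d} (hq : VecPrimrec q)
    {K V : ∀ a, Fin (n a) → Vec d} (hK : SeqPrimrec n K) (hV : SeqPrimrec n V) :
    VecPrimrec fun a => att score ρ (q a) (K a) (V a) := by
  obtain ⟨K', hK', hKK⟩ := hK
  obtain ⟨V', hV', hVV⟩ := hV
  have hs : RatPrimrec fun p : α × ℕ => score (q p.1) (K' p.1 p.2) :=
    RatPrimrec.of_piecewiseRational hscore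
      (x := fun p : α × ℕ => Sum.elim (q p.1) (K' p.1 p.2)) (by
        rintro (i | i)
        · exact (hq i).comp Primrec.fst
        · exact hK' i)
  obtain ⟨W, hW, h⟩ := exists_ratPrimrec_normalization hρ hn
    (x := fun a j => score (q a) (K' a j)) hs
  intro c
  refine (RatPrimrec.sum_range (f := fun a i => W (a, i) * V' a i c) hn (hW.mul (hV' c))).of_eq
    fun a => ?_
  simp only [Finset.sum_range, att, Finset.sum_apply, hKK, hVV, Pi.smul_apply, smul_eq_mul, h]

theorem SeqPrimrec.encLayer
    (hscore : PiecewiseRational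
      (fun x : Fin d ⊕ Fin d → ℚ => score (fun i => x (Sum.inl i)) (fun i => x (Sum.inr i))))
    (hρ : IsNormalization ρ) {θ : LayerParams d} (hθ : θ.All PiecewiseRationalMap) {n : α → ℕ}
    (hn : Primrec n) {X : ∀ a, Fin (n a) → Vec d} (hX : SeqPrimrec n X) :
    SeqPrimrec n fun a => encLayer score ρ θ (X a) := by
  obtain ⟨hQ, hK, hV, hO⟩ := hθ
  obtain ⟨X', hX', h⟩ := id hX
  have ha := (vecPrimrec_att hscore hρ (hn.comp Primrec.fst) (hX'.map hQ)
    ((hX.map hK).comp (Primrec.fst (α := α) (β := ℕ)))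
    ((hX.map hV).comp (Primrec.fst (α := α) (β := ℕ)))).add hX'
  refine SeqPrimrec.of_vecPrimrec ((ha.map hO).add ha) fun a i => ?_
  simp only [TransformerTC.encLayer, h]

theorem SeqPrimrec.decLayer
    (hscore : PiecewiseRational
      (fun x : Fin d ⊕ Fin d → ℚ => score (fun i => x (Sum.inl i)) (fun i => x (Sum.inr i))))
    (hρ : IsNormalization ρ) {θ : LayerParams d} (hθ : θ.All PiecewiseRationalMap) {n m : α → ℕ}
    (hn : Primrec n) {K V : ∀ a, Fin (n a) → Vec d}
    (hKe : SeqPrimrec n K) (hVe : SeqPrimrec n V) {Y : ∀ a, Fin (m a) → Vec d}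
    (hY : SeqPrimrec m Y) :
    SeqPrimrec m fun a => decLayer score ρ θ (K a) (V a) (Y a) := by
  obtain ⟨hQ, hK, hV, hO⟩ := hθ
  obtain ⟨Y', hY', h⟩ := id hY
  have hYi : SeqPrimrec (fun p : α × ℕ => p.2 + 1) fun p j => Y' p.1 j :=
    ⟨_, hY'.comp ((Primrec.fst.comp Primrec.fst).pair Primrec.snd), fun _ _ => rfl⟩
  have hp := (vecPrimrec_att hscore hρ (Primrec.succ.comp Primrec.snd) (hY'.map hQ)
    (hYi.map hK) (hYi.map hV)).add hY'
  have ha := (vecPrimrec_att hscore hρ (hn.comp Primrec.fst) hp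
    (hKe.comp (Primrec.fst (α := α) (β := ℕ)))
    (hVe.comp (Primrec.fst (α := α) (β := ℕ)))).add hp
  refine SeqPrimrec.of_vecPrimrec ((ha.map hO).add ha) fun a i => ?_
  simp only [TransformerTC.decLayer, h, Fin.val_castLE]

namespace Transformer

variable {T : Transformer d} (hT : T.Admissible)

include hT

theorem Admissible.seqPrimrec_encode {n : α → ℕ} (hn : Primrec n) {X : ∀ a, Fin (n a) → Vec d}
    (hX : SeqPrimrec n X) : SeqPrimrec n fun a => T.encode (X a) := by
  have h : ∀ (l : List (LayerParams d)), (∀ θ ∈ l, θ.All PiecewiseRationalMap) →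
      ∀ X : ∀ a, Fin (n a) → Vec d, SeqPrimrec n X → SeqPrimrec n fun a =>
        l.foldl (fun Z θ => encLayer T.score T.normalize θ Z) (X a) := by
    intro l
    induction l with
    | nil => exact fun _ X hX => hX
    | cons θ l ih =>
      intro hl X hX
      exact ih (fun θ hθ => hl θ (List.mem_cons_of_mem _ hθ)) _
        (hX.encLayer hT.score hT.normalize (hl θ List.mem_cons_self) hn)
  exact h _ hT.params.1 X hX

theorem Admissible.vecPrimrec_tDec {n t : α → ℕ} (hn : Primrec n) (ht : Primrec t)
    {X : ∀ a, Fin (n a) → Vec d} (hX : SeqPrimrec n X) {Y : ∀ a, Fin (t a + 1) → Vec d}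
    (hY : SeqPrimrec (fun a => t a + 1) Y) :
    VecPrimrec fun a => T.tDec (T.tEnc (X a)) (Y a) := by
  have hE := hT.seqPrimrec_encode hn hX
  have hK := hE.map hT.params.2.1
  have hV := hE.map hT.params.2.2.1
  have h : ∀ (l : List (LayerParams d)), (∀ θ ∈ l, θ.All PiecewiseRationalMap) →
      ∀ Y : ∀ a, Fin (t a + 1) → Vec d, SeqPrimrec (fun a => t a + 1) Y →
        SeqPrimrec (fun a => t a + 1) fun a =>
          l.foldl (fun Z θ => decLayer T.score T.normalize θ (T.tEnc (X a)).1 (T.tEnc (X a)).2 Z)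
            (Y a) := by
    intro l
    induction l with
    | nil => exact fun _ Y hY => hY
    | cons θ l ih =>
      intro hl Y hY
      exact ih (fun θ hθ => hl θ (List.mem_cons_of_mem _ hθ)) _
        (SeqPrimrec.decLayer hT.score hT.normalize (hl θ List.mem_cons_self) hn hK hV hY)
  obtain ⟨Z, hZ, hZ'⟩ := h _ hT.params.2.2.2.1 Y hY
  refine fun i => (((hZ.comp (Primrec.id.pair ht)).map hT.params.2.2.2.2) i).of_eq fun a => ?_
  simp only [tDec, hZ', Fin.val_last, id]

end Transformer

end

end TransformerTC

namespace TransformerTC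

open Turing Computability

/-! ### Languages of Transformer recognizers are semidecidable -/

/-- The vector with a given code. -/
def vecOfCode {d : ℕ} (v : Fin d → ℕ × ℕ × ℕ) : Vec d := fun i => ratOfCode (v i)

theorem vecOfCode_surjective (d : ℕ) : Function.Surjective (vecOfCode (d := d)) := fun x => by
  choose v hv using fun i => ratOfCode_surjective (x i)
  exact ⟨v, funext hv⟩

theorem vecPrimrec_vecOfCode {d : ℕ} {α : Type} [Primcodable α] {v : α → Fin d → ℕ × ℕ × ℕ}
    (hv : Primrec v) : VecPrimrec fun a => vecOfCode (v a) :=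
  fun i => RatPrimrec.code.comp (primrec_eval hv i)

/-- The sequence of vectors coded by a list, extended by a constant. -/
def seqOfCode {d : ℕ} (l : List (Fin d → ℕ × ℕ × ℕ)) (i : ℕ) : Vec d :=
  vecOfCode (l.getD i fun _ => (0, 0, 0))

theorem vecPrimrec_seqOfCode {d : ℕ} {α : Type} [Primcodable α]
    {l : α → List (Fin d → ℕ × ℕ × ℕ)} (hl : Primrec l) {i : α → ℕ} (hi : Primrec i) :
    VecPrimrec fun a => seqOfCode (l a) (i a) :=
  vecPrimrec_vecOfCode ((Primrec.list_getD _).comp hl hi)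

theorem exists_seqOfCode {d : ℕ} (x : ℕ → Vec d) (n : ℕ) :
    ∃ l, ∀ i < n, seqOfCode l i = x i := by
  choose v hv using fun i => vecOfCode_surjective d (x i)
  refine ⟨(List.range n).map v, fun i hi => ?_⟩
  simp [seqOfCode, hi, hv]

theorem PrimrecPred.forall_fin {α : Type} [Primcodable α] {d : ℕ} {p : α → Fin d → Prop}
    (hp : ∀ i, PrimrecPred fun a => p a i) : PrimrecPred fun a => ∀ i, p a i := by
  classical
  have h : PrimrecRel fun (i : Fin d) (a : α) => p a i := by
    have : Primrec₂ fun (i : Fin d) (a : α) => decide (p a i) :=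
      Primrec.fin_curry₁.2 fun i => (hp i).decide
    exact ⟨inferInstance, this⟩
  exact (h.forall_mem_list.comp (Primrec.const (List.finRange d)) Primrec.id).of_eq
    fun a => by simp

theorem VecPrimrec.const {α : Type} [Primcodable α] {d : ℕ} (x : Vec d) :
    VecPrimrec fun _ : α => x := fun _ => RatPrimrec.const _

theorem VecPrimrec.eq {α : Type} [Primcodable α] {d : ℕ} {x y : α → Vec d} (hx : VecPrimrec x)
    (hy : VecPrimrec y) : PrimrecPred fun a => x a = y a :=
  (PrimrecPred.forall_fin fun i => (hx i).eq (hy i)).of_eq fun _ => funext_iff.symm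

section Witness

variable {α : Type} [Primcodable α] {d : ℕ} {n r : α → ℕ} {X Y P : α → List (Fin d → ℕ × ℕ × ℕ)}

theorem primrecPred_positions (hr : Primrec r) (hP : Primrec P)
    {G : List Bool → List VecSym} (hG : Primrec G) : PrimrecPred fun a =>
      ∀ i < r a, encodeVec (seqOfCode (P a) i) = G (encodeNat (i + 1)) :=
  PrimrecPred.forall_lt_nat hr (Primrec.eq.comp (primrec_encodeVec (vecPrimrec_seqOfCode
    (hP.comp Primrec.fst) Primrec.snd))
      (hG.comp (primrec_encodeNat.comp (Primrec.succ.comp Primrec.snd))))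

theorem primrecPred_outputs {T : Transformer d} (hT : T.Admissible) (hn : Primrec n)
    (hr : Primrec r) (hX : Primrec X) (hY : Primrec Y) (hP : Primrec P) : PrimrecPred fun a =>
      ∀ t < r a, seqOfCode (Y a) (t + 1) =
        T.tDec (T.tEnc fun i : Fin (n a) => seqOfCode (X a) i + seqOfCode (P a) i)
          (fun j : Fin (t + 1) => seqOfCode (Y a) j + seqOfCode (P a) j) := by
  have hseq : ∀ {l : α → List (Fin d → ℕ × ℕ × ℕ)}, Primrec l →
      VecPrimrec fun p : (α × ℕ) × ℕ => seqOfCode (l p.1.1) p.2 := fun hl =>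
    vecPrimrec_seqOfCode (hl.comp (Primrec.fst.comp Primrec.fst)) Primrec.snd
  refine PrimrecPred.forall_lt_nat hr (VecPrimrec.eq
    (vecPrimrec_seqOfCode (hY.comp Primrec.fst) (Primrec.succ.comp Primrec.snd))
    (hT.vecPrimrec_tDec (hn.comp Primrec.fst) Primrec.snd
      (SeqPrimrec.of_vecPrimrec ((hseq hX).add (hseq hP)) fun a i => rfl)
      (SeqPrimrec.of_vecPrimrec ((hseq hY).add (hseq hP)) fun a i => rfl)))

end Witness

variable {S : Type} [Fintype S] [Primcodable S] {d : ℕ}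

/-- Acceptance by a recognizer is witnessed by a number `r`, the outputs up to time `r + 1` and
the values of the positional encoding that are used. -/
theorem exists_primrecRel_accepts_iff {A : Recognizer S d}
    (hA : A.network ∈ transformersWithPos d) :
    ∃ R : List S → ℕ × List (Fin d → ℕ × ℕ × ℕ) × List (Fin d → ℕ × ℕ × ℕ) → Prop,
      PrimrecRel R ∧ ∀ w, A.Accepts w ↔ ∃ z, R w z := by
  obtain ⟨T, hT, pos, ⟨cp, hp, hpt⟩, hnet⟩ := hA
  obtain ⟨cf, hf, hft⟩ := A.final_linear
  obtain ⟨G, hG, hGpos⟩ := exists_primrec_of_time hp hpt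
  obtain ⟨H, hH, hHfin⟩ := exists_primrec_of_time hf hft
  choose emb hemb using fun a => vecOfCode_surjective d (A.embed a)
  have hX : Primrec fun w : List S => w.map emb :=
    Primrec.list_map Primrec.id ((Primrec.dom_finite emb).comp Primrec.snd).to₂
  have hembed : ∀ (w : List S) (i : Fin w.length),
      seqOfCode (w.map emb) i = A.embed (w.get i) := fun w i => by
    simp [seqOfCode, hemb]
  -- Outputs and positional values are guessed and verified. `G` yields only the encodings of the
  -- positional values, and injectivity of `encodeVec` identifies the guesses without decoding. For
  -- the outputs it suffices to check the recurrence. The first bound covers both the input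
  -- positions up to |w| and the decoder positions up to r + 1.
  refine ⟨fun w z =>
    (∀ i < w.length + z.1 + 1, encodeVec (seqOfCode z.2.2 i) = G (encodeNat (i + 1))) ∧
    seqOfCode z.2.1 0 = A.seed ∧
    (∀ t < z.1 + 1, seqOfCode z.2.1 (t + 1) =
      T.tDec (T.tEnc fun i : Fin w.length => seqOfCode (w.map emb) i + seqOfCode z.2.2 i)
        (fun j : Fin (t + 1) => seqOfCode z.2.1 j + seqOfCode z.2.2 j)) ∧
    H (encodeVec (seqOfCode z.2.1 (z.1 + 1))) = encodeBool true, ?_, fun w => ?_⟩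
  · have hz : Primrec fun p : List S × ℕ × List (Fin d → ℕ × ℕ × ℕ) ×
        List (Fin d → ℕ × ℕ × ℕ) => p.2 := Primrec.snd
    have hr := Primrec.fst.comp hz
    have hr' := RatPrimrec.primrec_add hr (Primrec.const 1)
    have hY := Primrec.fst.comp (Primrec.snd.comp hz)
    have hP := Primrec.snd.comp (Primrec.snd.comp hz)
    have hn : Primrec fun p : List S × ℕ × List (Fin d → ℕ × ℕ × ℕ) ×
        List (Fin d → ℕ × ℕ × ℕ) => p.1.length := Primrec.list_length.comp Primrec.fst
    exact (primrecPred_positions (RatPrimrec.primrec_add (RatPrimrec.primrec_add hn hr)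
      (Primrec.const 1)) hP hG).and (((vecPrimrec_seqOfCode hY (Primrec.const 0)).eq
        (VecPrimrec.const _)).and ((primrecPred_outputs hT hn hr' (hX.comp Primrec.fst) hY hP).and
          (Primrec.eq.comp (hH.comp (primrec_encodeVec (vecPrimrec_seqOfCode hY hr')))
            (Primrec.const _))))
  · have hacc : A.Accepts w ↔ ∃ r,
        T.out pos (fun i => A.embed (w.get i)) A.seed (r + 1) ∈ A.final := by
      rw [Recognizer.Accepts, hnet]
      rfl
    have hH' : ∀ y, H (encodeVec y) = encodeBool true ↔ y ∈ A.final := fun y => by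
      rw [hHfin]
      simp [encodeBool]
    rw [hacc]
    constructor
    · rintro ⟨r, hr⟩
      obtain ⟨P, hP⟩ := exists_seqOfCode (fun i => pos (i + 1)) (w.length + r + 1)
      obtain ⟨Y, hY⟩ := exists_seqOfCode (T.out pos (fun i => A.embed (w.get i)) A.seed) (r + 2)
      refine ⟨(r, Y, P), fun i hi => by rw [hP i hi, hGpos], hY 0 (by omega), fun t ht => ?_,
        (hH' _).2 (by rw [hY (r + 1) (by omega)]; exact hr)⟩
      dsimp only at ht ⊢
      rw [hY (t + 1) (by omega), T.out_succ]
      congr 2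
      · funext i
        rw [hembed, hP i (by omega)]
      · funext j
        rw [hY j (by omega), hP j (by omega)]
    · rintro ⟨⟨r, Y, P⟩, hP, hY0, hY, hfin⟩
      dsimp only at hP hY0 hY hfin
      have hP' : ∀ i < w.length + r + 1, seqOfCode P i = pos (i + 1) := fun i hi =>
        encodeVec_injective d (by rw [hP i hi, hGpos])
      have hYout : ∀ t ≤ r + 1,
          seqOfCode Y t = T.out pos (fun i => A.embed (w.get i)) A.seed t := by
        intro t
        induction t using Nat.strong_induction_on with
        | _ t ih =>
          intro ht
          cases t with
          | zero => exact hY0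
          | succ t =>
            rw [hY t (by omega), T.out_succ]
            congr 2
            · funext i
              rw [hembed, hP' i (by omega)]
            · funext j
              rw [ih j (by omega) (by omega), hP' j (by omega)]
      exact ⟨r, by rw [← hYout (r + 1) le_rfl]; exact (hH' _).1 hfin⟩

/-- Languages with primitive recursive witnesses are recognized by Turing machines. -/
theorem exists_accepts_iff_of_primrecRel {Z : Type} [Primcodable Z] {R : List S → Z → Prop}
    (hR : PrimrecRel R) : ∃ M : TuringMachine S, ∀ w, M.Accepts w ↔ ∃ z, R w z := by
  classical
  let R' : List S → ℕ → Bool := fun w k =>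
    ((Encodable.decode (α := Z) k).map fun z => decide (R w z)).getD false
  have hR' : Primrec₂ R' :=
    Primrec.option_getD.comp (Primrec.option_map (Primrec.decode.comp Primrec.snd)
      (hR.decide.comp (Primrec.fst.comp Primrec.fst) Primrec.snd).to₂)
      (Primrec.const false)
  obtain ⟨M, hM⟩ := exists_accepts_iff_of_primrec hR'
  refine ⟨M, fun w => (hM w).trans ⟨?_, ?_⟩⟩
  · rintro ⟨k, hk⟩
    rcases hz : Encodable.decode (α := Z) k with _ | z
    · simp only [R', hz, Option.map_none, Option.getD_none, Bool.false_eq_true] at hk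
    · simp only [R', hz, Option.map_some, Option.getD_some, decide_eq_true_eq] at hk
      exact ⟨z, hk⟩
  · rintro ⟨z, hz⟩
    exact ⟨Encodable.encode z, by simp [R', hz]⟩

/-- The language of a Transformer recognizer is recognized by a Turing machine. -/
theorem exists_language_eq {S : Type} [Fintype S] {d : ℕ} {A : Recognizer S d}
    (hA : A.network ∈ transformersWithPos d) :
    ∃ M : TuringMachine S, M.language = A.language := by
  let _ : Primcodable S := Primcodable.ofEquiv _ (Fintype.equivFin S)
  obtain ⟨R, hR, h⟩ := exists_primrecRel_accepts_iff hA
  classical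
  obtain ⟨M, hM⟩ := exists_accepts_iff_of_primrecRel hR
  exact ⟨M, Set.ext fun w => (hM w).trans (h w).symm⟩

end TransformerTC

namespace TransformerTC

open Turing Computability

/-! ### Recognizers from Turing machines in normal form -/

namespace TuringMachine

variable {S : Type} [Fintype S] {M : TuringMachine S} {d : ℕ}

open Classical in
/-- The recognizer that simulates `M`. -/
noncomputable def recognizer (e : Coord M.Q M.Γ ≃ Fin d) (O : Vec d → Vec d) (P : ℕ → Vec d)
    (hd : 0 < d) : Recognizer S d where
  embed s := fun j => M.embedNet s (e.symm j)
  network := (machineTransformer e O).net P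
  seed := simSeed e
  final := {x | 0 < x ⟨0, hd⟩}
  embed_linear := ⟨1, finiteFunctionComputable encodeVec _, fun _ => by
    simp [finiteFunctionComputable]⟩
  final_linear := by
    classical
    convert linearTime_pos hd (p := fun x => x ∈ {x : Vec d | 0 < x ⟨0, hd⟩}) fun _ => Iff.rfl

theorem language_recognizer (hM : M.NormalForm) {e : Coord M.Q M.Γ ≃ Fin d} {O : Vec d → Vec d}
    {P : ℕ → Vec d} (hp : Positional e P O) (hd : 0 < d) (hacc : (e .acc).val = 0) :
    (recognizer e O P hd).language = M.language := by
  ext w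
  refine Iff.trans ?_ (accepts_iff_simOut hM hp w).symm
  rw [show e .acc = ⟨0, hd⟩ from Fin.ext hacc]
  rfl

end TuringMachine

theorem turingComplete_transformersWithPos : TuringComplete transformersWithPos := by
  intro S _ L
  constructor
  · rintro ⟨d, _, A, hA, rfl⟩
    exact exists_language_eq hA
  · rintro ⟨M, rfl⟩
    obtain ⟨e, hacc, h₁, h₂, -, -⟩ := Coord.exists_equiv_fin M.fold.Q M.fold.Γ
    refine ⟨_, by omega, TuringMachine.recognizer e
      (onCoord e M.fold.transitionInvNet) (TuringMachine.linearPos _) (by omega),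
      ⟨_, TuringMachine.admissible_machineTransformer
        TuringMachine.piecewiseRationalMap_transitionInvNet, _,
        linearTime_linearPos (by omega), rfl⟩, ?_⟩
    rw [TuringMachine.language_recognizer M.normalForm_fold
      (TuringMachine.positional_linearPos h₁ h₂) _ hacc, M.language_fold]

end TransformerTC

theorem theorem3p3 :
    TransformerTC.TuringComplete TransformerTC.transformersWithPos ∧
    ∀ (S : Type) [Fintype S],
      (∀ M : TransformerTC.TuringMachine S, ∃ M' : TransformerTC.TuringMachine S,
        M'.NormalForm ∧ M'.language = M.language) ∧
      ∀ M : TransformerTC.TuringMachine S, M.NormalForm →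
        ∃ (T : TransformerTC.Transformer
              (2 * Fintype.card M.Q + 4 * Fintype.card M.Γ + 11))
          (A : TransformerTC.Recognizer S
              (2 * Fintype.card M.Q + 4 * Fintype.card M.Γ + 11)),
          T.score = TransformerTC.absScore _ ∧
          T.normalize = TransformerTC.hardmax ∧
          T.enc.length = 1 ∧
          T.dec.length = 3 ∧
          T.All TransformerTC.FeedForward ∧
          A.network = T.net (TransformerTC.recipPos _) ∧
          A.language = M.language := by
  refine ⟨TransformerTC.turingComplete_transformersWithPos, fun S _ =>
    ⟨fun M => ⟨M.fold, M.normalForm_fold, M.language_fold⟩, fun M hM => ?_⟩⟩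
  obtain ⟨e, hacc, h₁, h₂, h₃, h₄⟩ := TransformerTC.Coord.exists_equiv_fin M.Q M.Γ
  have hd : 0 < 2 * Fintype.card M.Q + 4 * Fintype.card M.Γ + 11 := by omega
  exact ⟨TransformerTC.TuringMachine.machineTransformer e _,
    TransformerTC.TuringMachine.recognizer e _ _ hd, rfl, rfl, rfl, rfl,
    TransformerTC.TuringMachine.feedForward_machineTransformer (fun _ h => h)
      TransformerTC.TuringMachine.feedForward_transitionNet, rfl,
    TransformerTC.TuringMachine.language_recognizer hM
      (TransformerTC.TuringMachine.positional_recipPos h₁ h₂ h₃ h₄) hd hacc⟩
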